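/- **Setting.** Let $\mathbb A$ be a nonempty finite set of colors. Let $(\sigma,\tau)$ be a weighted substitution on $\mathbb A$: each $a\in\mathbb A$ is assigned a nonempty finite word $\sigma(a)=\sigma(a)_0\sigma(a)_1\cdots$ over $\mathbb A$ and weights $\tau(a)_0,\tau(a)_1,\dots\in(0,1)$, as many as the length $|\sigma(a)|$, with $\sum_i\tau(a)_i=1$. Its iterates are given by $\sigma^0(a)=a$, $\tau^0(a)=1$ and, inductively, by replacing each $\sigma(a)_i$ in $\sigma(a)$ by the word $\sigma^{n-1}(\sigma(a)_i)$ with weights $\tau^n(a)_k=\tau(a)_i\,\tau^{n-1}(\sigma(a)_i)_j$, where $k$ is the position of the $j$-th letter of $\sigma^{n-1}(\sigma(a)_i)$. Assume that $\sigma$ is primitive: there is $n\ge1$ such that every color occurs in $\sigma^n(a)$ for every $a$. Let $G=B(\sigma,\tau)$ be the smallest closed multiplicative subgroup of $\mathbb R_+=(0,\infty)$ that contains all $\tau^n(a)_i$ ($n\ge0$) with $\sigma^n(a)_i=a$, and let $g:\mathbb A\to\mathbb R_+$ satisfy $g(\sigma(a)_i)G=g(a)\tau(a)_iG$ for all $a,i$.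 An admissible tile is an open rectangle $(x_1,x_2)\times(y_1,y_2)$ with $0<y_1<y_2$ and $x_2-x_1=y_1$. A colored tiling $\omega$ is a set of pairs $(R,a)$, $R$ an admissible tile and $a\in\mathbb A$, such that $R\cap R'=\emptyset$ for distinct $(R,a),(R',a')\in\omega$ and the closures of the tiles have union $\mathbb H=\{x+iy: y>0\}$. A net $\omega_n$ converges to $\omega$ if for every $(R,a)\in\omega$ there are $(R_n,a_n)\in\omega_n$ with $a_n=a$ eventually and $R_n\to R$ in the Hausdorff metric. For $\lambda>0$ put $\lambda\omega=\{(\lambda R,a):(R,a)\in\omega\}$. A vertical line is a separating line of $\omega$ if it meets no tile of $\omega$. Let $\Omega'$ be the set of colored tilings $\omega$ such that for every $((x_1,x_2)\times(y_1,y_2),a)\in\omega$ one has $y_1\in g(a)G$ and, for all $0\le i<|\sigma(a)|$, $(R^i,\sigma(a)_i)\in\omega$, where $$R^i=\Bigl(x_1+(x_2-x_1)\sum_{j<i}\tau(a)_j,\ x_1+(x_2-x_1)\sum_{j\le i}\tau(a)_j\Bigr)\times(\tau(a)_iy_1,\,y_1).$$ Let $\Omega=\Omega(\sigma,\tau,g)$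 be the closure of the set of those $\omega\in\Omega'$ that have no separating line. Let $\Theta$ be the set of closed orbits, that is, of the sets $\xi=G\omega$ with $\omega\in\Omega$ and $\lambda\omega=\omega$ for some $\lambda\in G$, $\lambda>1$; such $\lambda$ are the multiplicative cycles of $\xi$. Let $c(\xi)$ be the minimum multiplicative cycle of $\xi$, and let $\Theta_0$ be the set of $\xi\in\Theta$ whose elements have a separating line. For $\alpha\in\mathbb C$ define the $\mathbb A\times\mathbb A$ matrices $$(M_\alpha)_{a,a'}=\sum_{i:\,\sigma(a)_i=a'}\tau(a)_i^\alpha,\qquad (M_{\alpha,+})_{a,a'}=\mathbf 1_{\sigma(a)_0=a'}\,\tau(a)_0^\alpha,\qquad (M_{\alpha,-})_{a,a'}=\mathbf 1_{\sigma(a)_{|\sigma(a)|-1}=a'}\,\tau(a)_{|\sigma(a)|-1}^\alpha .$$ **Theorem 4.1.** The minimum $c(\xi)$ exists for every $\xi\in\Theta$. The product $$\zeta_\Omega(\alpha)=\prod_{\xi\in\Theta}\bigl(1-c(\xi)^{-\alpha}\bigr)^{-1}$$ converges absolutely (i.e. $\sum_{\xi\in\Theta}|c(\xi)^{-\alpha}|<\infty$)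 for $\operatorname{Re}\alpha>1$, and $\zeta_\Omega$ has a unique meromorphic extension to $\mathbb C$, again denoted $\zeta_\Omega$. The set $\Theta_0$ is finite, $\det(I-M_\alpha)\neq0$ for $\operatorname{Re}\alpha>1$, and $$\zeta_\Omega(\alpha)=\frac{\det(I-M_{\alpha,+})\,\det(I-M_{\alpha,-})}{\det(I-M_\alpha)}\,\zeta_{\Sigma_0}(\alpha),\qquad \zeta_{\Sigma_0}(\alpha)=\prod_{\xi\in\Theta_0}\bigl(1-c(\xi)^{-\alpha}\bigr)^{-1},$$ as an identity of meromorphic functions on $\mathbb C$; in particular it holds at every $\alpha\in\mathbb C$ at which $\det(I-M_\alpha)\ne0$ and $c(\xi)^{-\alpha}\neq1$ for all $\xi\in\Theta_0$. -/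

import Mathlib

open scoped Pointwise

noncomputable section

/-- The multiplicative group of positive real numbers, with its usual topology. -/
abbrev PosReal : Type := {x : ℝ // 0 < x}

/-! ### Colored tilings of the upper half plane -/

/-- An admissible tile: an open rectangle `(x₁, x₂) × (y₁, y₂)` of the upper half plane
with `x₂ - x₁ = y₁`. -/
@[ext]
structure AdmissibleTile where
  x₁ : ℝ
  x₂ : ℝ
  y₁ : ℝ
  y₂ : ℝ
  y₁_pos : 0 < y₁
  y₁_lt_y₂ : y₁ < y₂
  width_eq : x₂ - x₁ = y₁

namespace AdmissibleTile

/-- The rectangle itself, as a subset of the complex plane. -/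
def toSet (R : AdmissibleTile) : Set ℂ :=
  Set.Ioo R.x₁ R.x₂ ×ℂ Set.Ioo R.y₁ R.y₂

/-- The tile `l R = (l x₁, l x₂) × (l y₁, l y₂)`. -/
def scale (l : PosReal) (R : AdmissibleTile) : AdmissibleTile where
  x₁ := l * R.x₁
  x₂ := l * R.x₂
  y₁ := l * R.y₁
  y₂ := l * R.y₂
  y₁_pos := mul_pos l.2 R.y₁_pos
  y₁_lt_y₂ := mul_lt_mul_of_pos_left R.y₁_lt_y₂ l.2
  width_eq := by rw [← mul_sub, R.width_eq]

lemma one_scale (R : AdmissibleTile) : scale 1 R = R := by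
  ext <;> simp [scale]

lemma mul_scale (l m : PosReal) (R : AdmissibleTile) :
    scale (l * m) R = scale l (scale m R) := by
  ext <;> simp [scale, mul_assoc]

lemma mem_toSet {R : AdmissibleTile} {z : ℂ} :
    z ∈ R.toSet ↔ (R.x₁ < z.re ∧ z.re < R.x₂) ∧ (R.y₁ < z.im ∧ z.im < R.y₂) := Iff.rfl

lemma x₁_lt_x₂ (R : AdmissibleTile) : R.x₁ < R.x₂ := by
  have h := R.width_eq
  have h' := R.y₁_pos
  linarith

lemma mem_closure_toSet {R : AdmissibleTile} {z : ℂ} :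
    z ∈ closure R.toSet ↔
      (R.x₁ ≤ z.re ∧ z.re ≤ R.x₂) ∧ (R.y₁ ≤ z.im ∧ z.im ≤ R.y₂) := by
  rw [toSet, Complex.closure_reProdIm, closure_Ioo R.x₁_lt_x₂.ne, closure_Ioo R.y₁_lt_y₂.ne]
  rfl

lemma mul_mem_scale_toSet {l : PosReal} {R : AdmissibleTile} {z : ℂ} :
    ((l : ℝ) : ℂ) * z ∈ (scale l R).toSet ↔ z ∈ R.toSet := by
  simp only [mem_toSet, scale, Complex.re_ofReal_mul,
    Complex.im_ofReal_mul, mul_lt_mul_iff_right₀ l.2]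

lemma mul_mem_closure_scale_toSet {l : PosReal} {R : AdmissibleTile} {z : ℂ} :
    ((l : ℝ) : ℂ) * z ∈ closure (scale l R).toSet ↔ z ∈ closure R.toSet := by
  simp only [mem_closure_toSet, scale, Complex.re_ofReal_mul,
    Complex.im_ofReal_mul, mul_le_mul_iff_right₀ l.2]

end AdmissibleTile

lemma PosReal.exists_mul_eq (l : PosReal) (z : ℂ) : ∃ w : ℂ, ((l : ℝ) : ℂ) * w = z := by
  refine ⟨((l : ℝ) : ℂ)⁻¹ * z, ?_⟩
  have h : ((l : ℝ) : ℂ) ≠ 0 := by exact_mod_cast l.2.ne'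
  rw [mul_inv_cancel_left₀ h]

/-- A colored tiling of the upper half plane with colors in `A`. -/
@[ext]
structure ColoredTiling (A : Type*) where
  tiles : Set (AdmissibleTile × A)
  disjoint : ∀ p ∈ tiles, ∀ q ∈ tiles, p ≠ q → p.1.toSet ∩ q.1.toSet = ∅
  cover : ⋃ p ∈ tiles, closure p.1.toSet = {z : ℂ | 0 < z.im}

namespace ColoredTiling

variable {A : Type*}

/-- The topology of the space of colored tilings: `ω_n → ω` if and only if for every
`(R, a) ∈ ω` there are `(R_n, a_n) ∈ ω_n` with `a_n = a` eventually and `R_n → R` in the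
Hausdorff metric. It is generated by the sets of those `ω` that have a tile of color `a`
at Hausdorff distance less than `ε` from `R`. -/
instance : TopologicalSpace (ColoredTiling A) :=
  TopologicalSpace.generateFrom
    {U | ∃ (R : AdmissibleTile) (a : A) (ε : ℝ), 0 < ε ∧
      U = {ω | ∃ R' : AdmissibleTile, (R', a) ∈ ω.tiles ∧
        Metric.hausdorffDist R.toSet R'.toSet < ε}}

/-- The tiling `l ω = {(l R, a) ; (R, a) ∈ ω}`. -/
def scale (l : PosReal) (ω : ColoredTiling A) : ColoredTiling A where
  tiles := (fun p : AdmissibleTile × A => (p.1.scale l, p.2)) '' ω.tiles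
  disjoint := by
    rintro _ ⟨p, hp, rfl⟩ _ ⟨q, hq, rfl⟩ hne
    have hpq : p ≠ q := fun h => hne (by rw [h])
    rw [Set.eq_empty_iff_forall_notMem]
    rintro z ⟨hz₁, hz₂⟩
    obtain ⟨w, rfl⟩ := l.exists_mul_eq z
    have h : w ∈ p.1.toSet ∩ q.1.toSet :=
      ⟨AdmissibleTile.mul_mem_scale_toSet.1 hz₁, AdmissibleTile.mul_mem_scale_toSet.1 hz₂⟩
    rw [ω.disjoint p hp q hq hpq] at h
    exact h
  cover := by
    ext z
    obtain ⟨w, rfl⟩ := l.exists_mul_eq z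
    have h := Set.ext_iff.1 ω.cover w
    simp only [Set.mem_iUnion, exists_prop, Set.mem_ofPred_eq] at h
    simp only [Set.biUnion_image, Set.mem_iUnion, exists_prop, Set.mem_ofPred_eq,
      AdmissibleTile.mul_mem_closure_scale_toSet, Complex.im_ofReal_mul,
      mul_pos_iff_of_pos_left l.2]
    exact h

instance : MulAction PosReal (ColoredTiling A) where
  smul := scale
  one_smul ω := by
    change scale 1 ω = ω
    ext1
    simp [scale, AdmissibleTile.one_scale]
  mul_smul l m ω := by
    change scale (l * m) ω = scale l (scale m ω)
    ext1
    simp only [scale, Set.image_image, AdmissibleTile.mul_scale]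

/-- The vertical line with abscissa `x` meets no tile of `ω`. -/
def IsSeparatingLine (ω : ColoredTiling A) (x : ℝ) : Prop :=
  ∀ p ∈ ω.tiles, p.1.toSet ∩ {z : ℂ | z.re = x} = ∅

def HasSeparatingLine (ω : ColoredTiling A) : Prop :=
  ∃ x : ℝ, ω.IsSeparatingLine x

end ColoredTiling

/-! ### Weighted substitutions -/

/-- A weighted substitution `(σ, τ)`: the color `a` is replaced by the word
`σ(a)₀ σ(a)₁ ⋯` of length `len a`, whose letters carry the weights
`τ(a)₀, τ(a)₁, …` in `(0, 1)`, of sum `1`. -/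
structure WeightedSubstitution (A : Type*) where
  len : A → ℕ
  len_pos : ∀ a, 0 < len a
  σ : (a : A) → Fin (len a) → A
  τ : (a : A) → Fin (len a) → PosReal
  τ_lt_one : ∀ a i, (τ a i : ℝ) < 1
  τ_sum : ∀ a, ∑ i, (τ a i : ℝ) = 1

namespace AdmissibleTile

variable {A : Type*}

/-- The `i`-th child of a tile of color `a`. -/
def child (s : WeightedSubstitution A) (R : AdmissibleTile) (a : A) (i : Fin (s.len a)) :
    AdmissibleTile where
  x₁ := R.x₁ + (R.x₂ - R.x₁) * ∑ j ∈ Finset.Iio i, (s.τ a j : ℝ)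
  x₂ := R.x₁ + (R.x₂ - R.x₁) * ∑ j ∈ Finset.Iic i, (s.τ a j : ℝ)
  y₁ := s.τ a i * R.y₁
  y₂ := R.y₁
  y₁_pos := mul_pos (s.τ a i).2 R.y₁_pos
  y₁_lt_y₂ := mul_lt_of_lt_one_left R.y₁_pos (s.τ_lt_one a i)
  width_eq := by
    rw [← Finset.Iio_insert i, Finset.sum_insert (by simp), R.width_eq]
    ring

end AdmissibleTile

namespace WeightedSubstitution

variable {A : Type*} (s : WeightedSubstitution A)

/-- The word `(σⁿ(a)₀, τⁿ(a)₀) (σⁿ(a)₁, τⁿ(a)₁) ⋯` of the iterated weighted substitution. -/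
def iter : ℕ → A → List (A × PosReal)
  | 0, a => [(a, 1)]
  | n + 1, a =>
    (List.ofFn fun i : Fin (s.len a) =>
      (iter n (s.σ a i)).map fun p => (p.1, s.τ a i * p.2)).flatten

/-- `σ` is primitive: for some `n ≥ 1`, every color occurs in every word `σⁿ(a)`. -/
def IsPrimitive : Prop :=
  ∃ n : ℕ, 0 < n ∧ ∀ a a' : A, ∃ w : PosReal, (a', w) ∈ s.iter n a

/-- The base set `B(σ, τ)`: the smallest closed subgroup of the positive reals that contains
every `τⁿ(a)ᵢ` with `σⁿ(a)ᵢ = a`. -/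
def base : Subgroup PosReal :=
  sInf {H : Subgroup PosReal | IsClosed (H : Set PosReal) ∧
    {w : PosReal | ∃ (a : A) (n : ℕ), (a, w) ∈ s.iter n a} ⊆ (H : Set PosReal)}

/-- `g(σ(a)ᵢ) G = g(a) τ(a)ᵢ G` for all `a` and `i`, where `G = B(σ, τ)`. -/
def IsCompatible (g : A → PosReal) : Prop :=
  ∀ (a : A) (i : Fin (s.len a)),
    g (s.σ a i) • (s.base : Set PosReal) = (g a * s.τ a i) • (s.base : Set PosReal)

/-- The tilings `ω` such that, for every `(R, a) ∈ ω`, the height `y₁` of the lower side of `R`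
is in `g(a) G` and the children of `R`, with their colors `σ(a)ᵢ`, are in `ω`. -/
def tilings (g : A → PosReal) : Set (ColoredTiling A) :=
  {ω | ∀ p ∈ ω.tiles,
    (∃ l ∈ s.base, p.1.y₁ = (g p.2 * l : PosReal)) ∧
    ∀ i : Fin (s.len p.2), (p.1.child s p.2 i, s.σ p.2 i) ∈ ω.tiles}

/-- The space `Ω(σ, τ, g)`. -/
def Omega (g : A → PosReal) : Set (ColoredTiling A) :=
  closure {ω | ω ∈ s.tilings g ∧ ¬ ω.HasSeparatingLine}

/-- The closed orbits of `Ω(σ, τ, g)` under the multiplicative action of `G`. -/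
def closedOrbits (g : A → PosReal) : Set (Set (ColoredTiling A)) :=
  {ξ | ∃ ω ∈ s.Omega g, (∃ l ∈ s.base, 1 < l ∧ l • ω = ω) ∧ ξ = MulAction.orbit s.base ω}

/-- The closed orbits with a separating line. -/
def separatedClosedOrbits (g : A → PosReal) : Set (Set (ColoredTiling A)) :=
  {ξ ∈ s.closedOrbits g | ∃ ω ∈ ξ, ω.HasSeparatingLine}

/-- The multiplicative cycles of an orbit. -/
def multiplicativeCycles (ξ : Set (ColoredTiling A)) : Set ℝ :=
  {c | ∃ l ∈ s.base, 1 < l ∧ (∃ ω ∈ ξ, l • ω = ω) ∧ c = (l : ℝ)}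

/-- The minimum multiplicative cycle of a closed orbit. -/
def minCycle (ξ : Set (ColoredTiling A)) : ℝ :=
  sInf (s.multiplicativeCycles ξ)

/-- `Z` is the `ζ`-function of the multiplicative action on `Ω(σ, τ, g)`: the meromorphic
function on the whole plane (in normal form: it takes its limit value wherever that is finite,
and the value `0` at its poles) that is the product over the closed orbits for `Re α > 1`. -/
def IsZetaFunction (g : A → PosReal) (Z : ℂ → ℂ) : Prop :=
  MeromorphicNFOn Z Set.univ ∧
  ∀ α : ℂ, 1 < α.re →
    HasProd (fun ξ : s.closedOrbits g => (1 - (s.minCycle ξ.1 : ℂ) ^ (-α))⁻¹) (Z α)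

/-- The product over the closed orbits with a separating line. -/
def zetaSep (g : A → PosReal) (α : ℂ) : ℂ :=
  ∏ᶠ ξ ∈ s.separatedClosedOrbits g, (1 - (s.minCycle ξ : ℂ) ^ (-α))⁻¹

variable [DecidableEq A]

def M (α : ℂ) : Matrix A A ℂ :=
  Matrix.of fun a a' => ∑ i : Fin (s.len a), if s.σ a i = a' then ((s.τ a i : ℝ) : ℂ) ^ α else 0

def first (a : A) : Fin (s.len a) := ⟨0, s.len_pos a⟩

def last (a : A) : Fin (s.len a) := ⟨s.len a - 1, Nat.sub_lt (s.len_pos a) Nat.one_pos⟩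

def MPlus (α : ℂ) : Matrix A A ℂ :=
  Matrix.of fun a a' =>
    if s.σ a (s.first a) = a' then ((s.τ a (s.first a) : ℝ) : ℂ) ^ α else 0

def MMinus (α : ℂ) : Matrix A A ℂ :=
  Matrix.of fun a a' =>
    if s.σ a (s.last a) = a' then ((s.τ a (s.last a) : ℝ) : ℂ) ^ α else 0

end WeightedSubstitution

end

/-! The letters of the words σ(a) are the edges of a finite directed multigraph on the colors: the
i-th letter of σ(a) leads from a to σ(a)_i and has weight τ(a)_i^α. For Re α > 1 the row sums of
|τ^α| are less than 1, so the series of log det(I - M_α) may be rearranged, and 1/det(I - M_α) is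
the product of (1 - weight)⁻¹ over the cycles (`hasProd_cycleProd`). The matrices M_{α,+} and
M_{α,-} keep only first, respectively last, letters; their determinants remove exactly the cycles
made of first letters only or of last letters only, and the interior cycles remain
(`hasProd_interior`).

On the geometric side, a tiling is rigid downwards: of two tiles over a common interval, the lower
one descends from the higher one (`desc_of_overlap`). If λω = ω with λ > 1 and the origin lies
strictly inside the base of a tile p, every tile descends from some λⁿp, so p and λ determine ω
(`eq_of_smul_eq`). The descendants of p above the origin form a chain that contains λ⁻¹p, and
therefore a periodic path in the multigraph. Conversely, an interior periodic path prescribes the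
relative position of the origin in a tile, and the enlargements of one such tile span an invariant
tiling. Thus interior cycles correspond to closed orbits without separating line, and the minimum
cycle of the orbit is the inverse of the product of the weights τ along the cycle
(`exists_interior_equiv`).

If an invariant tiling has a separating line, the vertical axis is one. Its orbit is then determined
by the colors of two tiles meeting at the axis and the ratio of their heights. Such a tiling is a
limit of tilings without separating line, where two touching tiles descend from children of one
tile, along last letters on the left and first letters on the right. Invariance under a single λ
makes these two runs commensurable, which leaves finitely many ratios
(`finite_separatedClosedOrbits`). The remaining factor is thus a finite product, and the formula
extends from Re α > 1 to the plane by the identity theorem. -/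

/-! ### Eigenvalues, traces and determinants -/

open Polynomial in
theorem Matrix.det_aeval_eq_prod_roots_charpoly {n : Type*} [Fintype n] [DecidableEq n]
    (M : Matrix n n ℂ) (p : ℂ[X]) :
    (aeval M p).det = (M.charpoly.roots.map fun μ => p.eval μ).prod := by
  -- This is the case p = X - r, read off from the characteristic polynomial at r. Both sides are
  -- multiplicative in p, and p splits into linear factors.
  have key : ∀ r : ℂ, (M - algebraMap ℂ _ r).det =
      (M.charpoly.roots.map fun μ => μ - r).prod := by
    intro r
    have h1 : M.charpoly.eval r = (M.charpoly.roots.map fun μ => r - μ).prod := by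
      rw [(IsAlgClosed.splits M.charpoly).eval_eq_prod_roots_of_monic M.charpoly_monic]
    have hc : Multiset.card M.charpoly.roots = Fintype.card n := by
      rw [← (IsAlgClosed.splits M.charpoly).natDegree_eq_card_roots, M.charpoly_natDegree_eq_dim]
    have h2 : M - algebraMap ℂ _ r = -(Matrix.scalar n r - M) := by
      rw [neg_sub]; rfl
    rw [h2, Matrix.det_neg, ← Matrix.eval_charpoly, h1, ← hc]
    rw [← Multiset.card_map (fun μ => r - μ), ← Multiset.prod_map_neg, Multiset.map_map]
    simp
  have hp := (IsAlgClosed.splits p).eq_prod_roots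
  conv_lhs => rw [hp]
  conv_rhs => rw [hp]
  have hc : Multiset.card M.charpoly.roots = Fintype.card n := by
    rw [← (IsAlgClosed.splits M.charpoly).natDegree_eq_card_roots, M.charpoly_natDegree_eq_dim]
  simp only [map_mul, aeval_C, Matrix.det_mul, eval_mul, eval_C, Multiset.prod_map_mul]
  congr 1
  · rw [Algebra.algebraMap_eq_smul_one, Matrix.det_smul]
    simp [hc]
  · generalize p.roots = s
    induction s using Multiset.induction_on with
    | empty => simp
    | cons a s ih =>
      simp only [Multiset.map_cons, Multiset.prod_cons, map_mul, Matrix.det_mul, ih, eval_mul,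
        Multiset.prod_map_mul]
      congr 1
      rw [map_sub, aeval_X, aeval_C, key]
      simp

open Polynomial in
theorem Matrix.trace_pow_eq_sum_roots_charpoly {n : Type*} [Fintype n] [DecidableEq n]
    (M : Matrix n n ℂ) (k : ℕ) :
    (M ^ k).trace = (M.charpoly.roots.map fun μ => μ ^ k).sum := by
  have h : (M ^ k).charpoly =
      ((M.charpoly.roots.map fun μ => μ ^ k).map fun a => X - C a).prod := by
    refine Polynomial.funext fun x => ?_
    rw [Matrix.eval_charpoly]
    -- Evaluating the determinant formula at x - X^k for every x shows that the eigenvalues of M^k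
    -- are the k-th powers of those of M, with multiplicity.
    have := M.det_aeval_eq_prod_roots_charpoly (C x - X ^ k)
    simp only [map_sub, aeval_C, map_pow, aeval_X, eval_sub, eval_C, eval_pow, eval_X] at this
    rw [eval_multiset_prod]
    simp only [Multiset.map_map, Function.comp_def, eval_sub, eval_X, eval_C]
    exact this
  rw [Matrix.trace_eq_sum_roots_charpoly, h, Polynomial.roots_multiset_prod_X_sub_C]

theorem Matrix.norm_le_of_mem_roots_charpoly {n : Type*} [Fintype n] [DecidableEq n]
    (M : Matrix n n ℂ) {r : ℝ} (hr : ∀ i, ∑ j, ‖M i j‖ ≤ r) {μ : ℂ} (hμ : μ ∈ M.charpoly.roots) :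
    ‖μ‖ ≤ r := by
  have h0 : M.charpoly.IsRoot μ := (Polynomial.mem_roots'.1 hμ).2
  have h1 : (Matrix.scalar n μ - M).det = 0 := by rw [← Matrix.eval_charpoly]; exact h0
  obtain ⟨v, hv, hMv⟩ := Matrix.exists_mulVec_eq_zero_iff.2 h1
  rw [Matrix.sub_mulVec, sub_eq_zero] at hMv
  have hne : Nonempty n := by
    by_contra h
    rw [not_nonempty_iff] at h
    exact hv (Subsingleton.elim _ _)
  -- The eigenvector equation is read at a coordinate of maximal modulus.
  obtain ⟨i, -, hi⟩ := Finset.exists_max_image Finset.univ (fun i => ‖v i‖) Finset.univ_nonempty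
  have hvi : 0 < ‖v i‖ := by
    obtain ⟨j, hj⟩ := Function.ne_iff.1 hv
    exact (norm_pos_iff.2 hj).trans_le (hi j (Finset.mem_univ _))
  have h2 : μ * v i = ∑ j, M i j * v j := by
    have := congrFun hMv i
    simpa [Matrix.mulVec, dotProduct, Matrix.diagonal_apply] using this
  refine le_of_mul_le_mul_right ?_ hvi
  calc ‖μ‖ * ‖v i‖ = ‖∑ j, M i j * v j‖ := by rw [← norm_mul, h2]
    _ ≤ ∑ j, ‖M i j‖ * ‖v i‖ := by
        refine (norm_sum_le _ _).trans (Finset.sum_le_sum fun j _ => ?_)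
        rw [norm_mul]
        exact mul_le_mul_of_nonneg_left (hi j (Finset.mem_univ _)) (norm_nonneg _)
    _ = (∑ j, ‖M i j‖) * ‖v i‖ := by rw [Finset.sum_mul]
    _ ≤ r * ‖v i‖ := mul_le_mul_of_nonneg_right (hr i) hvi.le

theorem Matrix.det_one_sub_eq_prod_roots_charpoly {n : Type*} [Fintype n] [DecidableEq n]
    (M : Matrix n n ℂ) : (1 - M).det = (M.charpoly.roots.map fun μ => 1 - μ).prod := by
  have := M.det_aeval_eq_prod_roots_charpoly (Polynomial.C 1 - Polynomial.X)
  simpa using this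

theorem Matrix.det_one_sub_ne_zero {n : Type*} [Fintype n] [DecidableEq n]
    (M : Matrix n n ℂ) {r : ℝ} (hr1 : r < 1) (hr : ∀ i, ∑ j, ‖M i j‖ ≤ r) : (1 - M).det ≠ 0 := by
  rw [M.det_one_sub_eq_prod_roots_charpoly]
  refine Multiset.prod_ne_zero fun h => ?_
  obtain ⟨μ, hμ, h⟩ := Multiset.mem_map.1 h
  have := M.norm_le_of_mem_roots_charpoly hr hμ
  rw [sub_eq_zero] at h
  rw [← h] at this
  simp at this
  linarith

/-- All eigenvalues lie in the open unit disc, so the sum splits into the Taylor series of -log(1 -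
μ). Stating only the exponential of the sum avoids choosing a branch of the logarithm of the
determinant. -/
theorem Matrix.hasSum_trace_pow_div {n : Type*} [Fintype n] [DecidableEq n]
    (M : Matrix n n ℂ) {r : ℝ} (hr1 : r < 1) (hr : ∀ i, ∑ j, ‖M i j‖ ≤ r) :
    ∃ S : ℂ, HasSum (fun k : ℕ => (M ^ (k + 1)).trace / (k + 1 : ℕ)) S ∧
      Complex.exp S = ((1 - M).det)⁻¹ := by
  rw [M.det_one_sub_eq_prod_roots_charpoly]
  simp only [M.trace_pow_eq_sum_roots_charpoly]
  have hs : ∀ μ ∈ M.charpoly.roots, ‖μ‖ < 1 := fun μ hμ =>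
    (M.norm_le_of_mem_roots_charpoly hr hμ).trans_lt hr1
  generalize M.charpoly.roots = s at hs
  induction s using Multiset.induction_on with
  | empty => exact ⟨0, by simp, by simp⟩
  | cons μ s ih =>
    obtain ⟨S, hS, he⟩ := ih fun ν hν => hs ν (Multiset.mem_cons_of_mem hν)
    have hμ := hs μ (Multiset.mem_cons_self _ _)
    have h1 : HasSum (fun k : ℕ => μ ^ (k + 1) / (k + 1 : ℕ)) (-Complex.log (1 - μ)) := by
      have := (hasSum_nat_add_iff' 1).2 (Complex.hasSum_taylorSeries_neg_log hμ)
      simpa using this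
    have hne : 1 - μ ≠ 0 := by
      intro h
      rw [sub_eq_zero] at h
      rw [← h] at hμ
      simp at hμ
    refine ⟨-Complex.log (1 - μ) + S, ?_, ?_⟩
    · convert h1.add hS using 2 with k
      rw [Multiset.map_cons, Multiset.sum_cons, add_div]
    · rw [Complex.exp_add, he, Complex.exp_neg, Complex.exp_log hne, Multiset.map_cons,
        Multiset.prod_cons, mul_inv]

/-! ### Cycles of a finite directed multigraph -/

section Cycles

variable {A E : Type*}

/-- The periodic infinite paths of the multigraph with edges `E`. -/
structure PeriodicPath (src tgt : E → A) where
  edge : ℕ → E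
  tgt_edge : ∀ n, tgt (edge n) = src (edge (n + 1))
  exists_period : ∃ d, 0 < d ∧ ∀ n, edge (n + d) = edge n

namespace PeriodicPath

variable {src tgt : E → A}

theorem ext' {x y : PeriodicPath src tgt} (h : ∀ n, x.edge n = y.edge n) : x = y := by
  cases x
  cases y
  congr
  exact funext h

def shift (x : PeriodicPath src tgt) : PeriodicPath src tgt :=
  ⟨fun n => x.edge (n + 1), fun n => x.tgt_edge (n + 1), by
    obtain ⟨d, hd, h⟩ := x.exists_period
    exact ⟨d, hd, fun n => by simpa only [add_right_comm] using h (n + 1)⟩⟩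

theorem shift_iterate_apply (x : PeriodicPath src tgt) (k n : ℕ) :
    (shift^[k] x).edge n = x.edge (n + k) := by
  induction k generalizing n with
  | zero => rfl
  | succ k ih =>
    rw [Function.iterate_succ_apply']
    change (shift^[k] x).edge (n + 1) = _
    rw [ih, add_right_comm, add_assoc]

theorem shift_iterate_eq_self_iff (x : PeriodicPath src tgt) (k : ℕ) :
    shift^[k] x = x ↔ ∀ n, x.edge (n + k) = x.edge n := by
  constructor
  · intro h n
    rw [← shift_iterate_apply, h]
  · intro h
    refine ext' fun n => ?_
    rw [shift_iterate_apply, h]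

theorem mem_periodicPts (x : PeriodicPath src tgt) : x ∈ Function.periodicPts shift := by
  obtain ⟨d, hd, h⟩ := x.exists_period
  exact ⟨d, hd, (shift_iterate_eq_self_iff x d).2 h⟩

noncomputable def period (x : PeriodicPath src tgt) : ℕ := Function.minimalPeriod shift x

theorem period_pos (x : PeriodicPath src tgt) : 0 < x.period :=
  Function.minimalPeriod_pos_of_mem_periodicPts x.mem_periodicPts

theorem shift_iterate_period (x : PeriodicPath src tgt) : shift^[x.period] x = x :=
  Function.iterate_minimalPeriod

theorem period_shift_iterate (x : PeriodicPath src tgt) (k : ℕ) :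
    (shift^[k] x).period = x.period :=
  Function.minimalPeriod_apply_iterate x.mem_periodicPts k

theorem exists_shift_iterate_eq (x : PeriodicPath src tgt) (k : ℕ) :
    ∃ l, shift^[l] (shift^[k] x) = x := by
  -- A multiple of the period that is at least k, so that the truncated subtraction is exact.
  refine ⟨(k + 1) * x.period - k, ?_⟩
  rw [← Function.iterate_add_apply, Nat.sub_add_cancel]
  · exact Function.IsPeriodicPt.const_mul x.shift_iterate_period (k + 1)
  · exact (Nat.le_succ k).trans (Nat.le_mul_of_pos_right _ x.period_pos)

/-- Two periodic paths are equivalent if they run through the same cycle. -/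
def cycleSetoid (src tgt : E → A) : Setoid (PeriodicPath src tgt) where
  r x y := ∃ k, shift^[k] x = y
  iseqv :=
    { refl := fun _ => ⟨0, rfl⟩
      symm := by
        rintro x _ ⟨k, rfl⟩
        exact x.exists_shift_iterate_eq k
      trans := by
        rintro x _ _ ⟨k, rfl⟩ ⟨l, rfl⟩
        exact ⟨l + k, Function.iterate_add_apply _ _ _ _⟩ }

section Weights

variable {R : Type*} [CommMonoid R]

/-- The product of the weights of the first `n` edges. -/
def pathProd (z : E → R) (x : PeriodicPath src tgt) (n : ℕ) : R :=
  ∏ i ∈ Finset.range n, z (x.edge i)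

theorem pathProd_add (z : E → R) (x : PeriodicPath src tgt) (m n : ℕ) :
    x.pathProd z (m + n) = x.pathProd z m * (shift^[m] x).pathProd z n := by
  simp only [pathProd, Finset.prod_range_add, shift_iterate_apply, add_comm _ m]

theorem pathProd_mul (z : E → R) (x : PeriodicPath src tgt) {d : ℕ} (hd : shift^[d] x = x)
    (k : ℕ) : x.pathProd z (k * d) = x.pathProd z d ^ k := by
  induction k with
  | zero => simp [pathProd]
  | succ k ih =>
    rw [Nat.succ_mul, add_comm, pathProd_add, hd, ih, pow_succ']

theorem pathProd_shift (z : E → R) (x : PeriodicPath src tgt) {d : ℕ} (hd : shift^[d] x = x) :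
    x.shift.pathProd z d = x.pathProd z d := by
  cases d with
  | zero => rfl
  | succ d =>
    have h := (shift_iterate_eq_self_iff x (d + 1)).1 hd 0
    rw [zero_add] at h
    simp only [pathProd]
    rw [Finset.prod_range_succ, Finset.prod_range_succ']
    simp only [shift, h]

theorem pathProd_shift_iterate (z : E → R) (x : PeriodicPath src tgt) {d : ℕ}
    (hd : shift^[d] x = x) (k : ℕ) : (shift^[k] x).pathProd z d = x.pathProd z d := by
  induction k with
  | zero => rfl
  | succ k ih =>
    rw [Function.iterate_succ_apply', pathProd_shift, ih]
    rw [← Function.iterate_add_apply, add_comm, Function.iterate_add_apply, hd]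

/-- The product of the weights of the edges of the cycle. -/
noncomputable def cycleProd (z : E → R) : Quotient (cycleSetoid src tgt) → R :=
  Quotient.lift (fun x => x.pathProd z x.period) (by
    rintro x _ ⟨k, rfl⟩
    rw [period_shift_iterate, pathProd_shift_iterate z x x.shift_iterate_period])

end Weights

/-- The periodic paths for which `n` is a period. -/
abbrev Per (src tgt : E → A) (n : ℕ) : Type _ := {x : PeriodicPath src tgt // shift^[n] x = x}

/-- Addition in `Fin (n + 1)` wraps around, so the condition at the last index says that the walk
closes up. This is why the period is written as `n + 1`. -/
def perEquiv (src tgt : E → A) (n : ℕ) :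
    Per src tgt (n + 1) ≃ {v : Fin (n + 1) → E // ∀ i, tgt (v i) = src (v (i + 1))} where
  toFun x := ⟨fun i => x.1.edge i, fun i => by
    rw [x.1.tgt_edge]
    congr 1
    have hx := (shift_iterate_eq_self_iff x.1 (n + 1)).1 x.2 0
    rw [zero_add] at hx
    dsimp only
    rw [Fin.val_add_one]
    split_ifs with h
    · rw [h]; exact hx
    · rfl⟩
  invFun v := ⟨⟨fun k => v.1 (Fin.ofNat (n + 1) k), fun k => by
      rw [v.2]
      have : Fin.ofNat (n + 1) k + 1 = Fin.ofNat (n + 1) (k + 1) := by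
        ext
        simp [Fin.val_add]
      rw [this],
    n + 1, n.succ_pos, fun k => by
      have : Fin.ofNat (n + 1) (k + (n + 1)) = Fin.ofNat (n + 1) k := by
        ext
        simp
      rw [this]⟩, by
      rw [shift_iterate_eq_self_iff]
      intro k
      have : Fin.ofNat (n + 1) (k + (n + 1)) = Fin.ofNat (n + 1) k := by
        ext
        simp
      dsimp only
      rw [this]⟩
  left_inv x := by
    refine Subtype.ext (PeriodicPath.ext' fun k => ?_)
    change x.1.edge (k % (n + 1)) = x.1.edge k
    have hx := (shift_iterate_eq_self_iff x.1 (n + 1)).1 x.2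
    exact Function.Periodic.map_mod_nat hx k
  right_inv v := by
    refine Subtype.ext (funext fun i => ?_)
    change v.1 (Fin.ofNat (n + 1) i) = v.1 i
    simp

instance [Finite E] (n : ℕ) : Finite (Per src tgt (n + 1)) :=
  Finite.of_equiv _ (perEquiv src tgt n).symm

end PeriodicPath

end Cycles
open PeriodicPath

/-! ### Closed walks and traces of powers -/

section EdgeMatrix

variable {A E : Type*} [Fintype A] [DecidableEq A] [Fintype E] {R : Type*} [CommRing R]

/-- The matrix of the sums of the weights of the edges with given ends. -/
def edgeMatrix (src tgt : E → A) (z : E → R) : Matrix A A R :=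
  Matrix.of fun a b => ∑ e, if src e = a ∧ tgt e = b then z e else 0

theorem edgeMatrix_pow_apply (src tgt : E → A) (z : E → R) (n : ℕ) (a b : A) :
    (edgeMatrix src tgt z ^ (n + 1)) a b = ∑ v : Fin (n + 1) → E,
      if src (v 0) = a ∧ (∀ i : Fin n, tgt (v i.castSucc) = src (v i.succ)) ∧
        tgt (v (Fin.last n)) = b then ∏ i, z (v i) else 0 := by
  induction n generalizing a with
  | zero =>
    simp only [zero_add, pow_one, edgeMatrix, Matrix.of_apply]
    refine Fintype.sum_equiv (Equiv.funUnique (Fin 1) E).symm _ _ fun e => ?_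
    simp [Equiv.funUnique]
  | succ n ih =>
    rw [pow_succ', Matrix.mul_apply]
    simp only [ih]
    rw [← (Fin.consEquiv fun _ : Fin (n + 2) => E).sum_comp, Fintype.sum_prod_type]
    simp only [edgeMatrix, Matrix.of_apply, Finset.sum_mul, Finset.mul_sum]
    rw [Finset.sum_congr rfl fun _ _ => Finset.sum_comm, Finset.sum_comm]
    refine Finset.sum_congr rfl fun e _ => ?_
    rw [Finset.sum_comm]
    refine Finset.sum_congr rfl fun v _ => ?_
    -- Once the first edge is fixed, the intermediate vertex must be its target.
    rw [Finset.sum_eq_single (tgt e)]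
    · simp only [Fin.consEquiv_apply, Fin.cons_zero, Fin.forall_fin_succ, Fin.castSucc_zero,
        Fin.cons_succ, Fin.prod_univ_succ (n := n + 1), ← Fin.succ_last, ← Fin.succ_castSucc]
      by_cases h1 : src e = a
      · by_cases h2 : src (v 0) = tgt e
        · simp [h1, h2]
        · simp [h1, h2, Ne.symm h2]
      · simp [h1]
    · intro b _ hb
      simp [Ne.symm hb]
    · simp

/-- A diagonal entry collects the walks that return to their starting vertex; summing over the
vertices gives each closed walk once, and `perEquiv` reads it as a periodic path. -/
theorem trace_edgeMatrix_pow (src tgt : E → A) (z : E → R) (n : ℕ)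
    [Fintype (Per src tgt (n + 1))] :
    (edgeMatrix src tgt z ^ (n + 1)).trace =
      ∑ x : Per src tgt (n + 1), x.1.pathProd z (n + 1) := by
  classical
  have h1 : ∀ x : Per src tgt (n + 1), x.1.pathProd z (n + 1) =
      ∏ i, z ((perEquiv src tgt n x).1 i) := fun x => by
    rw [pathProd, Finset.prod_range]
    rfl
  simp only [h1]
  rw [(perEquiv src tgt n).sum_comp fun v => ∏ i, z (v.1 i), Matrix.trace]
  simp only [Matrix.diag_apply, edgeMatrix_pow_apply]
  rw [Finset.sum_comm, ← Finset.sum_subtype (p := fun v => ∀ i, tgt (v i) = src (v (i + 1)))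
    (Finset.univ.filter fun v => ∀ i, tgt (v i) = src (v (i + 1))) (by simp)
    (fun v : Fin (n + 1) → E => ∏ i, z (v i)), Finset.sum_filter]
  refine Finset.sum_congr rfl fun v _ => ?_
  have h2 : (∀ i, tgt (v i) = src (v (i + 1))) ↔
      (∀ i : Fin n, tgt (v i.castSucc) = src (v i.succ)) ∧ tgt (v (Fin.last n)) = src (v 0) := by
    rw [Fin.forall_fin_succ', Fin.last_add_one]
    simp only [Fin.coeSucc_eq_succ]
  rw [Finset.sum_eq_single (src (v 0))]
  · simp only [h2, true_and]
  · intro b _ hb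
    simp [Ne.symm hb]
  · simp

end EdgeMatrix

/-! ### The Euler product over the cycles of a multigraph -/

section CycleZeta

open PeriodicPath

variable {A E : Type*}

/-- A periodic path together with one of its positive periods. -/
abbrev PathWithPeriod (src tgt : E → A) : Type _ :=
  {p : ℕ × PeriodicPath src tgt // 0 < p.1 ∧ shift^[p.1] p.2 = p.2}

def pathWithPeriodEquiv (src tgt : E → A) :
    (Σ n : ℕ, Per src tgt (n + 1)) ≃ PathWithPeriod src tgt where
  toFun p := ⟨(p.1 + 1, p.2.1), p.1.succ_pos, p.2.2⟩
  invFun p := ⟨p.1.1 - 1, p.1.2, by rw [Nat.sub_add_cancel p.2.1]; exact p.2.2⟩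
  left_inv p := rfl
  right_inv p := Subtype.ext (Prod.ext (Nat.sub_add_cancel p.2.1) rfl)

/-- A pair of a cycle, a multiplicity and a starting point gives a path with a period. -/
noncomputable def cycleParam (src tgt : E → A)
    (p : Σ q : Quotient (cycleSetoid src tgt), ℕ × Fin q.out.period) : PathWithPeriod src tgt :=
  ⟨((p.2.1 + 1) * p.1.out.period, shift^[p.2.2] p.1.out),
    Nat.mul_pos p.2.1.succ_pos p.1.out.period_pos, by
      have h : Function.IsPeriodicPt shift ((p.2.1 + 1) * p.1.out.period) p.1.out :=
        Function.IsPeriodicPt.const_mul p.1.out.shift_iterate_period (p.2.1 + 1)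
      exact h.apply_iterate _⟩

/-- Any period of x is a unique positive multiple of the minimal one, and x is a unique shift, by
less than the minimal period, of the representative of its cycle. The number of starting points is
what later cancels part of the denominator in trace(Mⁿ)/n. -/
theorem cycleParam_bijective (src tgt : E → A) : Function.Bijective (cycleParam src tgt) := by
  constructor
  · rintro ⟨q, k, i⟩ ⟨q', k', i'⟩ h
    have h1 : (k + 1) * q.out.period = (k' + 1) * q'.out.period :=
      congrArg (fun p : PathWithPeriod src tgt => p.1.1) h
    have h2 : shift^[i] q.out = shift^[i'] q'.out :=
      congrArg (fun p : PathWithPeriod src tgt => p.1.2) h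
    have hq : q = q' := by
      rw [← Quotient.out_eq q, ← Quotient.out_eq q']
      have e1 : (⟦q.out⟧ : Quotient (cycleSetoid src tgt)) = ⟦shift^[i] q.out⟧ :=
        Quotient.sound ⟨i, rfl⟩
      have e2 : (⟦q'.out⟧ : Quotient (cycleSetoid src tgt)) = ⟦shift^[i'] q'.out⟧ :=
        Quotient.sound ⟨i', rfl⟩
      rw [e1, e2, h2]
    subst hq
    have hk : k = k' := by
      have := Nat.eq_of_mul_eq_mul_right q.out.period_pos h1
      omega
    have hi : i = i' := Fin.ext (Function.iterate_injOn_Iio_minimalPeriod i.2 i'.2 h2)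
    rw [hk, hi]
  · rintro ⟨⟨n, x⟩, hn, hx⟩
    dsimp only at hn hx
    set q : Quotient (cycleSetoid src tgt) := ⟦x⟧ with hq
    obtain ⟨i, hi⟩ : (cycleSetoid src tgt).r q.out x := Quotient.exact (Quotient.out_eq q)
    have hper : q.out.period = x.period := by
      rw [← hi, period_shift_iterate]
    obtain ⟨k, hk⟩ : x.period ∣ n := Function.IsPeriodicPt.minimalPeriod_dvd hx
    have hk0 : k ≠ 0 := by
      rintro rfl
      simp at hk
      omega
    refine ⟨⟨q, k - 1, ⟨i % q.out.period, Nat.mod_lt _ q.out.period_pos⟩⟩, ?_⟩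
    refine Subtype.ext (Prod.ext ?_ ?_)
    · change (k - 1 + 1) * q.out.period = n
      rw [Nat.sub_add_cancel (Nat.pos_of_ne_zero hk0), hper, hk, mul_comm]
    · change shift^[i % q.out.period] q.out = x
      rw [← hi]
      exact Function.iterate_mod_minimalPeriod_eq

theorem norm_cycleProd_lt_one {src tgt : E → A} {z : E → ℂ} (hz : ∀ e, ‖z e‖ < 1)
    (q : Quotient (cycleSetoid src tgt)) : ‖cycleProd z q‖ < 1 := by
  induction q using Quotient.inductionOn with
  | h x =>
    change ‖x.pathProd z x.period‖ < 1
    obtain ⟨n, hn⟩ := Nat.exists_eq_succ_of_ne_zero x.period_pos.ne'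
    rw [hn, pathProd, norm_prod, Finset.prod_range_succ]
    refine mul_lt_one_of_nonneg_of_lt_one_right ?_ (norm_nonneg _) (hz _)
    exact Finset.prod_le_one (fun _ _ => norm_nonneg _) fun _ _ => (hz _).le

theorem pathProd_cycleParam {src tgt : E → A} (z : E → ℂ)
    (p : Σ q : Quotient (cycleSetoid src tgt), ℕ × Fin q.out.period) :
    (cycleParam src tgt p).1.2.pathProd z (cycleParam src tgt p).1.1 =
      cycleProd z p.1 ^ (p.2.1 + 1) := by
  change (shift^[p.2.2] p.1.out).pathProd z ((p.2.1 + 1) * p.1.out.period) = _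
  have h : Function.IsPeriodicPt shift ((p.2.1 + 1) * p.1.out.period) p.1.out :=
    Function.IsPeriodicPt.const_mul p.1.out.shift_iterate_period (p.2.1 + 1)
  rw [pathProd_shift_iterate z _ h, pathProd_mul z _ p.1.out.shift_iterate_period]
  have hq : cycleProd z p.1 = p.1.out.pathProd z p.1.out.period := by
    conv_lhs => rw [← Quotient.out_eq p.1]
    rfl
  rw [hq]

theorem norm_lt_one_of_row_sum_le [DecidableEq A] [Fintype E] {src : E → A} {z : E → ℂ} {r : ℝ}
    (hr1 : r < 1)
    (hr : ∀ a, (∑ e, if src e = a then ‖z e‖ else 0) ≤ r) (e : E) : ‖z e‖ < 1 := by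
  refine lt_of_le_of_lt ?_ hr1
  refine le_trans ?_ (hr (src e))
  have := Finset.single_le_sum (f := fun e' => if src e' = src e then ‖z e'‖ else 0)
    (fun e' _ => by split_ifs <;> simp) (Finset.mem_univ e)
  simpa using this

variable [Fintype A] [DecidableEq A] [Fintype E]

theorem sum_edgeMatrix_row (src tgt : E → A) (w : E → ℝ) (a : A) :
    ∑ b, edgeMatrix src tgt w a b = ∑ e, if src e = a then w e else 0 := by
  simp only [edgeMatrix, Matrix.of_apply]
  rw [Finset.sum_comm]
  refine Finset.sum_congr rfl fun e _ => ?_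
  rw [Finset.sum_eq_single (tgt e)]
  · simp
  · intro b _ hb
    simp [Ne.symm hb]
  · simp

/-- For a nonnegative matrix the bound r on the row sums is inherited by powers, as rⁿ. -/
theorem trace_edgeMatrix_pow_le (src tgt : E → A) {w : E → ℝ} (hw : ∀ e, 0 ≤ w e) {r : ℝ}
    (hr : ∀ a, (∑ e, if src e = a then w e else 0) ≤ r) (n : ℕ) :
    (edgeMatrix src tgt w ^ n).trace ≤ Fintype.card A * r ^ n := by
  rcases isEmpty_or_nonempty A with hA | ⟨⟨a₀⟩⟩
  · simp [Matrix.trace]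
  have hr0 : 0 ≤ r := (Finset.sum_nonneg fun e _ => by split_ifs <;> simp [hw]).trans (hr a₀)
  have hM : ∀ a b, 0 ≤ edgeMatrix src tgt w a b := fun a b =>
    Finset.sum_nonneg fun e _ => by split_ifs <;> simp [hw]
  have h : ∀ n a, (∀ b, 0 ≤ (edgeMatrix src tgt w ^ n) a b) ∧
      ∑ b, (edgeMatrix src tgt w ^ n) a b ≤ r ^ n := by
    intro n
    induction n with
    | zero =>
      intro a
      refine ⟨fun b => ?_, ?_⟩
      · rw [pow_zero, Matrix.one_apply]
        split_ifs <;> simp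
      · simp [Matrix.one_apply]
    | succ n ih =>
      intro a
      simp only [pow_succ', Matrix.mul_apply]
      refine ⟨fun b => Finset.sum_nonneg fun c _ => mul_nonneg (hM a c) ((ih c).1 b), ?_⟩
      rw [Finset.sum_comm]
      simp only [← Finset.mul_sum]
      calc ∑ c, edgeMatrix src tgt w a c * ∑ b, (edgeMatrix src tgt w ^ n) c b
          ≤ ∑ c, edgeMatrix src tgt w a c * r ^ n :=
            Finset.sum_le_sum fun c _ => mul_le_mul_of_nonneg_left (ih c).2 (hM a c)
        _ = (∑ c, edgeMatrix src tgt w a c) * r ^ n := by rw [Finset.sum_mul]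
        _ ≤ r * r ^ n := by
            rw [sum_edgeMatrix_row]
            exact mul_le_mul_of_nonneg_right (hr a) (pow_nonneg hr0 n)
  calc (edgeMatrix src tgt w ^ n).trace ≤ ∑ _a : A, r ^ n :=
        Finset.sum_le_sum fun a _ =>
          (Finset.single_le_sum (fun b _ => (h n a).1 b) (Finset.mem_univ a)).trans (h n a).2
    _ = Fintype.card A * r ^ n := by simp

theorem sum_norm_edgeMatrix_row_le {src tgt : E → A} {z : E → ℂ} {r : ℝ}
    (hr : ∀ a, (∑ e, if src e = a then ‖z e‖ else 0) ≤ r) (a : A) :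
    ∑ b, ‖edgeMatrix src tgt z a b‖ ≤ r := by
  refine le_trans ?_ (hr a)
  rw [← sum_edgeMatrix_row src tgt fun e => ‖z e‖]
  refine Finset.sum_le_sum fun b _ => ?_
  simp only [edgeMatrix, Matrix.of_apply]
  refine (norm_sum_le _ _).trans (Finset.sum_le_sum fun e _ => ?_)
  split_ifs <;> simp

/-- The norms over the paths of period n sum to at most the n-th trace for the weights |z|, which
decays geometrically. Absolute convergence is what permits grouping this family both by period and
by cycle. -/
theorem summable_pathProd_div {src tgt : E → A} {z : E → ℂ} {r : ℝ} (hr1 : r < 1)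
    (hr : ∀ a, (∑ e, if src e = a then ‖z e‖ else 0) ≤ r) :
    Summable fun p : PathWithPeriod src tgt => ‖p.1.2.pathProd z p.1.1 / (p.1.1 : ℂ)‖ := by
  rw [← (pathWithPeriodEquiv src tgt).summable_iff]
  have hfin : ∀ n : ℕ, Fintype (Per src tgt (n + 1)) := fun n => Fintype.ofFinite _
  refine (summable_sigma_of_nonneg fun _ => norm_nonneg _).2 ⟨fun n => Summable.of_finite, ?_⟩
  rcases isEmpty_or_nonempty A with hA | ⟨⟨a₀⟩⟩
  · have : IsEmpty E := ⟨fun e => hA.elim (src e)⟩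
    have : ∀ n, IsEmpty (Per src tgt (n + 1)) := fun n => ⟨fun x => this.elim (x.1.edge 0)⟩
    simp [summable_zero]
  have hr0 : 0 ≤ r := (Finset.sum_nonneg fun e _ => by split_ifs <;> simp).trans (hr a₀)
  refine Summable.of_nonneg_of_le (fun n => tsum_nonneg fun _ => norm_nonneg _) (fun n => ?_)
    ((summable_geometric_of_lt_one hr0 hr1).mul_left (Fintype.card A * r))
  rw [tsum_fintype]
  calc ∑ x : Per src tgt (n + 1), ‖x.1.pathProd z (n + 1) / ((n + 1 : ℕ) : ℂ)‖
      ≤ ∑ x : Per src tgt (n + 1), x.1.pathProd (fun e => ‖z e‖) (n + 1) := by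
        refine Finset.sum_le_sum fun x _ => ?_
        rw [norm_div, Complex.norm_natCast, pathProd, norm_prod]
        exact div_le_self (Finset.prod_nonneg fun _ _ => norm_nonneg _) (by simp)
    _ = (edgeMatrix src tgt (fun e => ‖z e‖) ^ (n + 1)).trace := (trace_edgeMatrix_pow _ _ _ _).symm
    _ ≤ Fintype.card A * r ^ (n + 1) := trace_edgeMatrix_pow_le _ _ (fun _ => norm_nonneg _) hr _
    _ = Fintype.card A * r * r ^ n := by rw [pow_succ']; ring

theorem summable_norm_cycleProd {src tgt : E → A} {z : E → ℂ} {r : ℝ} (hr1 : r < 1)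
    (hr : ∀ a, (∑ e, if src e = a then ‖z e‖ else 0) ≤ r) :
    Summable fun q : Quotient (cycleSetoid src tgt) => ‖cycleProd z q‖ := by
  have h1 := (Equiv.ofBijective _ (cycleParam_bijective src tgt)).summable_iff.2
    (summable_pathProd_div hr1 hr)
  -- Only the cycles run through once are kept: each starting point contributes |z(q)| divided by
  -- the period, and the starting points add up to |z(q)|.
  let ι : (Σ q : Quotient (cycleSetoid src tgt), Fin q.out.period) →
      Σ q : Quotient (cycleSetoid src tgt), ℕ × Fin q.out.period := fun p => ⟨p.1, 0, p.2⟩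
  have hι : Function.Injective ι := by
    rintro ⟨q, i⟩ ⟨q', i'⟩ h
    simp only [ι, Sigma.mk.injEq] at h
    obtain ⟨rfl, h⟩ := h
    simpa using h
  refine ((h1.comp_injective hι).sigma).congr fun q => ?_
  have h2 : ∀ i : Fin q.out.period,
      (((fun p : PathWithPeriod src tgt => ‖p.1.2.pathProd z p.1.1 / (p.1.1 : ℂ)‖) ∘
        (Equiv.ofBijective _ (cycleParam_bijective src tgt))) ∘ ι) ⟨q, i⟩ =
      ‖cycleProd z q‖ / q.out.period := by
    intro i
    change ‖(cycleParam src tgt _).1.2.pathProd z (cycleParam src tgt _).1.1 / _‖ = _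
    rw [pathProd_cycleParam, norm_div]
    simp [ι, cycleParam]
  simp only [h2]
  rw [tsum_fintype, Finset.sum_const, Finset.card_univ, Fintype.card_fin, nsmul_eq_mul,
    mul_div_cancel₀]
  exact_mod_cast q.out.period_pos.ne'

/-- One absolutely convergent sum over pairs (period, path) is evaluated twice. Grouped by period it
is the trace series, whose exponential is the inverse determinant; grouped by cycle it is the sum of
-log(1 - z(q)). -/
theorem hasProd_cycleProd {src tgt : E → A} {z : E → ℂ} {r : ℝ} (hr1 : r < 1)
    (hr : ∀ a, (∑ e, if src e = a then ‖z e‖ else 0) ≤ r) :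
    HasProd (fun q : Quotient (cycleSetoid src tgt) => (1 - cycleProd z q)⁻¹)
      ((1 - edgeMatrix src tgt z).det)⁻¹ := by
  obtain ⟨S, hS, hexp⟩ := Matrix.hasSum_trace_pow_div (edgeMatrix src tgt z) hr1
    (sum_norm_edgeMatrix_row_le hr)
  have hsum := (summable_pathProd_div (tgt := tgt) hr1 hr).of_norm
  have hfin : ∀ n : ℕ, Fintype (Per src tgt (n + 1)) := fun n => Fintype.ofFinite _
  have hT : HasSum (fun p : PathWithPeriod src tgt => p.1.2.pathProd z p.1.1 / (p.1.1 : ℂ)) S := by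
    have h1 := (pathWithPeriodEquiv src tgt).hasSum_iff.2 hsum.hasSum
    have h2 := h1.sigma fun n => hasSum_fintype _
    have h3 : S = ∑' p : PathWithPeriod src tgt, p.1.2.pathProd z p.1.1 / (p.1.1 : ℂ) := by
      refine HasSum.unique ?_ h2
      have h4 : (fun k : ℕ => (edgeMatrix src tgt z ^ (k + 1)).trace / ((k + 1 : ℕ) : ℂ)) =
          fun n => ∑ b, ((fun p : PathWithPeriod src tgt => p.1.2.pathProd z p.1.1 / (p.1.1 : ℂ)) ∘
            (pathWithPeriodEquiv src tgt)) ⟨n, b⟩ := by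
        funext n
        rw [trace_edgeMatrix_pow, Finset.sum_div]
        rfl
      exact h4 ▸ hS
    rw [h3]
    exact hsum.hasSum
  have hz := norm_lt_one_of_row_sum_le hr1 hr
  have hlog : HasSum (fun q : Quotient (cycleSetoid src tgt) =>
      Complex.log ((1 - cycleProd z q)⁻¹)) S := by
    have h1 := (Equiv.ofBijective _ (cycleParam_bijective src tgt)).hasSum_iff.2 hT
    refine h1.sigma fun q => ?_
    have hq := norm_cycleProd_lt_one hz q
    have hslit : 1 - cycleProd z q ∈ Complex.slitPlane := by
      rw [sub_eq_add_neg]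
      exact Complex.mem_slitPlane_of_norm_lt_one (by rwa [norm_neg])
    have h3 : HasSum (fun k : ℕ => cycleProd z q ^ (k + 1) / (k + 1 : ℕ))
        (-Complex.log (1 - cycleProd z q)) := by
      have := (hasSum_nat_add_iff' 1).2 (Complex.hasSum_taylorSeries_neg_log hq)
      simpa using this
    rw [Complex.log_inv _ (Complex.slitPlane_arg_ne_pi hslit)]
    have hsq : Summable fun c : ℕ × Fin q.out.period =>
        ((fun p : PathWithPeriod src tgt => p.1.2.pathProd z p.1.1 / (p.1.1 : ℂ)) ∘
          (Equiv.ofBijective _ (cycleParam_bijective src tgt))) ⟨q, c⟩ :=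
      h1.summable.comp_injective sigma_mk_injective
    have h4 := hsq.hasSum.prod_fiberwise fun k => hasSum_fintype _
    refine (h3.unique ?_).symm ▸ hsq.hasSum
    convert h4 using 2 with k
    have h5 : ∀ i : Fin q.out.period,
        (((fun p : PathWithPeriod src tgt => p.1.2.pathProd z p.1.1 / (p.1.1 : ℂ)) ∘
          (Equiv.ofBijective _ (cycleParam_bijective src tgt)))) ⟨q, k, i⟩ =
        cycleProd z q ^ (k + 1) / ((k + 1 : ℕ) * q.out.period) := by
      intro i
      change (cycleParam src tgt _).1.2.pathProd z (cycleParam src tgt _).1.1 / _ = _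
      rw [pathProd_cycleParam]
      simp [cycleParam]
    have hd : (q.out.period : ℂ) ≠ 0 := by exact_mod_cast q.out.period_pos.ne'
    have hk : ((k + 1 : ℕ) : ℂ) ≠ 0 := by exact_mod_cast k.succ_ne_zero
    simp only [h5]
    rw [Finset.sum_const, Finset.card_univ, Fintype.card_fin, nsmul_eq_mul]
    field_simp
  rw [← hexp]
  refine Complex.hasProd_of_hasSum_log (fun q => inv_ne_zero fun h => ?_) hlog
  have hq := norm_cycleProd_lt_one hz q
  rw [sub_eq_zero] at h
  rw [← h] at hq
  simp at hq

end CycleZeta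

/-! ### The multigraph of a substitution and its interior cycles -/

namespace WeightedSubstitution

open PeriodicPath

variable {A : Type*} (s : WeightedSubstitution A)

/-- The edges of the multigraph of a substitution: the letters of the words `σ(a)`. -/
abbrev Edge : Type _ := Σ a : A, Fin (s.len a)

def tgt (e : s.Edge) : A := s.σ e.1 e.2

def weight (e : s.Edge) : ℝ := s.τ e.1 e.2

theorem weight_pos (e : s.Edge) : 0 < s.weight e := (s.τ e.1 e.2).2

theorem weight_lt_one (e : s.Edge) : s.weight e < 1 := s.τ_lt_one e.1 e.2

abbrev IsFirst (e : s.Edge) : Prop := (e.2 : ℕ) = 0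

abbrev IsLast (e : s.Edge) : Prop := (e.2 : ℕ) + 1 = s.len e.1

/-- Such a letter would be the whole word and would have weight 1. Hence no cycle is removed by both
M_{α,+} and M_{α,-}. -/
theorem not_isFirst_and_isLast (e : s.Edge) : ¬(s.IsFirst e ∧ s.IsLast e) := by
  rintro ⟨h1, h2⟩
  have h3 : s.len e.1 = 1 := by rw [← h2, h1]
  have h4 := s.τ_sum e.1
  have h5 := s.τ_lt_one e.1 e.2
  have : ∀ j : Fin (s.len e.1), j = e.2 := fun j => by
    ext
    have := j.2
    omega
  rw [Finset.sum_eq_single e.2 (fun j _ hj => absurd (this j) hj) (by simp)] at h4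
  linarith

abbrev Path : Type _ := PeriodicPath (Sigma.fst : s.Edge → A) s.tgt

abbrev Cycle : Type _ := Quotient (cycleSetoid (Sigma.fst : s.Edge → A) s.tgt)

variable {s}

theorem forall_edge_shift_iterate_iff (p : s.Edge → Prop) (x : s.Path) (k : ℕ) :
    (∀ n, p ((shift^[k] x).edge n)) ↔ ∀ n, p (x.edge n) := by
  have h : ∀ (y : s.Path) k, (∀ n, p (y.edge n)) → ∀ n, p ((shift^[k] y).edge n) := by
    intro y k h n
    rw [shift_iterate_apply]
    exact h _
  refine ⟨fun hx => ?_, h x k⟩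
  obtain ⟨l, hl⟩ := x.exists_shift_iterate_eq k
  rw [← hl]
  exact h _ l hx

variable (s) in
/-- All edges of the cycle satisfy `p`. -/
def Cycle.All (p : s.Edge → Prop) : s.Cycle → Prop :=
  Quotient.lift (fun x : s.Path => ∀ n, p (x.edge n)) (by
    rintro x _ ⟨k, rfl⟩
    exact propext (forall_edge_shift_iterate_iff p x k).symm)

/-- A cycle that consists neither of first edges only nor of last edges only. -/
def Cycle.IsInterior (q : s.Cycle) : Prop :=
  ¬Cycle.All s s.IsFirst q ∧ ¬Cycle.All s s.IsLast q

/-- A single edge of weight zero kills the whole cycle, so the determinant of the truncated matrix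
sees only the cycles inside p. -/
theorem prod_cycle_ite {R : Type*} [CommSemiring R] (p : s.Edge → Prop) [DecidablePred p]
    (z : s.Edge → R) (q : s.Cycle) [Decidable (Cycle.All s p q)] :
    cycleProd (fun e => if p e then z e else 0) q =
      if Cycle.All s p q then cycleProd z q else 0 := by
  obtain ⟨x, rfl⟩ := Quotient.exists_rep q
  by_cases h : Cycle.All s p ⟦x⟧
  · rw [if_pos h]
    change x.pathProd (fun e => if p e then z e else 0) x.period = x.pathProd z x.period
    exact Finset.prod_congr rfl fun i _ => if_pos (h _)
  · rw [if_neg h]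
    obtain ⟨n, hn⟩ := not_forall.1 (show ¬∀ n, p (x.edge n) from h)
    change x.pathProd (fun e => if p e then z e else 0) x.period = 0
    -- The offending edge is moved into the first period.
    refine Finset.prod_eq_zero (i := n % x.period)
      (Finset.mem_range.2 (Nat.mod_lt _ x.period_pos)) (if_neg ?_)
    have h1 := (shift_iterate_eq_self_iff x x.period).1 x.shift_iterate_period
    rwa [Function.Periodic.map_mod_nat h1 n]

theorem pathProd_cpow (x : s.Path) (n : ℕ) (α : ℂ) :
    x.pathProd (fun e => (s.weight e : ℂ) ^ α) n = ((x.pathProd s.weight n : ℝ) : ℂ) ^ α := by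
  induction n with
  | zero => simp [pathProd]
  | succ n ih =>
    simp only [pathProd, Finset.prod_range_succ] at ih ⊢
    rw [ih, Complex.ofReal_mul, Complex.mul_cpow_ofReal_nonneg
      (Finset.prod_nonneg fun _ _ => (s.weight_pos _).le) (s.weight_pos _).le]

theorem cycleProd_cpow (q : s.Cycle) (α : ℂ) :
    cycleProd (fun e => (s.weight e : ℂ) ^ α) q = ((cycleProd s.weight q : ℝ) : ℂ) ^ α := by
  induction q using Quotient.inductionOn with
  | h x => exact pathProd_cpow x x.period α

variable (s) in
-- Here Re α > 1 enters: |τ^α| = τ^(Re α) < τ, while the weights τ of a word sum to 1. Finitely many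
-- colors give a uniform r.
theorem exists_row_sum_le [Fintype A] [Nonempty A] [DecidableEq A] {α : ℂ} (hα : 1 < α.re) :
    ∃ r < 1, ∀ a : A, (∑ e : s.Edge, if e.1 = a then ‖(s.weight e : ℂ) ^ α‖ else 0) ≤ r := by
  obtain ⟨a₀, ha₀⟩ := Finite.exists_max
    fun a : A => ∑ e : s.Edge, if e.1 = a then ‖(s.weight e : ℂ) ^ α‖ else 0
  refine ⟨_, ?_, ha₀⟩
  rw [Fintype.sum_sigma, Finset.sum_eq_single a₀]
  · simp only [if_true]
    rw [← s.τ_sum a₀]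
    refine Finset.sum_lt_sum_of_nonempty ⟨⟨0, s.len_pos a₀⟩, Finset.mem_univ _⟩ fun i _ => ?_
    rw [Complex.norm_cpow_eq_rpow_re_of_pos (s.weight_pos _)]
    exact (Real.rpow_lt_rpow_of_exponent_gt (s.weight_pos ⟨a₀, i⟩) (s.weight_lt_one _) hα).trans_eq
      (Real.rpow_one _)
  · intro b _ hb
    simp [hb]
  · simp

section Matrices

variable [Fintype A] [DecidableEq A]

variable (s)

theorem M_eq_edgeMatrix (α : ℂ) :
    s.M α = edgeMatrix Sigma.fst s.tgt fun e => (s.weight e : ℂ) ^ α := by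
  ext a b
  simp only [M, edgeMatrix, Matrix.of_apply, Fintype.sum_sigma]
  rw [Finset.sum_eq_single a]
  · simp [tgt, weight]
  · intro c _ hc
    simp [hc]
  · simp

theorem MPlus_eq_edgeMatrix (α : ℂ) :
    s.MPlus α = edgeMatrix Sigma.fst s.tgt
      fun e => if s.IsFirst e then (s.weight e : ℂ) ^ α else 0 := by
  ext a b
  simp only [MPlus, edgeMatrix, Matrix.of_apply, Fintype.sum_sigma]
  rw [Finset.sum_eq_single a, Finset.sum_eq_single (s.first a)]
  · simp [tgt, weight, first]
    rfl
  · intro i _ hi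
    have : (i : ℕ) ≠ 0 := fun h => hi (Fin.ext h)
    simp [IsFirst, this]
  · simp
  · intro c _ hc
    simp [hc]
  · simp

theorem MMinus_eq_edgeMatrix (α : ℂ) :
    s.MMinus α = edgeMatrix Sigma.fst s.tgt
      fun e => if s.IsLast e then (s.weight e : ℂ) ^ α else 0 := by
  ext a b
  have hlast : (s.last a : ℕ) + 1 = s.len a := Nat.sub_add_cancel (s.len_pos a)
  simp only [MMinus, edgeMatrix, Matrix.of_apply, Fintype.sum_sigma]
  rw [Finset.sum_eq_single a, Finset.sum_eq_single (s.last a)]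
  · simp [tgt, weight, IsLast, hlast]
  · intro i _ hi
    have : (i : ℕ) + 1 ≠ s.len a := fun h => hi (Fin.ext (by omega))
    simp [IsLast, this]
  · simp
  · intro c _ hc
    simp [hc]
  · simp

theorem det_one_sub_M_ne_zero [Nonempty A] {α : ℂ} (hα : 1 < α.re) : (1 - s.M α).det ≠ 0 := by
  obtain ⟨r, hr1, hr⟩ := s.exists_row_sum_le hα
  rw [M_eq_edgeMatrix]
  exact Matrix.det_one_sub_ne_zero _ hr1 (sum_norm_edgeMatrix_row_le hr)

theorem summable_cycleProd [Nonempty A] {α : ℂ} (hα : 1 < α.re) :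
    Summable fun q : s.Cycle => ‖((cycleProd s.weight q : ℝ) : ℂ) ^ α‖ := by
  obtain ⟨r, hr1, hr⟩ := s.exists_row_sum_le hα
  simpa only [cycleProd_cpow] using summable_norm_cycleProd (tgt := s.tgt) hr1 hr

/-- The Euler product of M is multiplied by the inverses of those of M_{α,+} and M_{α,-}. The factor
of a cycle cancels exactly once if the cycle lies along a boundary, and survives otherwise. -/
theorem hasProd_interior [Nonempty A] {α : ℂ} (hα : 1 < α.re) :
    HasProd (fun q : {q : s.Cycle // q.IsInterior} =>
      (1 - ((cycleProd s.weight q.1 : ℝ) : ℂ) ^ α)⁻¹)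
      ((1 - s.MPlus α).det * (1 - s.MMinus α).det / (1 - s.M α).det) := by
  classical
  obtain ⟨r, hr1, hr⟩ := s.exists_row_sum_le hα
  have hp : ∀ (p : s.Edge → Prop) [DecidablePred p],
      (1 - edgeMatrix (Sigma.fst : s.Edge → A) s.tgt
        fun e => if p e then (s.weight e : ℂ) ^ α else 0).det ≠ 0 ∧
      HasProd (fun q : s.Cycle => 1 - if Cycle.All s p q then
          ((cycleProd s.weight q : ℝ) : ℂ) ^ α else 0)
        (1 - edgeMatrix (Sigma.fst : s.Edge → A) s.tgt
          fun e => if p e then (s.weight e : ℂ) ^ α else 0).det := by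
    intro p _
    have hr' : ∀ a : A, (∑ e : s.Edge, if e.1 = a then
        ‖if p e then (s.weight e : ℂ) ^ α else 0‖ else 0) ≤ r := fun a =>
      (Finset.sum_le_sum fun e _ => by split_ifs <;> simp).trans (hr a)
    have hne := Matrix.det_one_sub_ne_zero _ hr1 (sum_norm_edgeMatrix_row_le (tgt := s.tgt) hr')
    refine ⟨hne, ?_⟩
    have h1 := (hasProd_cycleProd (tgt := s.tgt) hr1 hr').inv₀ (inv_ne_zero hne)
    simpa only [inv_inv, prod_cycle_ite, cycleProd_cpow] using h1
  have h := ((hp s.IsFirst).2.mul (hp s.IsLast).2).mul (hasProd_cycleProd (tgt := s.tgt) hr1 hr)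
  rw [← M_eq_edgeMatrix, ← MPlus_eq_edgeMatrix, ← MMinus_eq_edgeMatrix, ← div_eq_mul_inv] at h
  have hw : ∀ q : s.Cycle, 1 - ((cycleProd s.weight q : ℝ) : ℂ) ^ α ≠ 0 := by
    intro q hq
    have := norm_cycleProd_lt_one (norm_lt_one_of_row_sum_le hr1 hr) q
    rw [cycleProd_cpow, ← sub_eq_zero.1 hq] at this
    simp at this
  refine (hasProd_subtype_iff_mulIndicator (s := {q : s.Cycle | q.IsInterior})
    (f := fun q : s.Cycle => (1 - ((cycleProd s.weight q : ℝ) : ℂ) ^ α)⁻¹)).2 ?_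
  convert h using 1
  funext q
  simp only [cycleProd_cpow]
  by_cases h1 : Cycle.All s s.IsFirst q
  · have h2 : ¬Cycle.All s s.IsLast q := by
      induction q using Quotient.inductionOn with
      | h x => exact fun h2 => s.not_isFirst_and_isLast _ ⟨h1 0, h2 0⟩
    rw [Set.mulIndicator_of_notMem (fun h => h.1 h1), if_pos h1, if_neg h2, sub_zero, mul_one,
      mul_inv_cancel₀ (hw q)]
  · by_cases h2 : Cycle.All s s.IsLast q
    · rw [Set.mulIndicator_of_notMem (fun h => h.2 h2), if_neg h1, if_pos h2, sub_zero, one_mul,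
        mul_inv_cancel₀ (hw q)]
    · rw [Set.mulIndicator_of_mem (show q ∈ {q : s.Cycle | q.IsInterior} from ⟨h1, h2⟩), if_neg h1,
        if_neg h2, sub_zero, one_mul, one_mul]

end Matrices

end WeightedSubstitution

noncomputable section

namespace WeightedSubstitution

variable {A : Type*} (s : WeightedSubstitution A)

/-! ### Descendants of a colored tile -/

/-- The relative position of the left side of the edge `e`. -/
def left (e : s.Edge) : ℝ := ∑ j ∈ Finset.Iio e.2, (s.τ e.1 j : ℝ)

theorem left_nonneg (e : s.Edge) : 0 ≤ s.left e :=
  Finset.sum_nonneg fun j _ => (s.τ e.1 j).2.le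

theorem sum_Iic (e : s.Edge) :
    ∑ j ∈ Finset.Iic e.2, (s.τ e.1 j : ℝ) = s.left e + s.weight e := by
  rw [← Finset.Iio_insert e.2, Finset.sum_insert (by simp), add_comm]
  rfl

theorem left_add_weight_le_one (e : s.Edge) : s.left e + s.weight e ≤ 1 := by
  rw [← sum_Iic, ← s.τ_sum e.1]
  exact Finset.sum_le_sum_of_subset_of_nonneg (Finset.subset_univ _) fun j _ _ => (s.τ e.1 j).2.le

theorem left_add_weight_le_left {a : A} {i j : Fin (s.len a)} (h : i < j) :
    s.left ⟨a, i⟩ + s.weight ⟨a, i⟩ ≤ s.left ⟨a, j⟩ := by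
  rw [← sum_Iic]
  refine Finset.sum_le_sum_of_subset_of_nonneg (fun k hk => ?_) fun j _ _ => (s.τ a j).2.le
  exact Finset.mem_Iio.2 ((Finset.mem_Iic.1 hk).trans_lt h)

theorem left_eq_zero {e : s.Edge} (h : s.IsFirst e) : s.left e = 0 := by
  refine Finset.sum_eq_zero fun j hj => ?_
  have h1 : (j : ℕ) < e.2 := Fin.lt_def.1 (Finset.mem_Iio.1 hj)
  have h2 : (e.2 : ℕ) = 0 := h
  omega

theorem left_pos {e : s.Edge} (h : ¬s.IsFirst e) : 0 < s.left e := by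
  refine Finset.sum_pos (fun j _ => (s.τ e.1 j).2) ⟨⟨0, s.len_pos e.1⟩, Finset.mem_Iio.2 ?_⟩
  exact Fin.lt_def.2 (Nat.pos_of_ne_zero h)

theorem left_add_weight_eq_one {e : s.Edge} (h : s.IsLast e) : s.left e + s.weight e = 1 := by
  rw [← sum_Iic, ← s.τ_sum e.1]
  congr 1
  ext j
  have h1 : (e.2 : ℕ) + 1 = s.len e.1 := h
  have h2 := j.2
  simp only [Finset.mem_Iic, Finset.mem_univ, iff_true, Fin.le_def]
  omega

theorem left_add_weight_eq_left {a : A} {i j : Fin (s.len a)} (h : (i : ℕ) + 1 = j) :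
    s.left ⟨a, j⟩ = s.left ⟨a, i⟩ + s.weight ⟨a, i⟩ := by
  rw [← sum_Iic, left]
  congr 1
  ext k
  simp only [Finset.mem_Iio, Finset.mem_Iic, Fin.lt_def, Fin.le_def]
  omega

theorem left_add_weight_lt_one {e : s.Edge} (h : ¬s.IsLast e) : s.left e + s.weight e < 1 := by
  have h1 : (e.2 : ℕ) + 1 < s.len e.1 := lt_of_le_of_ne e.2.2 h
  rw [← s.left_add_weight_eq_left (i := e.2) (j := ⟨e.2 + 1, h1⟩) rfl]
  have := s.left_add_weight_le_one ⟨e.1, ⟨e.2 + 1, h1⟩⟩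
  have := s.weight_pos ⟨e.1, ⟨e.2 + 1, h1⟩⟩
  linarith

/-- The half-open intervals of the letters partition [0, 1); the last letter starting at or before u
is the right one. -/
theorem exists_left_le_lt (a : A) {u : ℝ} (h0 : 0 ≤ u) (h1 : u < 1) :
    ∃ i : Fin (s.len a), s.left ⟨a, i⟩ ≤ u ∧ u < s.left ⟨a, i⟩ + s.weight ⟨a, i⟩ := by
  classical
  obtain ⟨i, hi, hmax⟩ := Finset.exists_max_image
    (Finset.univ.filter fun i : Fin (s.len a) => s.left ⟨a, i⟩ ≤ u) id
    ⟨⟨0, s.len_pos a⟩, by simp [s.left_eq_zero (e := ⟨a, ⟨0, s.len_pos a⟩⟩) rfl, h0]⟩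
  rw [Finset.mem_filter] at hi
  refine ⟨i, hi.2, ?_⟩
  by_cases hl : (i : ℕ) + 1 = s.len a
  · rwa [s.left_add_weight_eq_one (e := ⟨a, i⟩) hl]
  · by_contra! h
    have hlt : (i : ℕ) + 1 < s.len a := lt_of_le_of_ne i.2 hl
    rw [← s.left_add_weight_eq_left (i := i) (j := ⟨i + 1, hlt⟩) rfl] at h
    have : (⟨i + 1, hlt⟩ : Fin (s.len a)) ≤ i := hmax ⟨i + 1, hlt⟩ (by simp [h])
    rw [Fin.le_def] at this
    simp at this

theorem exists_weight_le [Finite A] : ∃ r, 0 < r ∧ r < 1 ∧ ∀ e, s.weight e ≤ r := by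
  rcases isEmpty_or_nonempty s.Edge with h | h
  · exact ⟨1 / 2, by norm_num, by norm_num, fun e => h.elim e⟩
  · obtain ⟨e, he⟩ := Finite.exists_max s.weight
    exact ⟨_, s.weight_pos e, s.weight_lt_one e, he⟩

theorem exists_le_weight [Finite A] : ∃ c, 0 < c ∧ c < 1 ∧ ∀ e, c ≤ s.weight e := by
  rcases isEmpty_or_nonempty s.Edge with h | h
  · exact ⟨1 / 2, by norm_num, by norm_num, fun e => h.elim e⟩
  · obtain ⟨e, he⟩ := Finite.exists_min s.weight
    exact ⟨_, s.weight_pos e, s.weight_lt_one e, he⟩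

/-- The `i`-th child of a colored tile. -/
def child (p : AdmissibleTile × A) (i : Fin (s.len p.2)) : AdmissibleTile × A :=
  (p.1.child s p.2 i, s.σ p.2 i)

variable {s}

@[simp] theorem child_snd (p : AdmissibleTile × A) (i : Fin (s.len p.2)) :
    (s.child p i).2 = s.σ p.2 i := rfl

theorem child_x₁ (p : AdmissibleTile × A) (i : Fin (s.len p.2)) :
    (s.child p i).1.x₁ = p.1.x₁ + p.1.y₁ * s.left ⟨p.2, i⟩ := by
  rw [← p.1.width_eq]; rfl

theorem child_x₂ (p : AdmissibleTile × A) (i : Fin (s.len p.2)) :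
    (s.child p i).1.x₂ = p.1.x₁ + p.1.y₁ * (s.left ⟨p.2, i⟩ + s.weight ⟨p.2, i⟩) := by
  rw [← p.1.width_eq, ← sum_Iic]; rfl

theorem child_y₁ (p : AdmissibleTile × A) (i : Fin (s.len p.2)) :
    (s.child p i).1.y₁ = s.weight ⟨p.2, i⟩ * p.1.y₁ := rfl

theorem child_y₂ (p : AdmissibleTile × A) (i : Fin (s.len p.2)) :
    (s.child p i).1.y₂ = p.1.y₁ := rfl

theorem x₁_le_child_x₁ (p : AdmissibleTile × A) (i : Fin (s.len p.2)) :
    p.1.x₁ ≤ (s.child p i).1.x₁ := by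
  rw [child_x₁]
  have := mul_nonneg p.1.y₁_pos.le (s.left_nonneg ⟨p.2, i⟩)
  linarith

theorem child_x₂_le_x₂ (p : AdmissibleTile × A) (i : Fin (s.len p.2)) :
    (s.child p i).1.x₂ ≤ p.1.x₂ := by
  rw [child_x₂]
  have := mul_le_mul_of_nonneg_left (s.left_add_weight_le_one ⟨p.2, i⟩) p.1.y₁_pos.le
  have := p.1.width_eq
  linarith

theorem child_x₂_le_child_x₁ (p : AdmissibleTile × A) {i j : Fin (s.len p.2)} (h : i < j) :
    (s.child p i).1.x₂ ≤ (s.child p j).1.x₁ := by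
  rw [child_x₂, child_x₁]
  have := mul_le_mul_of_nonneg_left (s.left_add_weight_le_left h) p.1.y₁_pos.le
  linarith

theorem child_y₁_lt (p : AdmissibleTile × A) (i : Fin (s.len p.2)) :
    (s.child p i).1.y₁ < p.1.y₁ := (s.child p i).1.y₁_lt_y₂

theorem eq_of_child_overlap {p : AdmissibleTile × A} {i j : Fin (s.len p.2)}
    (h1 : (s.child p i).1.x₁ < (s.child p j).1.x₂) (h2 : (s.child p j).1.x₁ < (s.child p i).1.x₂) :
    i = j := by
  rcases lt_trichotomy i j with h | h | h
  · exact absurd (child_x₂_le_child_x₁ p h) (not_le.2 h2)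
  · exact h
  · exact absurd (child_x₂_le_child_x₁ p h) (not_le.2 h1)

theorem exists_child_mem (p : AdmissibleTile × A) {x : ℝ} (h1 : p.1.x₁ ≤ x) (h2 : x < p.1.x₂) :
    ∃ i, (s.child p i).1.x₁ ≤ x ∧ x < (s.child p i).1.x₂ := by
  have hy := p.1.y₁_pos
  have hw := p.1.width_eq
  obtain ⟨i, hi, hi'⟩ := s.exists_left_le_lt p.2 (u := (x - p.1.x₁) / p.1.y₁)
    (div_nonneg (by linarith) hy.le) ((div_lt_one hy).2 (by linarith))
  refine ⟨i, ?_, ?_⟩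
  · rw [child_x₁]
    rw [le_div_iff₀' hy] at hi
    linarith
  · rw [child_x₂]
    rw [div_lt_iff₀' hy] at hi'
    linarith

variable (s) in
/-- `q` is obtained from `p` by repeatedly passing to a child. -/
abbrev Desc : AdmissibleTile × A → AdmissibleTile × A → Prop :=
  Relation.ReflTransGen fun p q => ∃ i, q = s.child p i

theorem Desc.child {p q : AdmissibleTile × A} (h : s.Desc p q) (i : Fin (s.len q.2)) :
    s.Desc p (s.child q i) := h.tail ⟨i, rfl⟩

theorem desc_child (p : AdmissibleTile × A) (i : Fin (s.len p.2)) : s.Desc p (s.child p i) :=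
  Relation.ReflTransGen.single ⟨i, rfl⟩

theorem Desc.x₁_le {p q : AdmissibleTile × A} (h : s.Desc p q) : p.1.x₁ ≤ q.1.x₁ := by
  induction h with
  | refl => exact le_rfl
  | tail _ hr ih =>
    obtain ⟨i, rfl⟩ := hr
    exact ih.trans (x₁_le_child_x₁ _ i)

theorem Desc.x₂_le {p q : AdmissibleTile × A} (h : s.Desc p q) : q.1.x₂ ≤ p.1.x₂ := by
  induction h with
  | refl => exact le_rfl
  | tail _ hr ih =>
    obtain ⟨i, rfl⟩ := hr
    exact (child_x₂_le_x₂ _ i).trans ih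

theorem Desc.y₁_le {p q : AdmissibleTile × A} (h : s.Desc p q) : q.1.y₁ ≤ p.1.y₁ := by
  induction h with
  | refl => exact le_rfl
  | tail _ hr ih =>
    obtain ⟨i, rfl⟩ := hr
    exact (child_y₁_lt _ i).le.trans ih

theorem Desc.eq_or_exists {p q : AdmissibleTile × A} (h : s.Desc p q) :
    q = p ∨ ∃ i, s.Desc (s.child p i) q := by
  rcases Relation.ReflTransGen.cases_head h with h | ⟨_, ⟨i, rfl⟩, h⟩
  · exact Or.inl h.symm
  · exact Or.inr ⟨i, h⟩

theorem Desc.y₂_le {p q : AdmissibleTile × A} (h : s.Desc p q) : q.1.y₂ ≤ p.1.y₂ := by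
  induction h with
  | refl => exact le_rfl
  | tail _ hr ih =>
    obtain ⟨i, rfl⟩ := hr
    rw [child_y₂]
    exact (AdmissibleTile.y₁_lt_y₂ _).le.trans ih

theorem Desc.eq_or_y₂_le {p q : AdmissibleTile × A} (h : s.Desc p q) :
    q = p ∨ q.1.y₂ ≤ p.1.y₁ := by
  rcases h.eq_or_exists with h | ⟨i, h⟩
  · exact Or.inl h
  · exact Or.inr h.y₂_le

/-- Follow the branches to both tiles. At the fork they enter horizontally disjoint children; if
there is no fork, one tile is a proper descendant of the other and lies below it. -/
theorem desc_disjoint {p q q' : AdmissibleTile × A} (h : s.Desc p q) (h' : s.Desc p q')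
    (hne : q ≠ q') : q.1.toSet ∩ q'.1.toSet = ∅ := by
  have key : ∀ {p q : AdmissibleTile × A}, s.Desc p q → q ≠ p → p.1.toSet ∩ q.1.toSet = ∅ := by
    intro p q h hne
    rw [Set.eq_empty_iff_forall_notMem]
    rintro z ⟨hz, hz'⟩
    rw [AdmissibleTile.mem_toSet] at hz hz'
    have := h.eq_or_y₂_le.resolve_left hne
    linarith [hz.2.1, hz'.2.2]
  induction h using Relation.ReflTransGen.head_induction_on with
  | refl => exact key h' hne.symm
  | head hpr hrq ih =>
    obtain ⟨i, rfl⟩ := hpr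
    rcases h'.eq_or_exists with rfl | ⟨j, hj⟩
    · rw [Set.inter_comm]
      exact key ((desc_child _ i).trans hrq) hne
    · by_cases hij : i = j
      · subst hij
        exact ih hj
      · rw [Set.eq_empty_iff_forall_notMem]
        rintro z ⟨hz, hz'⟩
        rw [AdmissibleTile.mem_toSet] at hz hz'
        refine hij (eq_of_child_overlap ?_ ?_)
        · linarith [Desc.x₁_le hrq, hj.x₂_le, hz.1.1, hz'.1.2]
        · linarith [hj.x₁_le, Desc.x₂_le hrq, hz.1.2, hz'.1.1]

/-- Descending always into the child over x shrinks the height at least by a factor r < 1, and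
consecutive tiles abut vertically, so the height y is eventually caught. -/
theorem exists_desc_mem [Finite A] (p : AdmissibleTile × A) {x y : ℝ} (hx₁ : p.1.x₁ ≤ x)
    (hx₂ : x < p.1.x₂) (hy : 0 < y) (hyp : y ≤ p.1.y₁) :
    ∃ q, s.Desc p q ∧ (q.1.x₁ ≤ x ∧ x < q.1.x₂) ∧ q.1.y₁ < y ∧ y ≤ q.1.y₂ := by
  obtain ⟨r, hr0, hr1, hr⟩ := s.exists_weight_le
  obtain ⟨n, hn⟩ : ∃ n : ℕ, r ^ n * p.1.y₁ < y := by
    obtain ⟨n, hn⟩ := exists_pow_lt_of_lt_one (div_pos hy p.1.y₁_pos) hr1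
    exact ⟨n, by rwa [lt_div_iff₀ p.1.y₁_pos] at hn⟩
  induction n generalizing p with
  | zero =>
    rw [pow_zero, one_mul] at hn
    exact absurd hn (not_lt.2 hyp)
  | succ n ih =>
    obtain ⟨i, hi⟩ := exists_child_mem (s := s) p hx₁ hx₂
    by_cases h : (s.child p i).1.y₁ < y
    · exact ⟨s.child p i, desc_child p i, hi, h, hyp⟩
    · obtain ⟨q, hq, hq'⟩ := ih (s.child p i) hi.1 hi.2 (not_lt.1 h) (by
        refine lt_of_le_of_lt ?_ hn
        rw [child_y₁, pow_succ, mul_assoc]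
        exact mul_le_mul_of_nonneg_left
          (mul_le_mul_of_nonneg_right (hr _) p.1.y₁_pos.le) (pow_nonneg hr0.le n))
      exact ⟨q, (desc_child p i).trans hq, hq'⟩

/-! ### Tilings that are closed under taking children -/

variable {g : A → PosReal} {ω : ColoredTiling A}

theorem child_mem (hω : ω ∈ s.tilings g) {p : AdmissibleTile × A} (hp : p ∈ ω.tiles)
    (i : Fin (s.len p.2)) : s.child p i ∈ ω.tiles := (hω p hp).2 i

theorem Desc.mem {p q : AdmissibleTile × A} (h : s.Desc p q) (hω : ω ∈ s.tilings g)
    (hp : p ∈ ω.tiles) : q ∈ ω.tiles := by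
  induction h with
  | refl => exact hp
  | tail _ hr ih =>
    obtain ⟨i, rfl⟩ := hr
    exact child_mem hω ih i

end WeightedSubstitution

theorem ColoredTiling.eq_of_overlap {A : Type*} {ω : ColoredTiling A} {p q : AdmissibleTile × A}
    (hp : p ∈ ω.tiles) (hq : q ∈ ω.tiles) (h1 : p.1.x₁ < q.1.x₂) (h2 : q.1.x₁ < p.1.x₂)
    (h3 : p.1.y₁ < q.1.y₂) (h4 : q.1.y₁ < p.1.y₂) : p = q := by
  by_contra hne
  have h := ω.disjoint p hp q hq hne
  obtain ⟨x, hx, hx'⟩ := exists_between (max_lt (lt_min p.1.x₁_lt_x₂ h1) (lt_min h2 q.1.x₁_lt_x₂))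
  obtain ⟨y, hy, hy'⟩ := exists_between (max_lt (lt_min p.1.y₁_lt_y₂ h3) (lt_min h4 q.1.y₁_lt_y₂))
  rw [max_lt_iff] at hx hy
  rw [lt_min_iff] at hx' hy'
  rw [Set.eq_empty_iff_forall_notMem] at h
  exact h ⟨x, y⟩ ⟨⟨⟨hx.1, hx'.1⟩, hy.1, hy'.1⟩, ⟨hx.2, hx'.2⟩, hy.2, hy'.2⟩

theorem ColoredTiling.exists_mem {A : Type*} (ω : ColoredTiling A) (x : ℝ) {y : ℝ} (hy : 0 < y) :
    ∃ p ∈ ω.tiles, (p.1.x₁ ≤ x ∧ x ≤ p.1.x₂) ∧ p.1.y₁ ≤ y ∧ y ≤ p.1.y₂ := by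
  have h : (⟨x, y⟩ : ℂ) ∈ ⋃ p ∈ ω.tiles, closure p.1.toSet := by
    rw [ω.cover]
    exact hy
  obtain ⟨p, hp, h⟩ := Set.mem_iUnion₂.1 h
  exact ⟨p, hp, AdmissibleTile.mem_closure_toSet.1 h⟩

namespace WeightedSubstitution

variable {A : Type*} [Finite A] {s : WeightedSubstitution A} {g : A → PosReal}
  {ω : ColoredTiling A}

/-- The descendants of p already fill the column below p. A descendant caught at an interior point
of q that lies over p overlaps q, and disjointness of the tiling makes them equal. -/
theorem desc_of_overlap (hω : ω ∈ s.tilings g) {p q : AdmissibleTile × A} (hp : p ∈ ω.tiles)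
    (hq : q ∈ ω.tiles) (h1 : p.1.x₁ < q.1.x₂) (h2 : q.1.x₁ < p.1.x₂) (h : q.1.y₁ ≤ p.1.y₁) :
    s.Desc p q := by
  by_cases h3 : p.1.y₁ < q.1.y₂
  · rw [ω.eq_of_overlap hp hq h1 h2 h3 (h.trans_lt p.1.y₁_lt_y₂)]
  · obtain ⟨x, hx, hx'⟩ :=
      exists_between (max_lt (lt_min p.1.x₁_lt_x₂ h1) (lt_min h2 q.1.x₁_lt_x₂))
    obtain ⟨y, hy, hy'⟩ := exists_between q.1.y₁_lt_y₂
    rw [max_lt_iff] at hx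
    rw [lt_min_iff] at hx'
    obtain ⟨r, hr, hrx, hry⟩ := exists_desc_mem (s := s) p hx.1.le hx'.1
      (q.1.y₁_pos.trans hy) (hy'.le.trans (not_lt.1 h3))
    rw [← ω.eq_of_overlap (hr.mem hω hp) hq (hrx.1.trans_lt hx'.2) (hx.2.trans hrx.2)
      (hry.1.trans hy') (hy.trans_le hry.2)]
    exact hr

theorem exists_parent (hω : ω ∈ s.tilings g) {q : AdmissibleTile × A} (hq : q ∈ ω.tiles) :
    ∃ p ∈ ω.tiles, ∃ i, q = s.child p i := by
  obtain ⟨x, hx, hx'⟩ := exists_between q.1.x₁_lt_x₂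
  have hy := q.1.y₁_pos.trans q.1.y₁_lt_y₂
  -- A tile reaching strictly above q cannot be q itself, so the descent from t to q has a last
  -- step.
  obtain ⟨t, ht, htx, hty⟩ := ω.exists_mem x (y := q.1.y₂ + 1) (by linarith)
  have h : s.Desc t q := by
    rcases le_total q.1.y₁ t.1.y₁ with h | h
    · exact desc_of_overlap hω ht hq (by linarith) (by linarith) h
    · have := desc_of_overlap hω hq ht (by linarith) (by linarith) h
      linarith [this.y₂_le]
  rcases Relation.ReflTransGen.cases_tail h with rfl | ⟨p, hp, i, hi⟩
  · linarith
  · exact ⟨p, Desc.mem hp hω ht, i, hi⟩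

/-- Every tile is a child, so the ratio of its lower to its upper height is a weight. Consequently
tiles meeting a given height cannot be too narrow. -/
theorem mul_y₂_le (hω : ω ∈ s.tilings g) {c : ℝ} (hc : ∀ e, c ≤ s.weight e)
    {q : AdmissibleTile × A} (hq : q ∈ ω.tiles) : c * q.1.y₂ ≤ q.1.y₁ := by
  obtain ⟨p, -, i, rfl⟩ := exists_parent hω hq
  rw [child_y₁, child_y₂]
  exact mul_le_mul_of_nonneg_right (hc _) p.1.y₁_pos.le

end WeightedSubstitution

end

noncomputable section

/-! ### Scaling -/

/-- The colored tile `l p`. -/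
abbrev scaleTile {A : Type*} (l : PosReal) (p : AdmissibleTile × A) : AdmissibleTile × A :=
  (p.1.scale l, p.2)

namespace scaleTile

variable {A : Type*} (l m : PosReal) (p : AdmissibleTile × A)

@[simp] theorem snd : (scaleTile l p).2 = p.2 := rfl

@[simp] theorem x₁ : (scaleTile l p).1.x₁ = l * p.1.x₁ := rfl

@[simp] theorem x₂ : (scaleTile l p).1.x₂ = l * p.1.x₂ := rfl

@[simp] theorem y₁ : (scaleTile l p).1.y₁ = l * p.1.y₁ := rfl

theorem mul : scaleTile (l * m) p = scaleTile l (scaleTile m p) :=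
  Prod.ext (AdmissibleTile.mul_scale l m p.1) rfl

theorem one : scaleTile 1 p = p := Prod.ext p.1.one_scale rfl

theorem inv_scale : scaleTile l⁻¹ (scaleTile l p) = p := by
  rw [← mul, inv_mul_cancel, one]

theorem scale_inv : scaleTile l (scaleTile l⁻¹ p) = p := by
  rw [← mul, mul_inv_cancel, one]

end scaleTile

namespace ColoredTiling

variable {A : Type*} {ω : ColoredTiling A}

theorem smul_tiles (l : PosReal) : (l • ω).tiles = scaleTile l '' ω.tiles := rfl

theorem scaleTile_mem_smul {l : PosReal} {p : AdmissibleTile × A} :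
    scaleTile l p ∈ (l • ω).tiles ↔ p ∈ ω.tiles := by
  rw [smul_tiles]
  refine ⟨?_, fun h => ⟨p, h, rfl⟩⟩
  rintro ⟨q, hq, h⟩
  rwa [← scaleTile.inv_scale l p, ← h, scaleTile.inv_scale]

theorem mem_smul {l : PosReal} {p : AdmissibleTile × A} :
    p ∈ (l • ω).tiles ↔ scaleTile l⁻¹ p ∈ ω.tiles := by
  conv_lhs => rw [← scaleTile.scale_inv l p]
  exact scaleTile_mem_smul

theorem scaleTile_mem {l : PosReal} (h : l • ω = ω) {p : AdmissibleTile × A} (hp : p ∈ ω.tiles) :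
    scaleTile l p ∈ ω.tiles := by
  rw [← h]
  exact scaleTile_mem_smul.2 hp

theorem inv_smul_eq {l : PosReal} (h : l • ω = ω) : l⁻¹ • ω = ω := by
  rw [inv_smul_eq_iff, h]

theorem pow_smul_eq {l : PosReal} (h : l • ω = ω) (n : ℕ) : l ^ n • ω = ω := by
  induction n with
  | zero => rw [pow_zero, one_smul]
  | succ n ih => rw [pow_succ, mul_smul, h, ih]

end ColoredTiling

theorem PosReal.exists_pow_mul_gt {l : PosReal} (hl : 1 < l) (a : ℝ) {b : ℝ} (hb : 0 < b) :
    ∃ N : ℕ, ∀ n, N ≤ n → a < ((l ^ n : PosReal) : ℝ) * b := by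
  have hl' : (1 : ℝ) < l := hl
  obtain ⟨N, hN⟩ := pow_unbounded_of_one_lt (a / b) hl'
  refine ⟨N, fun n hn => ?_⟩
  rw [div_lt_iff₀ hb] at hN
  refine hN.trans_le (mul_le_mul_of_nonneg_right ?_ hb.le)
  exact pow_le_pow_right₀ hl'.le hn

namespace WeightedSubstitution

variable {A : Type*} {s : WeightedSubstitution A} {g : A → PosReal} {ω : ColoredTiling A}

theorem scaleTile_child (l : PosReal) (p : AdmissibleTile × A) (i : Fin (s.len p.2)) :
    scaleTile l (s.child p i) = s.child (scaleTile l p) i := by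
  have h : (scaleTile l (s.child p i)).1 = (s.child (scaleTile l p) i).1 := by
    ext
    · refine Eq.trans ?_ (child_x₁ (s := s) (scaleTile l p) i).symm
      rw [scaleTile.x₁, child_x₁]
      change _ = (l : ℝ) * _ + (l : ℝ) * _ * _
      ring
    · refine Eq.trans ?_ (child_x₂ (s := s) (scaleTile l p) i).symm
      rw [scaleTile.x₂, child_x₂]
      change _ = (l : ℝ) * _ + (l : ℝ) * _ * _
      ring
    · exact mul_left_comm _ _ _
    · rfl
  exact Prod.ext h rfl

theorem Desc.scale {p q : AdmissibleTile × A} (h : s.Desc p q) (l : PosReal) :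
    s.Desc (scaleTile l p) (scaleTile l q) := by
  induction h with
  | refl => exact .refl
  | tail _ hr ih =>
    obtain ⟨i, rfl⟩ := hr
    rw [scaleTile_child]
    exact ih.tail ⟨i, rfl⟩

theorem smul_mem_tilings (hω : ω ∈ s.tilings g) {l : PosReal} (hl : l ∈ s.base) :
    l • ω ∈ s.tilings g := by
  rintro _ ⟨p, hp, rfl⟩
  obtain ⟨⟨m, hm, h⟩, h'⟩ := hω p hp
  refine ⟨⟨l * m, mul_mem hl hm, ?_⟩, fun i => ?_⟩
  · change (l : ℝ) * p.1.y₁ = (g p.2 * (l * m) : PosReal)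
    rw [h]
    simp only [Positive.val_mul]
    ring
  · change s.child (scaleTile l p) i ∈ _
    rw [← scaleTile_child, ColoredTiling.scaleTile_mem_smul]
    exact h' i

/-! ### Tilings and separating lines -/

theorem isSeparatingLine_iff {x : ℝ} :
    ω.IsSeparatingLine x ↔ ∀ p ∈ ω.tiles, ¬(p.1.x₁ < x ∧ x < p.1.x₂) := by
  refine forall₂_congr fun p _ => ?_
  rw [Set.eq_empty_iff_forall_notMem]
  constructor
  · intro h hx
    obtain ⟨y, hy⟩ := exists_between p.1.y₁_lt_y₂
    exact h ⟨x, y⟩ ⟨⟨hx, hy⟩, rfl⟩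
  · rintro h z ⟨hz, rfl⟩
    exact h hz.1

theorem exists_mem_column_of_not_hasSeparatingLine (h : ¬ω.HasSeparatingLine) (x : ℝ) :
    ∃ p ∈ ω.tiles, p.1.x₁ < x ∧ x < p.1.x₂ := by
  by_contra! h'
  exact h ⟨x, isSeparatingLine_iff.2 fun p hp hx => not_lt.2 (h' p hp hx.1) hx.2⟩

/-- The enlargements lⁿ p belong to the tiling, and their bases eventually contain any given
abscissa. -/
theorem not_hasSeparatingLine_of_smul_eq {l : PosReal} (hl : 1 < l) (h : l • ω = ω)
    {p : AdmissibleTile × A} (hp : p ∈ ω.tiles) (h1 : p.1.x₁ < 0) (h2 : 0 < p.1.x₂) :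
    ¬ω.HasSeparatingLine := by
  rintro ⟨x, hx⟩
  rw [isSeparatingLine_iff] at hx
  obtain ⟨N₁, hN₁⟩ := PosReal.exists_pow_mul_gt hl x h2
  obtain ⟨N₂, hN₂⟩ := PosReal.exists_pow_mul_gt hl (-x) (neg_pos.2 h1)
  have a1 := hN₁ (max N₁ N₂) (le_max_left _ _)
  have a2 := hN₂ (max N₁ N₂) (le_max_right _ _)
  refine hx _ (ColoredTiling.scaleTile_mem (ColoredTiling.pow_smul_eq h (max N₁ N₂)) hp) ⟨?_, a1⟩
  rw [scaleTile.x₁]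
  linarith

theorem isSeparatingLine_zero {l : PosReal} (hl : 1 < l) (h : l • ω = ω)
    (hs : ω.HasSeparatingLine) : ω.IsSeparatingLine 0 :=
  isSeparatingLine_iff.2 fun _ hp hx => not_hasSeparatingLine_of_smul_eq hl h hp hx.1 hx.2 hs

theorem smul_hasSeparatingLine (l : PosReal) (hs : ω.HasSeparatingLine) :
    (l • ω).HasSeparatingLine := by
  obtain ⟨x, hx⟩ := hs
  refine ⟨l * x, isSeparatingLine_iff.2 ?_⟩
  rintro _ ⟨p, hp, rfl⟩ hx'
  refine isSeparatingLine_iff.1 hx p hp ?_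
  change (l : ℝ) * _ < _ ∧ _ < (l : ℝ) * _ at hx'
  rwa [mul_lt_mul_iff_right₀ l.2, mul_lt_mul_iff_right₀ l.2] at hx'

section Finite

variable [Finite A]

/-- Only the closures of the tiles cover, so tiles accumulating at x from the right must be
excluded. Tiles through (x + ε, 1) have width at least c. If all started to the right of x, smaller
and smaller ε would give tiles over a common interval with left sides closer and closer to x, each
strictly below the next, though all reach height 1. -/
theorem exists_mem_right (hω : ω ∈ s.tilings g) (x : ℝ) :
    ∃ p ∈ ω.tiles, p.1.x₁ ≤ x ∧ x < p.1.x₂ := by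
  obtain ⟨c, hc0, hc1, hc⟩ := s.exists_le_weight
  have key : ∀ ε, 0 < ε → ε < c → (∃ p ∈ ω.tiles, p.1.x₁ ≤ x ∧ x < p.1.x₂) ∨
      ∃ q ∈ ω.tiles, (x < q.1.x₁ ∧ q.1.x₁ ≤ x + ε) ∧ x + c < q.1.x₂ ∧ q.1.y₁ ≤ 1 ∧ 1 ≤ q.1.y₂ := by
    intro ε hε hεc
    obtain ⟨q, hq, hqx, hqy⟩ := ω.exists_mem (x + ε) one_pos
    by_cases h : q.1.x₁ ≤ x
    · exact Or.inl ⟨q, hq, h, by linarith⟩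
    · refine Or.inr ⟨q, hq, ⟨not_le.1 h, hqx.1⟩, ?_, hqy⟩
      have h1 := mul_y₂_le hω hc hq
      have h2 := mul_le_mul_of_nonneg_left hqy.2 hc0.le
      linarith [q.1.width_eq, not_le.1 h]
  rcases key (c / 2) (by linarith) (by linarith) with h | ⟨q, hq, hq1, hq2, hq3⟩
  · exact h
  rcases key ((min (q.1.x₁ - x) c) / 2) (half_pos (lt_min (by linarith) hc0))
    (by linarith [min_le_right (q.1.x₁ - x) c]) with h | ⟨q', hq', hq'1, hq'2, hq'3⟩
  · exact h
  rcases key ((min (q'.1.x₁ - x) c) / 2) (half_pos (lt_min (by linarith) hc0))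
    (by linarith [min_le_right (q'.1.x₁ - x) c]) with h | ⟨q'', hq'', hq''1, hq''2, hq''3⟩
  · exact h
  exfalso
  have step : ∀ {p p' : AdmissibleTile × A}, p ∈ ω.tiles → p' ∈ ω.tiles →
      (x < p.1.x₁ ∧ p.1.x₁ ≤ x + c) → x + c < p.1.x₂ → x + c < p'.1.x₂ → p'.1.x₁ < p.1.x₁ →
      p.1.y₂ ≤ p'.1.y₁ := by
    intro p p' hp hp' h1 h2 h3 h4
    have hd : s.Desc p' p := by
      rcases le_total p.1.y₁ p'.1.y₁ with h | h
      · exact desc_of_overlap hω hp' hp (by linarith) (by linarith) h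
      · exact absurd (desc_of_overlap hω hp hp' (by linarith) (by linarith) h).x₁_le (not_le.2 h4)
    rcases hd.eq_or_y₂_le with rfl | h
    · exact absurd h4 (lt_irrefl _)
    · exact h
  have e1 := step hq hq' ⟨hq1.1, by linarith⟩ hq2 hq'2
    (by linarith [min_le_left (q.1.x₁ - x) c])
  have e2 := step hq' hq'' ⟨hq'1.1, by linarith [min_le_right (q.1.x₁ - x) c]⟩ hq'2 hq''2
    (by linarith [min_le_left (q'.1.x₁ - x) c])
  -- The chain 1 ≤ q.y₂ ≤ q'.y₁ < q'.y₂ ≤ q''.y₁ ≤ 1 is absurd. Two tiles would not suffice, as they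
  -- could abut at height 1.
  linarith [q'.1.y₁_lt_y₂]

theorem exists_mem_left (hω : ω ∈ s.tilings g) (x : ℝ) :
    ∃ p ∈ ω.tiles, p.1.x₁ < x ∧ x ≤ p.1.x₂ := by
  obtain ⟨c, hc0, hc1, hc⟩ := s.exists_le_weight
  have key : ∀ ε, 0 < ε → ε < c → (∃ p ∈ ω.tiles, p.1.x₁ < x ∧ x ≤ p.1.x₂) ∨
      ∃ q ∈ ω.tiles, (q.1.x₂ < x ∧ x - ε ≤ q.1.x₂) ∧ q.1.x₁ < x - c ∧ q.1.y₁ ≤ 1 ∧ 1 ≤ q.1.y₂ := by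
    intro ε hε hεc
    obtain ⟨q, hq, hqx, hqy⟩ := ω.exists_mem (x - ε) one_pos
    by_cases h : x ≤ q.1.x₂
    · exact Or.inl ⟨q, hq, by linarith, h⟩
    · refine Or.inr ⟨q, hq, ⟨not_le.1 h, hqx.2⟩, ?_, hqy⟩
      have h1 := mul_y₂_le hω hc hq
      have h2 := mul_le_mul_of_nonneg_left hqy.2 hc0.le
      linarith [q.1.width_eq, not_le.1 h]
  rcases key (c / 2) (by linarith) (by linarith) with h | ⟨q, hq, hq1, hq2, hq3⟩
  · exact h
  rcases key ((min (x - q.1.x₂) c) / 2) (half_pos (lt_min (by linarith) hc0))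
    (by linarith [min_le_right (x - q.1.x₂) c]) with h | ⟨q', hq', hq'1, hq'2, hq'3⟩
  · exact h
  rcases key ((min (x - q'.1.x₂) c) / 2) (half_pos (lt_min (by linarith) hc0))
    (by linarith [min_le_right (x - q'.1.x₂) c]) with h | ⟨q'', hq'', hq''1, hq''2, hq''3⟩
  · exact h
  exfalso
  have step : ∀ {p p' : AdmissibleTile × A}, p ∈ ω.tiles → p' ∈ ω.tiles →
      (p.1.x₂ < x ∧ x - c ≤ p.1.x₂) → p.1.x₁ < x - c → p'.1.x₁ < x - c → p.1.x₂ < p'.1.x₂ →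
      p.1.y₂ ≤ p'.1.y₁ := by
    intro p p' hp hp' h1 h2 h3 h4
    have hd : s.Desc p' p := by
      rcases le_total p.1.y₁ p'.1.y₁ with h | h
      · exact desc_of_overlap hω hp' hp (by linarith) (by linarith) h
      · exact absurd (desc_of_overlap hω hp hp' (by linarith) (by linarith) h).x₂_le (not_le.2 h4)
    rcases hd.eq_or_y₂_le with rfl | h
    · exact absurd h4 (lt_irrefl _)
    · exact h
  have e1 := step hq hq' ⟨hq1.1, by linarith⟩ hq2 hq'2
    (by linarith [min_le_left (x - q.1.x₂) c])
  have e2 := step hq' hq'' ⟨hq'1.1, by linarith [min_le_right (x - q.1.x₂) c]⟩ hq'2 hq''2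
    (by linarith [min_le_left (x - q'.1.x₂) c])
  linarith [q'.1.y₁_lt_y₂]

end Finite

end WeightedSubstitution

/-! ### Approximation -/

section Approximation

variable {A : Type*}

theorem AdmissibleTile.isBounded_toSet (R : AdmissibleTile) : Bornology.IsBounded R.toSet := by
  rw [AdmissibleTile.toSet]
  exact (Metric.isBounded_Ioo _ _).reProdIm (Metric.isBounded_Ioo _ _)

theorem AdmissibleTile.nonempty_toSet (R : AdmissibleTile) : R.toSet.Nonempty := by
  obtain ⟨x, hx⟩ := exists_between R.x₁_lt_x₂
  obtain ⟨y, hy⟩ := exists_between R.y₁_lt_y₂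
  exact ⟨⟨x, y⟩, hx, hy⟩

/-- The sides of two tiles are `ε`-close. -/
def AdmissibleTile.Close (ε : ℝ) (R R' : AdmissibleTile) : Prop :=
  (|R.x₁ - R'.x₁| ≤ ε ∧ |R.x₂ - R'.x₂| ≤ ε) ∧ |R.y₁ - R'.y₁| ≤ ε ∧ |R.y₂ - R'.y₂| ≤ ε

/-- Each point of R has a point of R' within ε, so no side of R protrudes from R' by more than ε; by
symmetry the roles can be exchanged. -/
theorem AdmissibleTile.close_of_hausdorffDist_lt {R R' : AdmissibleTile} {ε : ℝ}
    (h : Metric.hausdorffDist R.toSet R'.toSet < ε) : R.Close ε R' := by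
  have key : ∀ {R R' : AdmissibleTile}, Metric.hausdorffDist R.toSet R'.toSet < ε →
      (R'.x₁ - ε ≤ R.x₁ ∧ R.x₂ ≤ R'.x₂ + ε) ∧ R'.y₁ - ε ≤ R.y₁ ∧ R.y₂ ≤ R'.y₂ + ε := by
    intro R R' h
    have hfin := Metric.hausdorffEDist_ne_top_of_nonempty_of_bounded R.nonempty_toSet
      R'.nonempty_toSet R.isBounded_toSet R'.isBounded_toSet
    have hz : ∀ x ∈ Set.Ioo R.x₁ R.x₂, ∀ y ∈ Set.Ioo R.y₁ R.y₂,
        (R'.x₁ - ε ≤ x ∧ x ≤ R'.x₂ + ε) ∧ R'.y₁ - ε ≤ y ∧ y ≤ R'.y₂ + ε := by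
      intro x hx y hy
      obtain ⟨w, hw, hd⟩ := Metric.exists_dist_lt_of_hausdorffDist_lt (x := (⟨x, y⟩ : ℂ))
        (show (⟨x, y⟩ : ℂ) ∈ R.toSet from ⟨hx, hy⟩) h hfin
      rw [AdmissibleTile.mem_toSet] at hw
      rw [Complex.dist_eq] at hd
      have h1 := abs_lt.1 ((Complex.abs_re_le_norm _).trans_lt hd)
      have h2 := abs_lt.1 ((Complex.abs_im_le_norm _).trans_lt hd)
      simp only [Complex.sub_re, Complex.sub_im] at h1 h2
      refine ⟨⟨?_, ?_⟩, ?_, ?_⟩ <;> linarith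
    obtain ⟨x₀, hx₀⟩ := exists_between R.x₁_lt_x₂
    obtain ⟨y₀, hy₀⟩ := exists_between R.y₁_lt_y₂
    refine ⟨⟨?_, ?_⟩, ?_, ?_⟩
    · exact le_of_forall_gt_imp_ge_of_dense fun x hx => by
        rcases lt_or_ge x R.x₂ with h' | h'
        · exact (hz x ⟨hx, h'⟩ y₀ hy₀).1.1
        · exact (hz x₀ hx₀ y₀ hy₀).1.1.trans (hx₀.2.le.trans h')
    · exact le_of_forall_lt_imp_le_of_dense fun x hx => by
        rcases lt_or_ge R.x₁ x with h' | h'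
        · exact (hz x ⟨h', hx⟩ y₀ hy₀).1.2
        · exact (h'.trans hx₀.1.le).trans (hz x₀ hx₀ y₀ hy₀).1.2
    · exact le_of_forall_gt_imp_ge_of_dense fun y hy => by
        rcases lt_or_ge y R.y₂ with h' | h'
        · exact (hz x₀ hx₀ y ⟨hy, h'⟩).2.1
        · exact (hz x₀ hx₀ y₀ hy₀).2.1.trans (hy₀.2.le.trans h')
    · exact le_of_forall_lt_imp_le_of_dense fun y hy => by
        rcases lt_or_ge R.y₁ y with h' | h'
        · exact (hz x₀ hx₀ y ⟨h', hy⟩).2.2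
        · exact (h'.trans hy₀.1.le).trans (hz x₀ hx₀ y₀ hy₀).2.2
  have h1 := key h
  rw [Metric.hausdorffDist_comm] at h
  have h2 := key h
  simp only [AdmissibleTile.Close, abs_le]
  refine ⟨⟨⟨?_, ?_⟩, ?_, ?_⟩, ⟨?_, ?_⟩, ?_, ?_⟩ <;> linarith

theorem ColoredTiling.exists_close_of_mem_closure {S : Set (ColoredTiling A)}
    {ω : ColoredTiling A} (hω : ω ∈ closure S) {p q : AdmissibleTile × A} (hp : p ∈ ω.tiles)
    (hq : q ∈ ω.tiles) {ε : ℝ} (hε : 0 < ε) :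
    ∃ ω' ∈ S, (∃ P, (P, p.2) ∈ ω'.tiles ∧ p.1.Close ε P) ∧
      ∃ Q, (Q, q.2) ∈ ω'.tiles ∧ q.1.Close ε Q := by
  have hU : ∀ r ∈ ω.tiles, IsOpen {ω' : ColoredTiling A | ∃ R' : AdmissibleTile,
      (R', r.2) ∈ ω'.tiles ∧ Metric.hausdorffDist r.1.toSet R'.toSet < ε} := fun r _ =>
    TopologicalSpace.GenerateOpen.basic _ ⟨r.1, r.2, ε, hε, rfl⟩
  have hmem : ∀ r ∈ ω.tiles, ω ∈ {ω' : ColoredTiling A | ∃ R' : AdmissibleTile,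
      (R', r.2) ∈ ω'.tiles ∧ Metric.hausdorffDist r.1.toSet R'.toSet < ε} := fun r hr =>
    ⟨r.1, hr, by rwa [Metric.hausdorffDist_self_zero]⟩
  obtain ⟨ω', ⟨⟨P, hP, hP'⟩, Q, hQ, hQ'⟩, hS⟩ := mem_closure_iff.1 hω _
    ((hU p hp).inter (hU q hq)) ⟨hmem p hp, hmem q hq⟩
  exact ⟨ω', hS, ⟨P, hP, AdmissibleTile.close_of_hausdorffDist_lt hP'⟩,
    Q, hQ, AdmissibleTile.close_of_hausdorffDist_lt hQ'⟩

end Approximation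

end

/-! ### Limits of tilings, and tilings invariant under a scaling -/

noncomputable section

theorem AdmissibleTile.eq_of_forall_close {R R' : AdmissibleTile} {K : ℝ} (hK : 0 < K)
    (h : ∀ ε, 0 < ε → R.Close (K * ε) R') : R = R' := by
  have key : ∀ {a b : ℝ}, (∀ ε, 0 < ε → |a - b| ≤ K * ε) → a = b := by
    intro a b hab
    by_contra hne
    have h0 : 0 < |a - b| := abs_pos.2 (sub_ne_zero.2 hne)
    have h1 := hab (|a - b| / (2 * K)) (by positivity)
    have h2 : K * (|a - b| / (2 * K)) = |a - b| / 2 := by field_simp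
    linarith
  ext
  · exact key fun ε hε => (h ε hε).1.1
  · exact key fun ε hε => (h ε hε).1.2
  · exact key fun ε hε => (h ε hε).2.1
  · exact key fun ε hε => (h ε hε).2.2

namespace WeightedSubstitution

variable {A : Type*} {s : WeightedSubstitution A} {g : A → PosReal} {ω : ColoredTiling A}

theorem isClosed_base : IsClosed (s.base : Set PosReal) := by
  rw [base, Subgroup.coe_sInf]
  exact isClosed_biInter fun H hH => hH.1

theorem mem_base_of_mem_iter {a : A} {n : ℕ} {w : PosReal} (h : (a, w) ∈ s.iter n a) :
    w ∈ s.base :=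
  Subgroup.mem_sInf.2 fun _ hH => hH.2 ⟨a, n, h⟩

/-- The heights of approximating tiles of the same color lie in g(a)G, which is closed. -/
theorem exists_y₁_eq_of_mem_closure (hω : ω ∈ closure (s.tilings g)) {p : AdmissibleTile × A}
    (hp : p ∈ ω.tiles) : ∃ l ∈ s.base, p.1.y₁ = (g p.2 * l : PosReal) := by
  let y : PosReal := ⟨p.1.y₁, p.1.y₁_pos⟩
  let K : Set PosReal := {u | (g p.2)⁻¹ * u ∈ s.base}
  have hK : IsClosed K := isClosed_base.preimage (f := fun u : PosReal => (g p.2)⁻¹ * u)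
    (Continuous.subtype_mk (continuous_const.mul continuous_subtype_val) _)
  have hy : y ∈ K := by
    rw [← hK.closure_eq, Metric.mem_closure_iff]
    intro ε hε
    obtain ⟨ω', hω', ⟨P, hP, hclose⟩, -⟩ :=
      ColoredTiling.exists_close_of_mem_closure hω hp hp (half_pos hε)
    obtain ⟨l, hl, h⟩ := (hω' _ hP).1
    refine ⟨g p.2 * l, ?_, ?_⟩
    · change (g p.2)⁻¹ * (g p.2 * l) ∈ s.base
      rwa [inv_mul_cancel_left]
    · rw [Subtype.dist_eq, Real.dist_eq, ← h]
      exact hclose.2.1.trans_lt (half_lt_self hε)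
  refine ⟨(g p.2)⁻¹ * y, hy, ?_⟩
  rw [mul_inv_cancel_left]

theorem close_child {P Q : AdmissibleTile} {ε : ℝ} (h : P.Close ε Q) (a : A) (i : Fin (s.len a)) :
    (s.child (P, a) i).1.Close (2 * ε) (s.child (Q, a) i).1 := by
  have hε : 0 ≤ ε := (abs_nonneg _).trans h.1.1
  have key : ∀ t : ℝ, 0 ≤ t → t ≤ 1 →
      |(P.x₁ + P.y₁ * t) - (Q.x₁ + Q.y₁ * t)| ≤ 2 * ε := by
    intro t h0 h1
    have e : (P.x₁ + P.y₁ * t) - (Q.x₁ + Q.y₁ * t) = (P.x₁ - Q.x₁) + (P.y₁ - Q.y₁) * t := by ring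
    rw [e]
    refine (abs_add_le _ _).trans ?_
    rw [abs_mul, abs_of_nonneg h0]
    have := mul_le_mul h.2.1 h1 h0 hε
    linarith [h.1.1]
  refine ⟨⟨?_, ?_⟩, ?_, ?_⟩
  · rw [child_x₁, child_x₁]
    have := s.left_add_weight_le_one ⟨a, i⟩
    have := s.weight_pos ⟨a, i⟩
    exact key _ (s.left_nonneg _) (by linarith)
  · rw [child_x₂, child_x₂]
    exact key _ (add_nonneg (s.left_nonneg _) (s.weight_pos _).le) (s.left_add_weight_le_one _)
  · rw [child_y₁, child_y₁, ← mul_sub, abs_mul, abs_of_pos (s.weight_pos _)]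
    have := mul_le_mul (s.weight_lt_one ⟨a, i⟩).le h.2.1 (abs_nonneg _) zero_le_one
    change _ * |P.y₁ - Q.y₁| ≤ _
    linarith
  · rw [child_y₂, child_y₂]
    change |P.y₁ - Q.y₁| ≤ _
    linarith [h.2.1]

/-- Let q be a tile of the limit that overlaps the expected child c. In an approximating tiling, the
tile near q and the true child near c still overlap, hence coincide. So q has the color of c and is
arbitrarily close to it. -/
theorem closure_tilings_subset : closure (s.tilings g) ⊆ s.tilings g := by
  intro ω hω p hp
  refine ⟨exists_y₁_eq_of_mem_closure hω hp, fun i => ?_⟩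
  change s.child p i ∈ ω.tiles
  set c := s.child p i with hc
  obtain ⟨x, hx, hx'⟩ := exists_between c.1.x₁_lt_x₂
  obtain ⟨y, hy, hy'⟩ := exists_between c.1.y₁_lt_y₂
  obtain ⟨q, hq, hqx, hqy⟩ := ω.exists_mem x (c.1.y₁_pos.trans hy)
  obtain ⟨δ, hδ, h1, h2, h3, h4⟩ : ∃ δ > 0, c.1.x₁ + δ ≤ q.1.x₂ ∧ q.1.x₁ + δ ≤ c.1.x₂ ∧
      c.1.y₁ + δ ≤ q.1.y₂ ∧ q.1.y₁ + δ ≤ c.1.y₂ := by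
    obtain ⟨δ, hδ, h⟩ := exists_between (lt_min
      (lt_min (show 0 < q.1.x₂ - c.1.x₁ by linarith) (show 0 < c.1.x₂ - q.1.x₁ by linarith))
      (lt_min (show 0 < q.1.y₂ - c.1.y₁ by linarith) (show 0 < c.1.y₂ - q.1.y₁ by linarith)))
    simp only [lt_min_iff] at h
    refine ⟨δ, hδ, ?_, ?_, ?_, ?_⟩ <;> linarith
  have key : ∀ ε, 0 < ε → q.1.Close (3 * ε) c.1 ∧ q.2 = c.2 := by
    intro ε hε
    -- With accuracy η the child moves by at most 2η and q by at most η. The total 3η is below the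
    -- overlap δ because η ≤ δ/4.
    obtain ⟨ω', hω', ⟨P, hP, hPc⟩, Q, hQ, hQc⟩ := ColoredTiling.exists_close_of_mem_closure hω hp hq
      (lt_min hε (show 0 < δ / 4 by linarith))
    have hε1 := min_le_left ε (δ / 4)
    have hε2 := min_le_right ε (δ / 4)
    generalize min ε (δ / 4) = η at *
    have hcc := close_child (s := s) hPc p.2 i
    have hmem := child_mem hω' hP i
    have hc' : (s.child (p.1, p.2) i) = c := rfl
    rw [hc'] at hcc
    obtain ⟨⟨a1, a2⟩, a3, a4⟩ := hQc
    obtain ⟨⟨b1, b2⟩, b3, b4⟩ := hcc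
    rw [abs_le] at a1 a2 a3 a4 b1 b2 b3 b4
    have heq := ω'.eq_of_overlap hQ hmem (by linarith) (by linarith) (by linarith) (by linarith)
    rw [← heq] at b1 b2 b3 b4
    refine ⟨⟨⟨?_, ?_⟩, ?_, ?_⟩, ?_⟩
    · rw [abs_le]; constructor <;> linarith
    · rw [abs_le]; constructor <;> linarith
    · rw [abs_le]; constructor <;> linarith
    · rw [abs_le]; constructor <;> linarith
    · have h5 := congrArg Prod.snd heq
      exact h5
  have h5 : q = c := Prod.ext
    (AdmissibleTile.eq_of_forall_close (K := 3) (by norm_num) fun ε hε => (key ε hε).1)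
    (key 1 one_pos).2
  rwa [← h5]

theorem Omega_subset_tilings : s.Omega g ⊆ s.tilings g :=
  (closure_mono fun _ h => h.1).trans closure_tilings_subset

theorem mem_Omega (hω : ω ∈ s.tilings g) (h : ¬ω.HasSeparatingLine) : ω ∈ s.Omega g :=
  subset_closure ⟨hω, h⟩

/-! ### Tilings that are invariant under a scaling -/

/-- The tile lⁿ p lies in both tilings. For large n it is above q, so q descends from it in ω, and
its descendants also belong to ω'. -/
theorem mem_of_smul_eq [Finite A] {ω' : ColoredTiling A} (hω : ω ∈ s.tilings g)
    (hω' : ω' ∈ s.tilings g) {l : PosReal} (hl : 1 < l) (h : l • ω = ω) (h' : l • ω' = ω')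
    {p q : AdmissibleTile × A} (hp : p ∈ ω.tiles) (hp' : p ∈ ω'.tiles) (hq : q ∈ ω.tiles)
    (hpq : ∃ N : ℕ, ∀ n, N ≤ n →
      (scaleTile (l ^ n) p).1.x₁ < q.1.x₂ ∧ q.1.x₁ < (scaleTile (l ^ n) p).1.x₂) :
    q ∈ ω'.tiles := by
  obtain ⟨N, hN⟩ := hpq
  obtain ⟨N', hN'⟩ := PosReal.exists_pow_mul_gt hl q.1.y₁ p.1.y₁_pos
  have h1 := hN (max N N') (le_max_left _ _)
  have h2 := hN' (max N N') (le_max_right _ _)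
  have hd : s.Desc (scaleTile (l ^ max N N') p) q :=
    desc_of_overlap hω (ColoredTiling.scaleTile_mem (ColoredTiling.pow_smul_eq h _) hp) hq h1.1 h1.2
      h2.le
  exact hd.mem hω' (ColoredTiling.scaleTile_mem (ColoredTiling.pow_smul_eq h' _) hp')

theorem exists_pow_overlap {l : PosReal} (hl : 1 < l) {p : AdmissibleTile × A}
    (q : AdmissibleTile × A) (h1 : p.1.x₁ < 0 ∨ p.1.x₁ = 0 ∧ 0 < q.1.x₂)
    (h2 : 0 < p.1.x₂ ∨ p.1.x₂ = 0 ∧ q.1.x₁ < 0) :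
    ∃ N : ℕ, ∀ n, N ≤ n →
      (scaleTile (l ^ n) p).1.x₁ < q.1.x₂ ∧ q.1.x₁ < (scaleTile (l ^ n) p).1.x₂ := by
  have e1 : ∃ N : ℕ, ∀ n, N ≤ n → (scaleTile (l ^ n) p).1.x₁ < q.1.x₂ := by
    rcases h1 with h | ⟨h, h'⟩
    · obtain ⟨N, hN⟩ := PosReal.exists_pow_mul_gt hl (-q.1.x₂) (neg_pos.2 h)
      refine ⟨N, fun n hn => ?_⟩
      have := hN n hn
      change ((l ^ n : PosReal) : ℝ) * _ < _
      linarith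
    · refine ⟨0, fun n _ => ?_⟩
      change ((l ^ n : PosReal) : ℝ) * _ < _
      rwa [h, mul_zero]
  have e2 : ∃ N : ℕ, ∀ n, N ≤ n → q.1.x₁ < (scaleTile (l ^ n) p).1.x₂ := by
    rcases h2 with h | ⟨h, h'⟩
    · exact PosReal.exists_pow_mul_gt hl q.1.x₁ h
    · refine ⟨0, fun n _ => ?_⟩
      change _ < ((l ^ n : PosReal) : ℝ) * _
      rwa [h, mul_zero]
  obtain ⟨N₁, h₁⟩ := e1
  obtain ⟨N₂, h₂⟩ := e2
  exact ⟨max N₁ N₂, fun n hn =>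
    ⟨h₁ n ((le_max_left _ _).trans hn), h₂ n ((le_max_right _ _).trans hn)⟩⟩

theorem eq_of_smul_eq [Finite A] {ω' : ColoredTiling A} (hω : ω ∈ s.tilings g)
    (hω' : ω' ∈ s.tilings g) {l : PosReal} (hl : 1 < l) (h : l • ω = ω) (h' : l • ω' = ω')
    {p : AdmissibleTile × A} (hp : p ∈ ω.tiles) (hp' : p ∈ ω'.tiles) (h1 : p.1.x₁ < 0)
    (h2 : 0 < p.1.x₂) : ω = ω' := by
  ext q
  exact ⟨fun hq => mem_of_smul_eq hω hω' hl h h' hp hp' hq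
      (exists_pow_overlap hl q (Or.inl h1) (Or.inl h2)),
    fun hq => mem_of_smul_eq hω' hω hl h' h hp' hp hq
      (exists_pow_overlap hl q (Or.inl h1) (Or.inl h2))⟩

theorem eq_of_smul_eq_of_isSeparatingLine [Finite A] {ω' : ColoredTiling A} (hω : ω ∈ s.tilings g)
    (hω' : ω' ∈ s.tilings g) {l : PosReal} (hl : 1 < l) (h : l • ω = ω) (h' : l • ω' = ω')
    (hs : ω.IsSeparatingLine 0) (hs' : ω'.IsSeparatingLine 0)
    {p q : AdmissibleTile × A} (hp : p ∈ ω.tiles) (hp' : p ∈ ω'.tiles) (hp0 : p.1.x₂ = 0)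
    (hq : q ∈ ω.tiles) (hq' : q ∈ ω'.tiles) (hq0 : q.1.x₁ = 0) : ω = ω' := by
  have key : ∀ {ω ω' : ColoredTiling A}, ω ∈ s.tilings g → ω' ∈ s.tilings g → l • ω = ω →
      l • ω' = ω' → ω.IsSeparatingLine 0 → p ∈ ω.tiles → p ∈ ω'.tiles → q ∈ ω.tiles →
      q ∈ ω'.tiles → ∀ r ∈ ω.tiles, r ∈ ω'.tiles := by
    intro ω ω' hω hω' h h' hs hp hp' hq hq' r hr
    have h0 := isSeparatingLine_iff.1 hs r hr
    rcases lt_or_ge r.1.x₁ 0 with hr0 | hr0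
    · refine mem_of_smul_eq hω hω' hl h h' hp hp' hr
        (exists_pow_overlap hl r (Or.inl ?_) (Or.inr ⟨hp0, hr0⟩))
      linarith [p.1.x₁_lt_x₂]
    · refine mem_of_smul_eq hω hω' hl h h' hq hq' hr
        (exists_pow_overlap hl r (Or.inr ⟨hq0, ?_⟩) (Or.inl ?_))
      · linarith [r.1.x₁_lt_x₂]
      · linarith [q.1.x₁_lt_x₂]
  ext r
  exact ⟨key hω hω' h h' hs hp hp' hq hq' r, key hω' hω h' h hs' hp' hp hq' hq r⟩

/-! ### The tiles above the origin -/

/-- The origin is below `p`, and not its right end. -/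
def AboveZero (p : AdmissibleTile × A) : Prop := p.1.x₁ ≤ 0 ∧ 0 < p.1.x₂

theorem AboveZero.scale {p : AdmissibleTile × A} (h : AboveZero p) (l : PosReal) :
    AboveZero (scaleTile l p) :=
  ⟨mul_nonpos_of_nonneg_of_nonpos l.2.le h.1, mul_pos l.2 h.2⟩

theorem Desc.aboveZero {p q : AdmissibleTile × A} (h : s.Desc p q) (hq : AboveZero q) :
    AboveZero p := ⟨h.x₁_le.trans hq.1, hq.2.trans_le h.x₂_le⟩

variable (s) in
open Classical in
/-- The index of the child of `p` that is above the origin. -/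
def digit (p : AdmissibleTile × A) : Fin (s.len p.2) :=
  -- The default makes the definition total; it is not reached when p itself is above the origin.
  if h : ∃ i, AboveZero (s.child p i) then h.choose else s.first p.2

theorem AboveZero.child_digit {p : AdmissibleTile × A} (h : AboveZero p) :
    AboveZero (s.child p (s.digit p)) := by
  have h' : ∃ i, AboveZero (s.child p i) := exists_child_mem p h.1 h.2
  rw [digit, dif_pos h']
  exact h'.choose_spec

theorem eq_digit {p : AdmissibleTile × A} {i : Fin (s.len p.2)} (h : AboveZero (s.child p i)) :
    i = s.digit p := by
  have h' := ((desc_child p i).aboveZero h).child_digit (s := s)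
  exact eq_of_child_overlap (h.1.trans_lt h'.2) (h'.1.trans_lt h.2)

variable (s) in
/-- The `n`-th descendant of `p` above the origin. -/
def chain (p : AdmissibleTile × A) (n : ℕ) : AdmissibleTile × A :=
  (fun q => s.child q (s.digit q))^[n] p

variable (s) in
/-- The edge from the `n`-th to the next tile of the chain of `p`. -/
def chainEdge (p : AdmissibleTile × A) (n : ℕ) : s.Edge := ⟨(s.chain p n).2, s.digit (s.chain p n)⟩

theorem chain_succ (p : AdmissibleTile × A) (n : ℕ) :
    s.chain p (n + 1) = s.child (s.chain p n) (s.digit (s.chain p n)) :=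
  Function.iterate_succ_apply' _ _ _

theorem chain_add (p : AdmissibleTile × A) (m n : ℕ) :
    s.chain p (m + n) = s.chain (s.chain p m) n := by
  rw [add_comm]
  exact Function.iterate_add_apply _ _ _ _

theorem chainEdge_add (p : AdmissibleTile × A) (m n : ℕ) :
    s.chainEdge p (m + n) = s.chainEdge (s.chain p m) n := by
  rw [chainEdge, chain_add]
  rfl

theorem tgt_chainEdge (p : AdmissibleTile × A) (n : ℕ) :
    s.tgt (s.chainEdge p n) = (s.chainEdge p (n + 1)).1 := by
  change _ = (s.chain p (n + 1)).2
  rw [chain_succ]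
  rfl

theorem desc_chain (p : AdmissibleTile × A) (n : ℕ) : s.Desc p (s.chain p n) := by
  induction n with
  | zero => exact .refl
  | succ n ih =>
    rw [chain_succ]
    exact Desc.child ih _

theorem AboveZero.chain {p : AdmissibleTile × A} (h : AboveZero p) (n : ℕ) :
    AboveZero (s.chain p n) := by
  induction n with
  | zero => exact h
  | succ n ih =>
    rw [chain_succ]
    exact ih.child_digit

/-- Ancestors of a tile above the origin are above the origin, and at each step only one child is.
So the descent has no freedom. -/
theorem Desc.exists_chain_eq {p q : AdmissibleTile × A} (h : s.Desc p q) (hq : AboveZero q) :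
    ∃ n, q = s.chain p n := by
  induction h with
  | refl => exact ⟨0, rfl⟩
  | tail hpr hr ih =>
    obtain ⟨i, rfl⟩ := hr
    obtain ⟨n, rfl⟩ := ih ((desc_child _ i).aboveZero hq)
    exact ⟨n + 1, by rw [chain_succ, eq_digit hq]⟩

theorem digit_scaleTile {p : AdmissibleTile × A} (h : AboveZero p) (l : PosReal) :
    s.digit (scaleTile l p) = s.digit p := by
  refine (eq_digit ?_).symm
  rw [← scaleTile_child]
  exact h.child_digit.scale l

theorem chain_scaleTile {p : AdmissibleTile × A} (h : AboveZero p) (l : PosReal) (n : ℕ) :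
    s.chain (scaleTile l p) n = scaleTile l (s.chain p n) := by
  induction n with
  | zero => rfl
  | succ n ih =>
    rw [chain_succ, chain_succ, ih, scaleTile_child, digit_scaleTile (h.chain n)]

theorem chainEdge_scaleTile {p : AdmissibleTile × A} (h : AboveZero p) (l : PosReal) (n : ℕ) :
    s.chainEdge (scaleTile l p) n = s.chainEdge p n := by
  rw [chainEdge, chain_scaleTile h, digit_scaleTile (h.chain n)]
  rfl

theorem chain_y₁ (p : AdmissibleTile × A) (n : ℕ) :
    (s.chain p n).1.y₁ = (∏ i ∈ Finset.range n, s.weight (s.chainEdge p i)) * p.1.y₁ := by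
  induction n with
  | zero => rw [Finset.prod_range_zero, one_mul]; rfl
  | succ n ih =>
    rw [chain_succ, child_y₁, ih, Finset.prod_range_succ]
    rw [mul_comm _ (s.weight _), mul_assoc]
    rfl

/-- The shrunken tile l⁻¹ p is a lower tile of ω in the same column, hence a member of the chain. As
chains commute with scaling, this is what makes the edge sequence periodic. -/
theorem exists_chain_eq_of_smul_eq [Finite A] (hω : ω ∈ s.tilings g) {l : PosReal} (hl : 1 < l)
    (h : l • ω = ω) {p : AdmissibleTile × A} (hp : p ∈ ω.tiles) (h0 : AboveZero p) :
    ∃ n, 0 < n ∧ scaleTile l⁻¹ p = s.chain p n := by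
  have hl' : l⁻¹ < 1 := inv_lt_one'.2 hl
  have hy : (scaleTile l⁻¹ p).1.y₁ < p.1.y₁ := mul_lt_of_lt_one_left p.1.y₁_pos hl'
  have h0' := h0.scale l⁻¹
  have hd : s.Desc p (scaleTile l⁻¹ p) := desc_of_overlap hω hp
    (ColoredTiling.scaleTile_mem (ColoredTiling.inv_smul_eq h) hp) (h0.1.trans_lt h0'.2)
    (h0'.1.trans_lt h0.2) hy.le
  obtain ⟨n, hn⟩ := hd.exists_chain_eq h0'
  refine ⟨n, Nat.pos_of_ne_zero ?_, hn⟩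
  rintro rfl
  rw [hn] at hy
  exact lt_irrefl _ hy

theorem chainEdge_add_of_chain_eq {p : AdmissibleTile × A} (h0 : AboveZero p) {l : PosReal} {n : ℕ}
    (h : scaleTile l p = s.chain p n) (m : ℕ) : s.chainEdge p (m + n) = s.chainEdge p m := by
  rw [add_comm, chainEdge_add, ← h, chainEdge_scaleTile h0]

theorem coe_eq_prod_of_chain_eq {p : AdmissibleTile × A} {l : PosReal} {n : ℕ}
    (h : scaleTile l p = s.chain p n) :
    (l : ℝ) = ∏ i ∈ Finset.range n, s.weight (s.chainEdge p i) := by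
  have h1 := chain_y₁ (s := s) p n
  rw [← h] at h1
  exact mul_right_cancel₀ p.1.y₁_pos.ne' h1

end WeightedSubstitution

end

noncomputable section

namespace WeightedSubstitution

open PeriodicPath

variable {A : Type*} {s : WeightedSubstitution A} {g : A → PosReal} {ω : ColoredTiling A}

/-! ### The position of the origin -/

variable (s) in
/-- The relative position of the point with the address `e` in a tile. -/
def pos (e : ℕ → s.Edge) : ℝ := ∑' n, (∏ i ∈ Finset.range n, s.weight (e i)) * s.left (e n)

theorem prod_weight_pos (e : ℕ → s.Edge) (n : ℕ) :
    0 < ∏ i ∈ Finset.range n, s.weight (e i) := Finset.prod_pos fun _ _ => s.weight_pos _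

theorem pos_nonneg (e : ℕ → s.Edge) : 0 ≤ s.pos e :=
  tsum_nonneg fun n => mul_nonneg (prod_weight_pos e n).le (s.left_nonneg _)

section Position

variable [Finite A]

theorem summable_pos (e : ℕ → s.Edge) :
    Summable fun n => (∏ i ∈ Finset.range n, s.weight (e i)) * s.left (e n) := by
  obtain ⟨r, hr0, hr1, hr⟩ := s.exists_weight_le
  refine Summable.of_nonneg_of_le
    (fun n => mul_nonneg (prod_weight_pos e n).le (s.left_nonneg _)) (fun n => ?_)
    (summable_geometric_of_lt_one hr0.le hr1)
  have h1 : ∏ i ∈ Finset.range n, s.weight (e i) ≤ r ^ n := by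
    have := Finset.prod_le_prod (s := Finset.range n) (fun i _ => (s.weight_pos (e i)).le)
      fun i _ => hr (e i)
    simpa using this
  have h2 : s.left (e n) ≤ 1 := by
    linarith [s.left_add_weight_le_one (e n), s.weight_pos (e n)]
  calc _ ≤ r ^ n * 1 := mul_le_mul h1 h2 (s.left_nonneg _) (pow_nonneg hr0.le n)
    _ = r ^ n := mul_one _

theorem pos_eq (e : ℕ → s.Edge) :
    s.pos e = s.left (e 0) + s.weight (e 0) * s.pos fun n => e (n + 1) := by
  rw [pos, (summable_pos e).tsum_eq_zero_add, Finset.prod_range_zero, one_mul, pos, ← tsum_mul_left]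
  congr 1
  refine tsum_congr fun n => ?_
  rw [Finset.prod_range_succ']
  ring

theorem pos_le_one (e : ℕ → s.Edge) : s.pos e ≤ 1 := by
  refine (summable_pos e).tsum_le_of_sum_range_le fun n => ?_
  have h : ∀ n, ∑ i ∈ Finset.range n, (∏ j ∈ Finset.range i, s.weight (e j)) * s.left (e i) +
      ∏ j ∈ Finset.range n, s.weight (e j) ≤ 1 := by
    intro n
    induction n with
    | zero => simp
    | succ n ih =>
      rw [Finset.sum_range_succ, Finset.prod_range_succ]
      have := mul_le_mul_of_nonneg_left (s.left_add_weight_le_one (e n)) (prod_weight_pos e n).le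
      linarith
  linarith [h n, prod_weight_pos e n]

/-- Each step of the recursion contracts differences by at most r < 1, so it has only one solution
with values in [0, 1]. -/
theorem eq_pos {e : ℕ → s.Edge} {v : ℕ → ℝ} (h0 : ∀ n, 0 ≤ v n) (h1 : ∀ n, v n ≤ 1)
    (hv : ∀ n, v n = s.left (e n) + s.weight (e n) * v (n + 1)) : v 0 = s.pos e := by
  obtain ⟨r, hr0, hr1, hr⟩ := s.exists_weight_le
  have key : ∀ n, |v 0 - s.pos e| ≤ r ^ n * |v n - s.pos fun k => e (k + n)| := by
    intro n
    induction n with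
    | zero => simp
    | succ n ih =>
      refine ih.trans ?_
      rw [hv n, pos_eq, pow_succ, mul_assoc]
      refine mul_le_mul_of_nonneg_left ?_ (pow_nonneg hr0.le n)
      have e1 : (fun k => e (k + 1 + n)) = fun k => e (k + (n + 1)) := by
        funext k
        rw [add_right_comm, add_assoc]
      rw [zero_add, e1, add_sub_add_left_eq_sub, ← mul_sub, abs_mul,
        abs_of_pos (s.weight_pos _)]
      exact mul_le_mul_of_nonneg_right (hr _) (abs_nonneg _)
  have h2 : |v 0 - s.pos e| ≤ 0 := by
    refine ge_of_tendsto' (tendsto_pow_atTop_nhds_zero_of_lt_one hr0.le hr1) fun n => ?_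
    refine (key n).trans (mul_le_of_le_one_right (pow_nonneg hr0.le n) ?_)
    rw [abs_le]
    constructor
    · linarith [h0 n, pos_le_one fun k => e (k + n)]
    · linarith [h1 n, pos_nonneg fun k => e (k + n)]
  exact sub_eq_zero.1 (abs_eq_zero.1 (le_antisymm h2 (abs_nonneg _)))

theorem pos_eq_zero {e : ℕ → s.Edge} (h : ∀ n, s.IsFirst (e n)) : s.pos e = 0 :=
  (eq_pos (v := fun _ => 0) (fun _ => le_rfl) (fun _ => zero_le_one)
    fun n => by rw [s.left_eq_zero (h n)]; simp).symm

theorem pos_eq_one {e : ℕ → s.Edge} (h : ∀ n, s.IsLast (e n)) : s.pos e = 1 :=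
  (eq_pos (v := fun _ => 1) (fun _ => zero_le_one) (fun _ => le_rfl)
    fun n => by rw [mul_one, s.left_add_weight_eq_one (h n)]).symm

theorem pos_pos {e : ℕ → s.Edge} (h : ¬∀ n, s.IsFirst (e n)) : 0 < s.pos e := by
  obtain ⟨n, hn⟩ := not_forall.1 h
  clear h
  induction n generalizing e with
  | zero =>
    rw [pos_eq]
    have := mul_nonneg (s.weight_pos (e 0)).le (pos_nonneg fun n => e (n + 1))
    linarith [s.left_pos hn]
  | succ n ih =>
    rw [pos_eq]
    have := mul_pos (s.weight_pos (e 0)) (ih (e := fun n => e (n + 1)) hn)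
    linarith [s.left_nonneg (e 0)]

theorem pos_lt_one {e : ℕ → s.Edge} (h : ¬∀ n, s.IsLast (e n)) : s.pos e < 1 := by
  obtain ⟨n, hn⟩ := not_forall.1 h
  clear h
  induction n generalizing e with
  | zero =>
    rw [pos_eq]
    have := mul_le_mul_of_nonneg_left (pos_le_one fun n => e (n + 1)) (s.weight_pos (e 0)).le
    linarith [s.left_add_weight_lt_one hn]
  | succ n ih =>
    rw [pos_eq]
    have := mul_lt_mul_of_pos_left (ih (e := fun n => e (n + 1)) hn) (s.weight_pos (e 0))
    linarith [s.left_add_weight_le_one (e 0)]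

/-- The relative positions of the origin in the tiles of the chain satisfy the recursion that
characterizes `pos`. So the address and the height fix the place of the tile. -/
theorem AboveZero.x₁_eq {p : AdmissibleTile × A} (h : AboveZero p) :
    p.1.x₁ = -(s.pos (s.chainEdge p) * p.1.y₁) := by
  have hy := fun n => (s.chain p n).1.y₁_pos
  have h1 := eq_pos (e := s.chainEdge p) (v := fun n => -(s.chain p n).1.x₁ / (s.chain p n).1.y₁)
    (fun n => div_nonneg (neg_nonneg.2 (h.chain n).1) (hy n).le)
    (fun n => by
      rw [div_le_one (hy n)]
      linarith [(h.chain (s := s) n).2, (s.chain p n).1.width_eq])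
    (fun n => by
      rw [chain_succ, child_x₁, child_y₁]
      have h1 := (hy n).ne'
      have h2 := (s.weight_pos (s.chainEdge p n)).ne'
      change _ = s.left (s.chainEdge p n) + s.weight (s.chainEdge p n) *
        (-((s.chain p n).1.x₁ + (s.chain p n).1.y₁ * s.left (s.chainEdge p n)) /
          (s.weight (s.chainEdge p n) * (s.chain p n).1.y₁))
      field_simp
      ring)
  rw [← h1]
  have := (hy 0).ne'
  change p.1.x₁ = -(-p.1.x₁ / p.1.y₁ * p.1.y₁)
  rw [div_mul_cancel₀ _ p.1.y₁_pos.ne', neg_neg]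

end Position

theorem child_congr {P Q : AdmissibleTile} {a : A} (hx : P.x₁ = Q.x₁) (hy : P.y₁ = Q.y₁)
    (i : Fin (s.len a)) : s.child (P, a) i = s.child (Q, a) i := by
  refine Prod.ext ?_ rfl
  ext
  · rw [child_x₁, child_x₁]
    change P.x₁ + P.y₁ * _ = Q.x₁ + Q.y₁ * _
    rw [hx, hy]
  · rw [child_x₂, child_x₂]
    change P.x₁ + P.y₁ * _ = Q.x₁ + Q.y₁ * _
    rw [hx, hy]
  · rw [child_y₁, child_y₁]
    change _ * P.y₁ = _ * Q.y₁
    rw [hy]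
  · exact hy

/-- Children do not depend on the upper side of the tile. An address together with a height leaves
y₂ undetermined, so tiles with the same data can be identified only from the first descendant on. -/
theorem chain_congr {p q : AdmissibleTile × A} (h : AboveZero p) (hx : p.1.x₁ = q.1.x₁)
    (hy : p.1.y₁ = q.1.y₁) (hc : p.2 = q.2) (n : ℕ) : s.chain p (n + 1) = s.chain q (n + 1) := by
  obtain ⟨P, a⟩ := p
  obtain ⟨Q, b⟩ := q
  obtain rfl : a = b := hc
  have h1 : s.digit (P, a) = s.digit (Q, a) := by
    have h3 : AboveZero (s.child (P, a) (s.digit (P, a))) := h.child_digit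
    rw [child_congr hx hy] at h3
    exact eq_digit h3
  have h2 : s.chain (P, a) 1 = s.chain (Q, a) 1 := by
    change s.child (P, a) (s.digit (P, a)) = s.child (Q, a) (s.digit (Q, a))
    rw [h1, child_congr hx hy]
  rw [add_comm, chain_add, chain_add, h2]

/-- A path that does not follow the boundary of the tiles. -/
def Interior (x : s.Path) : Prop := (¬∀ n, s.IsFirst (x.edge n)) ∧ ¬∀ n, s.IsLast (x.edge n)

theorem Interior.shift_iterate {x : s.Path} (h : Interior x) (k : ℕ) :
    Interior (PeriodicPath.shift^[k] x) := by
  rwa [Interior, forall_edge_shift_iterate_iff, forall_edge_shift_iterate_iff]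

theorem shift_iterate_edge (x : s.Path) (k : ℕ) :
    (PeriodicPath.shift^[k] x).edge = fun n => x.edge (n + k) :=
  funext fun n => shift_iterate_apply x k n

section Chain

variable [Finite A]

theorem interior_of_chainEdge_eq {x : s.Path} {p : AdmissibleTile × A}
    (h : ∀ n, s.chainEdge p n = x.edge n) (h1 : p.1.x₁ < 0) (h2 : 0 < p.1.x₂) : Interior x := by
  have h3 := AboveZero.x₁_eq (s := s) ⟨h1.le, h2⟩
  rw [show s.chainEdge p = x.edge from funext h] at h3
  constructor
  · intro h4
    rw [pos_eq_zero h4] at h3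
    linarith
  · intro h4
    rw [pos_eq_one h4] at h3
    linarith [p.1.width_eq]

theorem chain_x₁_neg {x : s.Path} {p : AdmissibleTile × A} (h0 : AboveZero p)
    (h : ∀ n, s.chainEdge p n = x.edge n) (hx : Interior x) (k : ℕ) : (s.chain p k).1.x₁ < 0 := by
  rw [(h0.chain (s := s) k).x₁_eq (s := s)]
  have h1 : s.chainEdge (s.chain p k) = (PeriodicPath.shift^[k] x).edge := by
    rw [shift_iterate_edge]
    funext n
    rw [← chainEdge_add, h, add_comm]
  rw [h1]
  have := mul_pos (pos_pos (hx.shift_iterate k).1) (s.chain p k).1.y₁_pos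
  linarith

/-- This is the converse of `AboveZero.x₁_eq`. An interior path keeps the remaining position
strictly below 1, so the half-open choice in `digit` selects precisely the edge of x. -/
theorem chainEdge_eq {x : s.Path} (hx : Interior x) {p : AdmissibleTile × A}
    (hc : p.2 = (x.edge 0).1) (hp : p.1.x₁ = -(s.pos x.edge * p.1.y₁)) (n : ℕ) :
    s.chainEdge p n = x.edge n := by
  have step : ∀ {q : AdmissibleTile × A} {e : s.Edge} {v : ℝ}, q.2 = e.1 → 0 ≤ v → v < 1 →
      q.1.x₁ = -((s.left e + s.weight e * v) * q.1.y₁) →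
      (⟨q.2, s.digit q⟩ : s.Edge) = e ∧ (s.child q (s.digit q)).1.x₁ =
        -(v * (s.child q (s.digit q)).1.y₁) := by
    rintro ⟨Q, a⟩ ⟨b, i⟩ v h hv0 hv1 hq
    obtain rfl : a = b := h
    change Q.x₁ = -(_ * Q.y₁) at hq
    have hx1 : (s.child (Q, a) i).1.x₁ = -(v * (s.child (Q, a) i).1.y₁) := by
      rw [child_x₁, child_y₁]
      change Q.x₁ + Q.y₁ * _ = -(v * (_ * Q.y₁))
      rw [hq]
      ring
    have hy := (s.child (Q, a) i).1.y₁_pos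
    have h1 : AboveZero (s.child (Q, a) i) := by
      refine ⟨?_, ?_⟩
      · rw [hx1]
        linarith [mul_nonneg hv0 hy.le]
      · have := (s.child (Q, a) i).1.width_eq
        have := mul_lt_mul_of_pos_right hv1 hy
        linarith
    rw [← eq_digit h1]
    exact ⟨rfl, hx1⟩
  have main : ∀ n, ((s.chain p n).2 = (x.edge n).1 ∧ (s.chain p n).1.x₁ =
      -(s.pos (PeriodicPath.shift^[n] x).edge * (s.chain p n).1.y₁)) ∧
      s.chainEdge p n = x.edge n := by
    have hs : ∀ n, (s.chain p n).2 = (x.edge n).1 → (s.chain p n).1.x₁ =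
        -(s.pos (PeriodicPath.shift^[n] x).edge * (s.chain p n).1.y₁) →
        s.chainEdge p n = x.edge n ∧ (s.chain p (n + 1)).1.x₁ =
          -(s.pos (PeriodicPath.shift^[n + 1] x).edge * (s.chain p (n + 1)).1.y₁) := by
      intro n h1 h2
      rw [pos_eq] at h2
      have e1 : (PeriodicPath.shift^[n] x).edge 0 = x.edge n := by
        rw [shift_iterate_apply, zero_add]
      have e2 : (fun k => (PeriodicPath.shift^[n] x).edge (k + 1)) =
          (PeriodicPath.shift^[n + 1] x).edge := by
        rw [Function.iterate_succ_apply']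
        rfl
      rw [e1, e2] at h2
      rw [chain_succ]
      exact step h1 (pos_nonneg _) (pos_lt_one (hx.shift_iterate (n + 1)).2) h2
    intro n
    induction n with
    | zero => exact ⟨⟨hc, hp⟩, (hs 0 hc hp).1⟩
    | succ n ih =>
      have h1 := hs n ih.1.1 ih.1.2
      have h2 : (s.chain p (n + 1)).2 = (x.edge (n + 1)).1 := by
        rw [← x.tgt_edge, ← h1.1, tgt_chainEdge]
        rfl
      exact ⟨⟨h2, h1.2⟩, (hs (n + 1) h2 h1.2).1⟩
  exact (main n).2

end Chain

/-! ### The tiling spanned by a tile -/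

theorem desc_pow_scaleTile {p : AdmissibleTile × A} {l : PosReal}
    (hd : s.Desc p (scaleTile l⁻¹ p)) {k m : ℕ} (h : k ≤ m) :
    s.Desc (scaleTile (l ^ m) p) (scaleTile (l ^ k) p) := by
  induction m, h using Nat.le_induction with
  | base => exact .refl
  | succ m _ ih =>
    refine Relation.ReflTransGen.trans ?_ ih
    have := hd.scale (l ^ (m + 1))
    rwa [← scaleTile.mul, pow_succ, mul_inv_cancel_right] at this

variable (s) in
/-- The tiling that consists of the descendants of the tiles `lᵏ p`. -/
def spanTiling [Finite A] (p : AdmissibleTile × A) (l : PosReal) (hl : 1 < l)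
    (hd : s.Desc p (scaleTile l⁻¹ p)) (h1 : p.1.x₁ < 0) (h2 : 0 < p.1.x₂) : ColoredTiling A where
  tiles := {q | ∃ k : ℕ, s.Desc (scaleTile (l ^ k) p) q}
  disjoint := by
    rintro q ⟨k, hk⟩ q' ⟨k', hk'⟩ hne
    exact desc_disjoint ((desc_pow_scaleTile hd (le_max_left k k')).trans hk)
      ((desc_pow_scaleTile hd (le_max_right k k')).trans hk') hne
  cover := by
    ext z
    simp only [Set.mem_iUnion, exists_prop, Set.mem_ofPred_eq]
    constructor
    · rintro ⟨q, -, hz⟩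
      exact q.1.y₁_pos.trans_le (AdmissibleTile.mem_closure_toSet.1 hz).2.1
    · intro hz
      obtain ⟨N₁, h₁⟩ := PosReal.exists_pow_mul_gt hl (-z.re) (neg_pos.2 h1)
      obtain ⟨N₂, h₂⟩ := PosReal.exists_pow_mul_gt hl z.re h2
      obtain ⟨N₃, h₃⟩ := PosReal.exists_pow_mul_gt hl z.im p.1.y₁_pos
      set N := max N₁ (max N₂ N₃)
      have a₁ := h₁ N (le_max_left _ _)
      have a₂ := h₂ N ((le_max_left _ _).trans (le_max_right _ _))
      have a₃ := h₃ N ((le_max_right _ _).trans (le_max_right _ _))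
      obtain ⟨q, hq, hqx, hqy⟩ := exists_desc_mem (s := s) (scaleTile (l ^ N) p) (x := z.re)
        (y := z.im) (by rw [scaleTile.x₁]; linarith) a₂ hz a₃.le
      exact ⟨q, ⟨N, hq⟩, AdmissibleTile.mem_closure_toSet.2
        ⟨⟨hqx.1, hqx.2.le⟩, hqy.1.le, hqy.2⟩⟩

theorem smul_spanTiling [Finite A] {p : AdmissibleTile × A} {l : PosReal} (hl : 1 < l)
    (hd : s.Desc p (scaleTile l⁻¹ p)) (h1 : p.1.x₁ < 0) (h2 : 0 < p.1.x₂) :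
    l • s.spanTiling p l hl hd h1 h2 = s.spanTiling p l hl hd h1 h2 := by
  ext q
  rw [ColoredTiling.mem_smul]
  constructor
  · rintro ⟨k, hk⟩
    refine ⟨k + 1, ?_⟩
    have := Desc.scale hk l
    rwa [scaleTile.scale_inv, ← scaleTile.mul, ← pow_succ'] at this
  · rintro ⟨k, hk⟩
    refine ⟨k, ?_⟩
    have := Desc.scale ((desc_pow_scaleTile hd k.le_succ).trans hk) l⁻¹
    rwa [← scaleTile.mul, pow_succ', inv_mul_cancel_left] at this

/-- The compatibility of g is exactly the statement that the condition on heights passes from a tile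
to its children. -/
theorem Desc.exists_y₁_eq (hg : s.IsCompatible g) {p q : AdmissibleTile × A} (h : s.Desc p q)
    (hp : ∃ l ∈ s.base, p.1.y₁ = (g p.2 * l : PosReal)) :
    ∃ l ∈ s.base, q.1.y₁ = (g q.2 * l : PosReal) := by
  induction h with
  | refl => exact hp
  | @tail r _ _ hr ih =>
    obtain ⟨i, rfl⟩ := hr
    obtain ⟨l, hl, h⟩ := ih
    have h1 : (g r.2 * s.τ r.2 i) * l ∈ g (s.σ r.2 i) • (s.base : Set PosReal) := by
      rw [hg]
      exact Set.smul_mem_smul_set hl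
    obtain ⟨m, hm, h2⟩ := h1
    refine ⟨m, hm, ?_⟩
    rw [child_snd]
    change _ = ((g (s.σ r.2 i) • m : PosReal) : ℝ)
    change g (s.σ r.2 i) • m = _ at h2
    rw [h2, child_y₁, h]
    simp only [Positive.val_mul, weight]
    ring

theorem spanTiling_mem_tilings [Finite A] (hg : s.IsCompatible g) {p : AdmissibleTile × A}
    {l : PosReal} (hl : 1 < l) (hd : s.Desc p (scaleTile l⁻¹ p)) (h1 : p.1.x₁ < 0)
    (h2 : 0 < p.1.x₂) (hlb : l ∈ s.base) (hp : ∃ l ∈ s.base, p.1.y₁ = (g p.2 * l : PosReal)) :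
    s.spanTiling p l hl hd h1 h2 ∈ s.tilings g := by
  rintro q ⟨k, hk⟩
  refine ⟨Desc.exists_y₁_eq hg hk ?_, fun i => ⟨k, Desc.child hk i⟩⟩
  obtain ⟨m, hm, h⟩ := hp
  refine ⟨l ^ k * m, mul_mem (pow_mem hlb k) hm, ?_⟩
  rw [scaleTile.y₁, h]
  simp only [Positive.val_mul]
  ring

theorem mem_spanTiling [Finite A] {p : AdmissibleTile × A} {l : PosReal} (hl : 1 < l)
    (hd : s.Desc p (scaleTile l⁻¹ p)) (h1 : p.1.x₁ < 0) (h2 : 0 < p.1.x₂) :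
    p ∈ (s.spanTiling p l hl hd h1 h2).tiles :=
  ⟨0, by rw [pow_zero, scaleTile.one]⟩

/-! ### Tilings with a given code -/

variable (s g) in
/-- The tiling `ω` is invariant under a scaling, and its tiles above the origin follow the path
`x`. -/
structure Coded (ω : ColoredTiling A) (x : s.Path) : Prop where
  mem : ω ∈ s.tilings g
  smul : ∃ l ∈ s.base, 1 < l ∧ l • ω = ω
  tile : ∃ p ∈ ω.tiles, (p.1.x₁ < 0 ∧ 0 < p.1.x₂) ∧ ∀ n, s.chainEdge p n = x.edge n

theorem prod_τ_mem_iter (x : s.Path) (n : ℕ) :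
    ((x.edge n).1, x.pathProd (fun e => s.τ e.1 e.2) n) ∈ s.iter n (x.edge 0).1 := by
  induction n generalizing x with
  | zero => exact List.mem_singleton.2 rfl
  | succ n ih =>
    rw [iter, List.mem_flatten]
    have h := ih x.shift
    have h1 : (x.shift.edge 0).1 = s.σ (x.edge 0).1 (x.edge 0).2 := (x.tgt_edge 0).symm
    rw [h1] at h
    refine ⟨_, List.mem_ofFn.2 ⟨(x.edge 0).2, rfl⟩, List.mem_map.2 ⟨_, h, ?_⟩⟩
    rw [pathProd, pathProd, Finset.prod_range_succ', mul_comm]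
    rfl

/-- Along a closed path from a to a, the product of the weights is some τⁿ(a)_i with σⁿ(a)_i = a. -/
theorem prod_τ_mem_base {x : s.Path} {n : ℕ} (h : PeriodicPath.shift^[n] x = x) :
    x.pathProd (fun e => s.τ e.1 e.2) n ∈ s.base := by
  have h1 := prod_τ_mem_iter x n
  have h2 := (shift_iterate_eq_self_iff x n).1 h 0
  rw [zero_add] at h2
  rw [h2] at h1
  exact mem_base_of_mem_iter h1

theorem coe_prod_τ (x : s.Path) (n : ℕ) :
    ((x.pathProd (fun e => s.τ e.1 e.2) n : PosReal) : ℝ) = x.pathProd s.weight n := by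
  induction n with
  | zero => rfl
  | succ n ih =>
    rw [pathProd, Finset.prod_range_succ, pathProd, Finset.prod_range_succ, Positive.val_mul]
    exact congrArg₂ _ ih rfl

theorem pathProd_weight_pos (x : s.Path) (n : ℕ) : 0 < x.pathProd s.weight n :=
  prod_weight_pos x.edge n

theorem pathProd_weight_lt_one (x : s.Path) {n : ℕ} (hn : 0 < n) : x.pathProd s.weight n < 1 := by
  obtain ⟨n, rfl⟩ := Nat.exists_eq_succ_of_ne_zero hn.ne'
  rw [pathProd, Finset.prod_range_succ]
  exact mul_lt_one_of_nonneg_of_lt_one_right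
    (Finset.prod_le_one (fun _ _ => (s.weight_pos _).le) fun _ _ => (s.weight_lt_one _).le)
    (s.weight_pos _).le (s.weight_lt_one _)

end WeightedSubstitution

end

/-! ### The correspondence between cycles and closed orbits -/

noncomputable section

namespace WeightedSubstitution

open PeriodicPath

variable {A : Type*} {s : WeightedSubstitution A} {g : A → PosReal}
  {ω ω' : ColoredTiling A} {x y : s.Path}

theorem mem_orbit_base_iff : ω' ∈ MulAction.orbit s.base ω ↔ ∃ t ∈ s.base, t • ω = ω' :=
  ⟨fun ⟨t, h⟩ => ⟨t.1, t.2, h⟩, fun ⟨t, ht, h⟩ => ⟨⟨t, ht⟩, h⟩⟩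

/-- Scalings commute, so all points of an orbit have the same stabilizer. -/
theorem smul_eq_of_mem_orbit (h : ω' ∈ MulAction.orbit s.base ω) {l : PosReal} (hl : l • ω' = ω') :
    l • ω = ω := by
  obtain ⟨t, -, rfl⟩ := mem_orbit_base_iff.1 h
  rw [← mul_smul, mul_comm, mul_smul] at hl
  exact smul_left_cancel t hl

theorem multiplicativeCycles_orbit :
    s.multiplicativeCycles (MulAction.orbit s.base ω) =
      {c | ∃ l ∈ s.base, 1 < l ∧ l • ω = ω ∧ c = (l : ℝ)} := by
  ext c
  constructor
  · rintro ⟨l, hl, hl1, ⟨ω', hω', h⟩, rfl⟩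
    exact ⟨l, hl, hl1, smul_eq_of_mem_orbit hω' h, rfl⟩
  · rintro ⟨l, hl, hl1, h, rfl⟩
    exact ⟨l, hl, hl1, ⟨ω, MulAction.mem_orbit_self ω, h⟩, rfl⟩

namespace Coded

theorem not_hasSeparatingLine (h : s.Coded g ω x) : ¬ω.HasSeparatingLine := by
  obtain ⟨p, hp, hp', -⟩ := h.tile
  obtain ⟨l, -, hl, hlω⟩ := h.smul
  exact not_hasSeparatingLine_of_smul_eq hl hlω hp hp'.1 hp'.2

theorem smul_base (h : s.Coded g ω x) {t : PosReal} (ht : t ∈ s.base) : s.Coded g (t • ω) x := by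
  obtain ⟨p, hp, hp', he⟩ := h.tile
  obtain ⟨l, hl, hl1, hlω⟩ := h.smul
  refine ⟨smul_mem_tilings h.mem ht, ⟨l, hl, hl1, ?_⟩, scaleTile t p,
    ColoredTiling.scaleTile_mem_smul.2 hp,
    ⟨mul_neg_of_pos_of_neg t.2 hp'.1, mul_pos t.2 hp'.2⟩, fun n => ?_⟩
  · rw [← mul_smul, mul_comm, mul_smul, hlω]
  · rw [chainEdge_scaleTile ⟨hp'.1.le, hp'.2⟩, he]

theorem mem_Omega (h : s.Coded g ω x) : ω ∈ s.Omega g :=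
  WeightedSubstitution.mem_Omega h.mem h.not_hasSeparatingLine

theorem orbit_mem_closedOrbits (h : s.Coded g ω x) :
    MulAction.orbit s.base ω ∈ s.closedOrbits g := ⟨ω, h.mem_Omega, h.smul, rfl⟩

variable [Finite A]

theorem interior (h : s.Coded g ω x) : Interior x := by
  obtain ⟨p, -, hp, he⟩ := h.tile
  exact interior_of_chainEdge_eq he hp.1 hp.2

theorem shift_iterate (h : s.Coded g ω x) (k : ℕ) : s.Coded g ω (PeriodicPath.shift^[k] x) := by
  obtain ⟨p, hp, hp', he⟩ := h.tile
  refine ⟨h.mem, h.smul, s.chain p k, (desc_chain p k).mem h.mem hp, ⟨?_, ?_⟩, fun n => ?_⟩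
  · exact chain_x₁_neg ⟨hp'.1.le, hp'.2⟩ he h.interior k
  · exact (AboveZero.chain ⟨hp'.1.le, hp'.2⟩ k).2
  · rw [← chainEdge_add, he, shift_iterate_apply, add_comm]

/-- Of two tiles above the origin the lower belongs to the chain of the higher, so one code is a
shift of the other. -/
theorem exists_shift_iterate_eq (h : s.Coded g ω x) (h' : s.Coded g ω y) :
    ∃ k, PeriodicPath.shift^[k] x = y := by
  obtain ⟨p, hp, hp', he⟩ := h.tile
  obtain ⟨q, hq, hq', hf⟩ := h'.tile
  have key : ∀ {p q : AdmissibleTile × A} {x y : s.Path}, p ∈ ω.tiles → q ∈ ω.tiles →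
      (p.1.x₁ < 0 ∧ 0 < p.1.x₂) → (q.1.x₁ < 0 ∧ 0 < q.1.x₂) → (∀ n, s.chainEdge p n = x.edge n) →
      (∀ n, s.chainEdge q n = y.edge n) → q.1.y₁ ≤ p.1.y₁ →
      ∃ k, PeriodicPath.shift^[k] x = y := by
    intro p q x y hp hq hp' hq' he hf hy
    have hd := desc_of_overlap h.mem hp hq (hp'.1.trans hq'.2) (hq'.1.trans hp'.2) hy
    obtain ⟨k, rfl⟩ := hd.exists_chain_eq ⟨hq'.1.le, hq'.2⟩
    refine ⟨k, PeriodicPath.ext' fun n => ?_⟩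
    rw [shift_iterate_apply, ← he, ← hf, ← chainEdge_add, add_comm]
  rcases le_total q.1.y₁ p.1.y₁ with h1 | h1
  · exact key hp hq hp' hq' he hf h1
  · obtain ⟨k, rfl⟩ := key hq hp hq' hp' hf he h1
    exact y.exists_shift_iterate_eq k

/-- A scaling that preserves `ω` corresponds to a period of the code. -/
theorem exists_period (h : s.Coded g ω x) {l : PosReal} (hl : 1 < l) (hlω : l • ω = ω) :
    ∃ n, 0 < n ∧ PeriodicPath.shift^[n] x = x ∧ (l : ℝ)⁻¹ = x.pathProd s.weight n := by
  obtain ⟨p, hp, hp', he⟩ := h.tile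
  have h0 : AboveZero p := ⟨hp'.1.le, hp'.2⟩
  obtain ⟨n, hn, hn'⟩ := exists_chain_eq_of_smul_eq h.mem hl hlω hp h0
  refine ⟨n, hn, ?_, ?_⟩
  · rw [shift_iterate_eq_self_iff]
    intro m
    rw [← he, ← he, chainEdge_add_of_chain_eq h0 hn']
  · have h1 := coe_eq_prod_of_chain_eq hn'
    simp only [he] at h1
    exact h1

theorem eq_of_tile (h : s.Coded g ω x) (h' : s.Coded g ω' x) {p : AdmissibleTile × A}
    (hp : p ∈ ω.tiles) (hp' : p ∈ ω'.tiles) (h1 : p.1.x₁ < 0) (h2 : 0 < p.1.x₂) : ω = ω' := by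
  obtain ⟨l, -, hl, hlω⟩ := h.smul
  obtain ⟨l', -, hl', hlω'⟩ := h'.smul
  obtain ⟨n, hn, hx, hn'⟩ := h.exists_period hl hlω
  obtain ⟨m, hm, hx', hm'⟩ := h'.exists_period hl' hlω'
  -- The inverses of l and l' are the products over n and m edges of the same path, and both n and m
  -- are periods. Either power is therefore the inverse of the product over nm edges.
  have e : l ^ m = l' ^ n := by
    refine Subtype.ext ?_
    rw [Positive.val_pow, Positive.val_pow, ← inv_inj, ← inv_pow, ← inv_pow, hn', hm',
      ← pathProd_mul _ _ hx, ← pathProd_mul _ _ hx', mul_comm]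
  refine eq_of_smul_eq h.mem h'.mem (one_lt_pow' hl hm.ne') (ColoredTiling.pow_smul_eq hlω m) ?_
    hp hp' h1 h2
  rw [e]
  exact ColoredTiling.pow_smul_eq hlω' n

/-- Tiles of equal color have heights in one coset of G, so an element of G matches them; equal
addresses then match the left sides. Their tops may still differ, so the common tile is taken one
generation below. -/
theorem exists_smul_eq (h : s.Coded g ω x) (h' : s.Coded g ω' x) : ∃ t ∈ s.base, t • ω = ω' := by
  obtain ⟨p, hp, hp0, he⟩ := h.tile
  obtain ⟨q, hq, hq0, hf⟩ := h'.tile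
  have hp0' : AboveZero p := ⟨hp0.1.le, hp0.2⟩
  have hq0' : AboveZero q := ⟨hq0.1.le, hq0.2⟩
  obtain ⟨m, hm, hpm⟩ := (h.mem p hp).1
  obtain ⟨m', hm', hqm⟩ := (h'.mem q hq).1
  have hc : p.2 = q.2 := (congrArg Sigma.fst (he 0)).trans (congrArg Sigma.fst (hf 0)).symm
  have ht : m' * m⁻¹ ∈ s.base := mul_mem hm' (inv_mem hm)
  have hty : (scaleTile (m' * m⁻¹) p).1.y₁ = q.1.y₁ := by
    rw [scaleTile.y₁, hpm, hqm, ← Positive.val_mul, hc]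
    congr 1
    rw [mul_comm (g q.2) m, ← mul_assoc, inv_mul_cancel_right, mul_comm]
  have htx : (scaleTile (m' * m⁻¹) p).1.x₁ = q.1.x₁ := by
    rw [(hp0'.scale _).x₁_eq (s := s), hq0'.x₁_eq (s := s), hty]
    congr 3
    funext n
    rw [chainEdge_scaleTile hp0', he, hf]
  have hch := chain_congr (s := s) (hp0'.scale (m' * m⁻¹)) htx hty hc 0
  have hcoded := h.smul_base ht
  refine ⟨m' * m⁻¹, ht, hcoded.eq_of_tile h' (p := s.chain q (0 + 1)) ?_ ?_ ?_ ?_⟩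
  · rw [← hch]
    exact (desc_chain _ _).mem hcoded.mem (ColoredTiling.scaleTile_mem_smul.2 hp)
  · exact (desc_chain _ _).mem h'.mem hq
  · exact chain_x₁_neg hq0' hf h.interior _
  · exact (hq0'.chain _).2

/-- Let t be the product over d edges. The tile t p and the d-th tile of the chain of p have the
same color, height and address, hence the same children, so ω and t⁻¹ω share a tile. -/
theorem inv_prod_smul_eq (h : s.Coded g ω x) {d : ℕ} (hx : PeriodicPath.shift^[d] x = x) :
    (x.pathProd (fun e => s.τ e.1 e.2) d)⁻¹ • ω = ω := by
  obtain ⟨p, hp, hp0, he⟩ := h.tile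
  have hp0' : AboveZero p := ⟨hp0.1.le, hp0.2⟩
  set t := x.pathProd (fun e => s.τ e.1 e.2) d with ht
  have htb : t⁻¹ ∈ s.base := inv_mem (prod_τ_mem_base hx)
  have hxe := (shift_iterate_eq_self_iff x d).1 hx
  have hy : (scaleTile t p).1.y₁ = (s.chain p d).1.y₁ := by
    rw [chain_y₁, scaleTile.y₁, ht, coe_prod_τ]
    simp only [he]
    rfl
  have hx1 : (scaleTile t p).1.x₁ = (s.chain p d).1.x₁ := by
    rw [(hp0'.scale _).x₁_eq (s := s), (hp0'.chain d).x₁_eq (s := s), hy]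
    congr 3
    funext n
    rw [chainEdge_scaleTile hp0', ← chainEdge_add, he, he, add_comm, hxe]
  have hc : (scaleTile t p).2 = (s.chain p d).2 := by
    have h1 : s.chainEdge p d = s.chainEdge p 0 := by
      rw [he, he]
      simpa using hxe 0
    exact (congrArg Sigma.fst h1).symm
  have hch := chain_congr (s := s) (hp0'.scale t) hx1 hy hc 0
  rw [chain_scaleTile hp0'] at hch
  refine (h.smul_base htb).eq_of_tile h (p := s.chain p (0 + 1)) ?_ ?_ ?_ ?_
  · rw [← scaleTile.inv_scale t (s.chain p (0 + 1)), hch]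
    refine ColoredTiling.scaleTile_mem_smul.2 ((desc_chain _ _).mem h.mem ?_)
    exact (desc_chain _ _).mem h.mem hp
  · exact (desc_chain _ _).mem h.mem hp
  · exact chain_x₁_neg hp0' he h.interior _
  · exact (hp0'.chain _).2

end Coded

variable [Finite A]

/-- The least cycle of a coded orbit. -/
theorem Coded.isLeast (h : s.Coded g ω x) :
    IsLeast (s.multiplicativeCycles (MulAction.orbit s.base ω))
      (x.pathProd s.weight x.period)⁻¹ := by
  rw [multiplicativeCycles_orbit]
  constructor
  · refine ⟨(x.pathProd (fun e => s.τ e.1 e.2) x.period)⁻¹,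
      inv_mem (prod_τ_mem_base x.shift_iterate_period), ?_,
      h.inv_prod_smul_eq x.shift_iterate_period, ?_⟩
    · rw [one_lt_inv']
      change ((x.pathProd (fun e => s.τ e.1 e.2) x.period : PosReal) : ℝ) < 1
      rw [coe_prod_τ]
      exact pathProd_weight_lt_one x x.period_pos
    · rw [← coe_prod_τ]
      rfl
  · rintro _ ⟨l, hl, hl1, hlω, rfl⟩
    obtain ⟨n, hn, hx, hn'⟩ := h.exists_period hl1 hlω
    obtain ⟨k, rfl⟩ : x.period ∣ n := Function.IsPeriodicPt.minimalPeriod_dvd hx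
    rw [← inv_inv (l : ℝ), hn', mul_comm, pathProd_mul _ _ x.shift_iterate_period]
    have hk : k ≠ 0 := by
      rintro rfl
      simp at hn
    refine inv_anti₀ (pow_pos (pathProd_weight_pos _ _) _) ?_
    exact pow_le_of_le_one (pathProd_weight_pos _ _).le
      (pathProd_weight_lt_one x x.period_pos).le hk

theorem exists_coded (hω : ω ∈ s.tilings g) {l : PosReal} (hlb : l ∈ s.base) (hl : 1 < l)
    (h : l • ω = ω) (hs : ¬ω.HasSeparatingLine) : ∃ x, s.Coded g ω x := by
  obtain ⟨p, hp, hp0⟩ := exists_mem_column_of_not_hasSeparatingLine hs 0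
  have hp0' : AboveZero p := ⟨hp0.1.le, hp0.2⟩
  obtain ⟨n, hn, hn'⟩ := exists_chain_eq_of_smul_eq hω hl h hp hp0'
  exact ⟨⟨s.chainEdge p, tgt_chainEdge p, n, hn, chainEdge_add_of_chain_eq hp0' hn'⟩, hω,
    ⟨l, hlb, hl, h⟩, p, hp, hp0, fun _ => rfl⟩

/-- Every interior periodic path is the code of a tiling. -/
theorem exists_coded_of_interior (hg : s.IsCompatible g) (hx : Interior x) :
    ∃ ω, s.Coded g ω x := by
  set d := x.period with hd
  have hdx : PeriodicPath.shift^[d] x = x := x.shift_iterate_period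
  set t := x.pathProd (fun e => s.τ e.1 e.2) d with ht
  have htb : t ∈ s.base := prod_τ_mem_base hdx
  have hxe := (shift_iterate_eq_self_iff x d).1 hdx
  set a := (x.edge 0).1 with ha
  set h : ℝ := (g a : PosReal).1 with hh
  have hh0 : 0 < h := (g a).2
  set u := s.pos x.edge with hu
  have hu0 : 0 < u := pos_pos hx.1
  have hu1 : u < 1 := pos_lt_one hx.2
  -- The tile has height g(a) and places the origin at relative position u. The upper side 2h is
  -- arbitrary.
  let P : AdmissibleTile :=
    { x₁ := -(u * h), x₂ := h - u * h, y₁ := h, y₂ := 2 * h, y₁_pos := hh0,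
      y₁_lt_y₂ := by linarith, width_eq := by ring }
  let T : AdmissibleTile × A := (P, a)
  have hT0 : AboveZero T := by
    have h1 := mul_pos hu0 hh0
    have h2 := mul_lt_mul_of_pos_right hu1 hh0
    refine ⟨?_, ?_⟩
    · change -(u * h) ≤ 0
      linarith
    · change 0 < h - u * h
      linarith
  have hTe : ∀ n, s.chainEdge T n = x.edge n := chainEdge_eq hx rfl rfl
  -- Replacing T by its rescaled d-th descendant changes only y₂, to the value that fits: the d-th
  -- descendant of p is then exactly t p, which need not hold for T.
  set p := scaleTile t⁻¹ (s.chain T d) with hp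
  have hy : p.1.y₁ = T.1.y₁ := by
    rw [hp, scaleTile.y₁, chain_y₁]
    simp only [hTe]
    have h1 : (∏ i ∈ Finset.range d, s.weight (x.edge i)) = (t : ℝ) := (coe_prod_τ x d).symm
    have h2 : ((t⁻¹ : PosReal) : ℝ) = (t : ℝ)⁻¹ := rfl
    rw [h1, h2, inv_mul_cancel_left₀ t.2.ne']
  have hp0 : AboveZero p := (hT0.chain d).scale _
  have hpe : ∀ n, s.chainEdge p n = x.edge n := by
    intro n
    rw [hp, chainEdge_scaleTile (hT0.chain d), ← chainEdge_add, hTe, add_comm, hxe]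
  have hpx : p.1.x₁ = T.1.x₁ := by
    rw [hp0.x₁_eq (s := s), hT0.x₁_eq (s := s), hy]
    congr 3
    funext n
    rw [hpe, hTe]
  have hpc : p.2 = T.2 := congrArg Sigma.fst ((hpe 0).trans (hTe 0).symm)
  have hdesc : s.Desc p (scaleTile t⁻¹⁻¹ p) := by
    obtain ⟨d', hd'⟩ := Nat.exists_eq_succ_of_ne_zero x.period_pos.ne'
    rw [inv_inv, hp, scaleTile.scale_inv, ← hp]
    have h1 := chain_congr (s := s) hp0 hpx hy hpc d'
    change d = d' + 1 at hd'
    rw [hd', ← h1]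
    exact desc_chain _ _
  have ht1 : 1 < t⁻¹ := by
    rw [one_lt_inv']
    change (t : ℝ) < 1
    rw [ht, coe_prod_τ]
    exact pathProd_weight_lt_one x x.period_pos
  have hp1 : p.1.x₁ < 0 := by
    rw [hpx]
    change -(u * h) < 0
    linarith [mul_pos hu0 hh0]
  refine ⟨s.spanTiling p t⁻¹ ht1 hdesc hp1 hp0.2, ?_, ⟨t⁻¹, inv_mem htb, ht1,
    smul_spanTiling ht1 hdesc hp1 hp0.2⟩, p, mem_spanTiling ht1 hdesc hp1 hp0.2, ⟨hp1, hp0.2⟩, hpe⟩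
  refine spanTiling_mem_tilings hg ht1 hdesc hp1 hp0.2 (inv_mem htb) ⟨1, one_mem _, ?_⟩
  rw [hy, hpc, mul_one]

/-- The cycles of the substitution that do not follow the boundary of the tiles are in bijection
with the closed orbits without separating line. -/
theorem exists_interior_equiv (hg : s.IsCompatible g) :
    ∃ f : {q : s.Cycle // q.IsInterior} →
        {ξ : s.closedOrbits g // ξ.1 ∉ s.separatedClosedOrbits g},
      Function.Bijective f ∧
      ∀ q, IsLeast (s.multiplicativeCycles (f q).1.1) (cycleProd s.weight q.1)⁻¹ := by
  have hex : ∀ q : {q : s.Cycle // q.IsInterior}, ∃ ω, s.Coded g ω q.1.out := by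
    intro q
    refine exists_coded_of_interior hg ?_
    have h := q.2
    rw [← Quotient.out_eq q.1] at h
    exact h
  choose W hW using hex
  have hsep : ∀ q, MulAction.orbit s.base (W q) ∉ s.separatedClosedOrbits g := by
    rintro q ⟨-, ω, hω, h⟩
    obtain ⟨t, ht, rfl⟩ := mem_orbit_base_iff.1 hω
    exact ((hW q).smul_base ht).not_hasSeparatingLine h
  refine ⟨fun q => ⟨⟨_, (hW q).orbit_mem_closedOrbits⟩, hsep q⟩, ⟨?_, ?_⟩, ?_⟩
  · intro q q' h
    have h1 : MulAction.orbit s.base (W q) = MulAction.orbit s.base (W q') :=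
      congrArg (fun ξ => ξ.1.1) h
    have h2 : W q' ∈ MulAction.orbit s.base (W q) := by
      rw [h1]
      exact MulAction.mem_orbit_self _
    obtain ⟨t, ht, h3⟩ := mem_orbit_base_iff.1 h2
    have h4 := (hW q).smul_base ht
    rw [h3] at h4
    obtain ⟨k, hk⟩ := h4.exists_shift_iterate_eq (hW q')
    refine Subtype.ext ?_
    rw [← Quotient.out_eq q.1, ← Quotient.out_eq q'.1]
    exact Quotient.sound ⟨k, hk⟩
  · rintro ⟨⟨ξ, ω, hω, ⟨l, hlb, hl, hlω⟩, rfl⟩, hξ⟩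
    have hs : ¬ω.HasSeparatingLine := fun hs =>
      hξ ⟨⟨ω, hω, ⟨l, hlb, hl, hlω⟩, rfl⟩, ω, MulAction.mem_orbit_self ω, hs⟩
    obtain ⟨x, hx⟩ := exists_coded (Omega_subset_tilings hω) hlb hl hlω hs
    refine ⟨⟨⟦x⟧, hx.interior⟩, ?_⟩
    refine Subtype.ext (Subtype.ext ?_)
    change MulAction.orbit s.base (W ⟨⟦x⟧, hx.interior⟩) = MulAction.orbit s.base ω
    obtain ⟨k, hk⟩ : (cycleSetoid (Sigma.fst : s.Edge → A) s.tgt).r (⟦x⟧ : s.Cycle).out x :=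
      Quotient.exact (Quotient.out_eq _)
    have h1 := (hW ⟨⟦x⟧, hx.interior⟩).shift_iterate k
    rw [hk] at h1
    obtain ⟨t, ht, h2⟩ := h1.exists_smul_eq hx
    refine MulAction.orbit_eq_iff.2 ?_
    refine (MulAction.orbitRel s.base (ColoredTiling A)).symm (mem_orbit_base_iff.2 ⟨t, ht, h2⟩)
  · intro q
    have h := (hW q).isLeast
    have h1 : cycleProd s.weight q.1 = q.1.out.pathProd s.weight q.1.out.period := by
      conv_lhs => rw [← Quotient.out_eq q.1]
      rfl
    rw [h1]
    exact h

/-- Every closed orbit has a least cycle. -/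
theorem exists_isLeast_multiplicativeCycles {ξ : Set (ColoredTiling A)}
    (hξ : ξ ∈ s.closedOrbits g) : ∃ c, IsLeast (s.multiplicativeCycles ξ) c := by
  classical
  obtain ⟨ω, hω, ⟨l, hlb, hl, hlω⟩, rfl⟩ := hξ
  replace hω := Omega_subset_tilings hω
  rw [multiplicativeCycles_orbit]
  obtain ⟨p, hp, hp0⟩ := exists_mem_right hω 0
  have hp0 : AboveZero p := hp0
  -- The scalings are compared by the place of l⁻¹ p in the chain of p; the earliest place gives the
  -- least l, as heights decrease along the chain. The origin may be the left end of p, so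
  -- separating lines are allowed here.
  have hex : ∃ n, ∃ l ∈ s.base, 1 < l ∧ l • ω = ω ∧ scaleTile l⁻¹ p = s.chain p n := by
    obtain ⟨n, -, hn⟩ := exists_chain_eq_of_smul_eq hω hl hlω hp hp0
    exact ⟨n, l, hlb, hl, hlω, hn⟩
  obtain ⟨m, hmb, hm, hmω, hmn⟩ := Nat.find_spec hex
  refine ⟨m, ⟨m, hmb, hm, hmω, rfl⟩, ?_⟩
  rintro _ ⟨k, hkb, hk, hkω, rfl⟩
  obtain ⟨n, -, hn⟩ := exists_chain_eq_of_smul_eq hω hk hkω hp hp0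
  have hle := Nat.find_min' hex ⟨k, hkb, hk, hkω, hn⟩
  have h1 : (scaleTile k⁻¹ p).1.y₁ ≤ (scaleTile m⁻¹ p).1.y₁ := by
    rw [hn, hmn, ← Nat.add_sub_cancel' hle, chain_add]
    exact (desc_chain _ _).y₁_le
  have h2 : (k : ℝ)⁻¹ ≤ (m : ℝ)⁻¹ := le_of_mul_le_mul_right h1 p.1.y₁_pos
  exact (inv_le_inv₀ k.2 m.2).1 h2

end WeightedSubstitution

end

/-! ### Finiteness of the closed orbits with a separating line -/

noncomputable section

namespace WeightedSubstitution

variable {A : Type*} {s : WeightedSubstitution A} {g : A → PosReal} {ω ω' : ColoredTiling A}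

/-! ### Descendants along a side of a tile -/

section Side

variable (e : ∀ a : A, Fin (s.len a))

variable (s) in
/-- The color of the selected child. -/
def sideColor (e : ∀ a : A, Fin (s.len a)) (a : A) : A := s.σ a (e a)

variable (s) in
/-- The product of the weights along the selected children. -/
def sideProd (e : ∀ a : A, Fin (s.len a)) (a : A) (n : ℕ) : ℝ :=
  ∏ i ∈ Finset.range n, s.weight ⟨(s.sideColor e)^[i] a, e ((s.sideColor e)^[i] a)⟩

variable (s) in
/-- The `n`-th descendant along the selected children. -/
def sideChain (e : ∀ a : A, Fin (s.len a)) (p : AdmissibleTile × A) (n : ℕ) : AdmissibleTile × A :=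
  (fun q => s.child q (e q.2))^[n] p

theorem sideProd_pos (a : A) (n : ℕ) : 0 < s.sideProd e a n :=
  Finset.prod_pos fun _ _ => s.weight_pos _

theorem sideProd_add (a : A) (m n : ℕ) :
    s.sideProd e a (m + n) = s.sideProd e a m * s.sideProd e ((s.sideColor e)^[m] a) n := by
  rw [sideProd, Finset.prod_range_add]
  refine congrArg _ (Finset.prod_congr rfl fun i _ => ?_)
  rw [add_comm, Function.iterate_add_apply]

theorem sideProd_mul {a : A} {d : ℕ} (h : (s.sideColor e)^[d] a = a) (k : ℕ) :
    s.sideProd e a (k * d) = s.sideProd e a d ^ k := by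
  induction k with
  | zero => simp [sideProd]
  | succ k ih => rw [Nat.succ_mul, add_comm, sideProd_add, h, ih, pow_succ']

theorem sideChain_succ (p : AdmissibleTile × A) (n : ℕ) :
    s.sideChain e p (n + 1) = s.child (s.sideChain e p n) (e (s.sideChain e p n).2) :=
  Function.iterate_succ_apply' _ _ _

theorem sideChain_snd (p : AdmissibleTile × A) (n : ℕ) :
    (s.sideChain e p n).2 = (s.sideColor e)^[n] p.2 := by
  induction n with
  | zero => rfl
  | succ n ih =>
    rw [sideChain_succ, Function.iterate_succ_apply', ← ih]
    rfl

theorem sideChain_y₁ (p : AdmissibleTile × A) (n : ℕ) :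
    (s.sideChain e p n).1.y₁ = s.sideProd e p.2 n * p.1.y₁ := by
  induction n with
  | zero =>
    rw [sideProd, Finset.prod_range_zero, one_mul]
    rfl
  | succ n ih =>
    have h : s.sideProd e p.2 (n + 1) = s.sideProd e p.2 n *
        s.weight ⟨(s.sideColor e)^[n] p.2, e ((s.sideColor e)^[n] p.2)⟩ :=
      Finset.prod_range_succ _ _
    rw [sideChain_succ, child_y₁, ih, h, ← sideChain_snd]
    ring

/-- Passing to any child but the first moves the left side strictly to the right, and it can never
move back. -/
theorem Desc.exists_eq_sideChain_first {p q : AdmissibleTile × A} (h : s.Desc p q)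
    (hx : q.1.x₁ = p.1.x₁) : ∃ n, q = s.sideChain s.first p n := by
  induction h with
  | refl => exact ⟨0, rfl⟩
  | @tail r _ hpr hr ih =>
    obtain ⟨i, rfl⟩ := hr
    have h1 := Desc.x₁_le hpr
    have h2 := x₁_le_child_x₁ r i
    have h3 : r.1.x₁ = p.1.x₁ := by linarith
    obtain ⟨n, rfl⟩ := ih h3
    refine ⟨n + 1, ?_⟩
    rw [sideChain_succ]
    congr 1
    by_contra hi
    have h4 : ¬s.IsFirst ⟨_, i⟩ := fun h => hi (Fin.ext h)
    have h5 := mul_pos (s.sideChain s.first p n).1.y₁_pos (s.left_pos h4)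
    rw [child_x₁] at hx
    linarith

theorem Desc.exists_eq_sideChain_last {p q : AdmissibleTile × A} (h : s.Desc p q)
    (hx : q.1.x₂ = p.1.x₂) : ∃ n, q = s.sideChain s.last p n := by
  induction h with
  | refl => exact ⟨0, rfl⟩
  | @tail r _ hpr hr ih =>
    obtain ⟨i, rfl⟩ := hr
    have h1 := Desc.x₂_le hpr
    have h2 := child_x₂_le_x₂ r i
    have h3 : r.1.x₂ = p.1.x₂ := by linarith
    obtain ⟨n, rfl⟩ := ih h3
    refine ⟨n + 1, ?_⟩
    rw [sideChain_succ]
    congr 1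
    by_contra hi
    have h4 : ¬s.IsLast ⟨_, i⟩ := fun h => hi (Fin.ext (by
      have h' : (i : ℕ) + 1 = s.len _ := h
      exact Nat.eq_sub_of_add_eq h'))
    have h5 := mul_lt_mul_of_pos_left (s.left_add_weight_lt_one h4)
      (s.sideChain s.last p n).1.y₁_pos
    rw [child_x₂] at hx
    linarith [(s.sideChain s.last p n).1.width_eq]

end Side

/-! ### Commensurable pairs of colors -/

variable (s) in
/-- Both colors recur along the respective sides, after the same scaling. -/
def Commensurable (b b' : A) : Prop :=
  ∃ p q : ℕ, 0 < p ∧ 0 < q ∧ (s.sideColor s.last)^[p] b = b ∧ (s.sideColor s.first)^[q] b' = b' ∧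
    s.sideProd s.last b p = s.sideProd s.first b' q

variable (s) in
/-- The possible ratios of the heights of two tiles of colors `b` and `b'` that meet below the
common vertex of two children of a tile. -/
def ratios (C : ℝ) (a : A) (i j : Fin (s.len a)) (b b' : A) : Set ℝ :=
  {ρ | ∃ m k : ℕ, (s.sideColor s.last)^[m] (s.σ a i) = b ∧
    (s.sideColor s.first)^[k] (s.σ a j) = b' ∧
    ρ = (s.sideProd s.last (s.σ a i) m * s.weight ⟨a, i⟩) /
      (s.sideProd s.first (s.σ a j) k * s.weight ⟨a, j⟩) ∧ C⁻¹ ≤ ρ ∧ ρ ≤ C}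

theorem finite_zpow_mem_Icc {U d D : ℝ} (hU0 : 0 < U) (hU1 : U < 1) (hd : 0 < d) :
    {v : ℝ | (∃ n : ℤ, v = U ^ n) ∧ d ≤ v ∧ v ≤ D}.Finite := by
  obtain ⟨N₁, h₁⟩ := exists_pow_lt_of_lt_one hd hU1
  obtain ⟨N₂, h₂⟩ := pow_unbounded_of_one_lt D ((one_lt_inv₀ hU0).2 hU1)
  refine ((Set.finite_Icc (-(N₂ : ℤ)) N₁).image fun n : ℤ => U ^ n).subset ?_
  rintro _ ⟨⟨n, rfl⟩, hn, hn'⟩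
  refine ⟨n, ⟨?_, ?_⟩, rfl⟩
  · by_contra! h
    have h3 : U ^ (-(N₂ : ℤ)) ≤ U ^ n := zpow_le_zpow_right_of_le_one₀ hU0 hU1.le h.le
    rw [zpow_neg, zpow_natCast, ← inv_pow] at h3
    linarith
  · by_contra! h
    have h3 : U ^ n ≤ U ^ (N₁ : ℤ) := zpow_le_zpow_right_of_le_one₀ hU0 hU1.le h.le
    rw [zpow_natCast] at h3
    linarith

/-- The runs along a side are deterministic, so every way to reach b or b' is the shortest one
followed by a return. With U the common product in `Commensurable` and c the ratio for the shortest
runs, (ρ/c)^(pq) is an integral power of U. Only finitely many such powers lie in the compact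
interval of (0, ∞) given by C, and ρ > 0 is determined by the power. -/
theorem finite_ratios {C : ℝ} (hC : 0 < C) (a : A) (i j : Fin (s.len a)) {b b' : A}
    (h : s.Commensurable b b') : (s.ratios C a i j b b').Finite := by
  classical
  obtain ⟨p, q, hp, hq, hpb, hqb, hU⟩ := h
  set U := s.sideProd s.last b p with hUdef
  have hU0 : 0 < U := sideProd_pos _ _ _
  have hU1 : U < 1 := by
    obtain ⟨n, rfl⟩ := Nat.exists_eq_succ_of_ne_zero hp.ne'
    rw [hUdef, sideProd, Finset.prod_range_succ]
    exact mul_lt_one_of_nonneg_of_lt_one_right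
      (Finset.prod_le_one (fun _ _ => (s.weight_pos _).le) fun _ _ => (s.weight_lt_one _).le)
      (s.weight_pos _).le (s.weight_lt_one _)
  rcases Set.eq_empty_or_nonempty (s.ratios C a i j b b') with h | ⟨_, m₁, k₁, hm₁, hk₁, -⟩
  · rw [h]
    exact Set.finite_empty
  have hexm : ∃ m, (s.sideColor s.last)^[m] (s.σ a i) = b := ⟨m₁, hm₁⟩
  have hexk : ∃ k, (s.sideColor s.first)^[k] (s.σ a j) = b' := ⟨k₁, hk₁⟩
  set m₀ := Nat.find hexm
  set k₀ := Nat.find hexk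
  have hm₀ : (s.sideColor s.last)^[m₀] (s.σ a i) = b := Nat.find_spec hexm
  have hk₀ : (s.sideColor s.first)^[k₀] (s.σ a j) = b' := Nat.find_spec hexk
  set c := (s.sideProd s.last (s.σ a i) m₀ * s.weight ⟨a, i⟩) /
      (s.sideProd s.first (s.σ a j) k₀ * s.weight ⟨a, j⟩) with hc
  have hc0 : 0 < c := div_pos (mul_pos (sideProd_pos _ _ _) (s.weight_pos _))
    (mul_pos (sideProd_pos _ _ _) (s.weight_pos _))
  have hpow : ∀ ρ ∈ s.ratios C a i j b b', ∃ n : ℤ, (ρ / c) ^ (p * q) = U ^ n := by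
    rintro _ ⟨m, k, hm, hk, rfl, -⟩
    obtain ⟨m', rfl⟩ := Nat.exists_eq_add_of_le (Nat.find_min' hexm hm)
    obtain ⟨k', rfl⟩ := Nat.exists_eq_add_of_le (Nat.find_min' hexk hk)
    change (s.sideColor s.last)^[m₀ + m'] _ = _ at hm
    change (s.sideColor s.first)^[k₀ + k'] _ = _ at hk
    rw [add_comm, Function.iterate_add_apply, hm₀] at hm
    rw [add_comm, Function.iterate_add_apply, hk₀] at hk
    change ∃ n : ℤ, ((s.sideProd s.last (s.σ a i) (m₀ + m') * s.weight ⟨a, i⟩) /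
      (s.sideProd s.first (s.σ a j) (k₀ + k') * s.weight ⟨a, j⟩) / c) ^ (p * q) = U ^ n
    rw [sideProd_add, sideProd_add, hm₀, hk₀]
    have h1 : s.sideProd s.last b m' ^ p = U ^ m' := by
      rw [← sideProd_mul _ hm, mul_comm, sideProd_mul _ hpb]
    have h2 : s.sideProd s.first b' k' ^ q = U ^ k' := by
      rw [← sideProd_mul _ hk, mul_comm, sideProd_mul _ hqb, hU]
    have h3 : (s.sideProd s.last (s.σ a i) m₀ * s.sideProd s.last b m' * s.weight ⟨a, i⟩) /
        (s.sideProd s.first (s.σ a j) k₀ * s.sideProd s.first b' k' * s.weight ⟨a, j⟩) / c =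
        s.sideProd s.last b m' / s.sideProd s.first b' k' := by
      have e1 := (sideProd_pos s.last (s.σ a i) m₀).ne'
      have e2 := (sideProd_pos s.first (s.σ a j) k₀).ne'
      have e3 := (sideProd_pos s.first b' k').ne'
      have e4 := (s.weight_pos ⟨a, i⟩).ne'
      have e5 := (s.weight_pos ⟨a, j⟩).ne'
      rw [hc]
      field_simp
    refine ⟨(m' * q : ℕ) - (k' * p : ℕ), ?_⟩
    rw [h3, div_pow, zpow_sub₀ hU0.ne', zpow_natCast, zpow_natCast, pow_mul, h1, mul_comm p q,
      pow_mul, h2, pow_mul, pow_mul]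
  refine Set.Finite.of_finite_image (f := fun ρ => (ρ / c) ^ (p * q)) ?_ ?_
  · refine (finite_zpow_mem_Icc hU0 hU1 (d := (C⁻¹ / c) ^ (p * q)) (D := (C / c) ^ (p * q))
      (pow_pos (div_pos (inv_pos.2 hC) hc0) _)).subset ?_
    rintro _ ⟨ρ, hρ, rfl⟩
    refine ⟨hpow ρ hρ, ?_⟩
    obtain ⟨m, k, -, -, -, h1, h2⟩ := hρ
    have h0 := inv_pos.2 hC
    constructor
    · exact pow_le_pow_left₀ (div_pos h0 hc0).le (div_le_div_of_nonneg_right h1 hc0.le) _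
    · exact pow_le_pow_left₀ (div_pos (h0.trans_le h1) hc0).le
        (div_le_div_of_nonneg_right h2 hc0.le) _
  · intro ρ hρ ρ' hρ' h
    obtain ⟨m, k, -, -, -, h1, -⟩ := hρ
    obtain ⟨m', k', -, -, -, h1', -⟩ := hρ'
    have h0 := inv_pos.2 hC
    have h3 := (pow_left_inj₀ (div_pos (h0.trans_le h1) hc0).le
      (div_pos (h0.trans_le h1') hc0).le (mul_pos hp hq).ne').1 h
    exact (div_left_inj' hc0.ne').1 h3

end WeightedSubstitution

end

noncomputable section

namespace WeightedSubstitution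

variable {A : Type*} {s : WeightedSubstitution A} {g : A → PosReal} {ω ω' : ColoredTiling A}

/-! ### Tiles at a vertical line of an approximating tiling -/

/-- On the way from q to L there is a last tile whose base contains c in its interior; the right
side of the next one is at c. -/
theorem Desc.exists_last {q L : AdmissibleTile × A} (h : s.Desc q L) {c : ℝ} (hc : c < q.1.x₂)
    (hL : L.1.x₂ = c) : ∃ q', s.Desc q q' ∧ (q'.1.x₁ < c ∧ c < q'.1.x₂) ∧
      ∃ i, (s.child q' i).1.x₂ = c ∧ s.Desc (s.child q' i) L := by
  induction h using Relation.ReflTransGen.head_induction_on with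
  | refl => exact absurd hL hc.ne'
  | @head q r hqr hrL ih =>
    obtain ⟨i, rfl⟩ := hqr
    have h1 := Desc.x₂_le hrL
    have h2 := Desc.x₁_le hrL
    have h3 := x₁_le_child_x₁ q i
    have h4 := L.1.x₁_lt_x₂
    rw [hL] at h1 h4
    rcases h1.eq_or_lt with h | h
    · exact ⟨q, Relation.ReflTransGen.refl, ⟨by linarith, hc⟩, i, h.symm, hrL⟩
    · obtain ⟨q', hq', h'⟩ := ih h
      exact ⟨q', (desc_child q i).trans hq', h'⟩

/-- Some tile straddles the line where L and R touch, and both descend from it. Below the last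
straddling ancestor of L, two children meet on the line; from them L is reached along last letters
and R along first letters. The bounds on the ratio express that L and R share a height. -/
theorem exists_div_mem_ratios [Finite A] (hω : ω ∈ s.tilings g) (hs : ¬ω.HasSeparatingLine)
    {c : ℝ} (hc0 : 0 < c) (hc : ∀ e, c ≤ s.weight e) {L R : AdmissibleTile × A} (hL : L ∈ ω.tiles)
    (hR : R ∈ ω.tiles) (hx : L.1.x₂ = R.1.x₁) (h1 : L.1.y₁ < R.1.y₂) (h2 : R.1.y₁ < L.1.y₂) :
    ∃ a i j, L.1.y₁ / R.1.y₁ ∈ s.ratios c⁻¹ a i j L.2 R.2 := by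
  obtain ⟨q, hq, hq1, hq2⟩ := exists_mem_column_of_not_hasSeparatingLine hs L.1.x₂
  have hLx := L.1.x₁_lt_x₂
  have hRx := R.1.x₁_lt_x₂
  have hqL : s.Desc q L := by
    rcases le_total L.1.y₁ q.1.y₁ with h | h
    · exact desc_of_overlap hω hq hL hq1 (hLx.trans hq2) h
    · have := (desc_of_overlap hω hL hq (hLx.trans hq2) hq1 h).x₂_le
      linarith
  obtain ⟨q', hqq', ⟨hq1', hq2'⟩, i, hi, hiL⟩ := hqL.exists_last hq2 rfl
  have hq' := hqq'.mem hω hq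
  have hqR : s.Desc q' R := by
    rcases le_total R.1.y₁ q'.1.y₁ with h | h
    · exact desc_of_overlap hω hq' hR (by linarith) (by linarith) h
    · have := (desc_of_overlap hω hR hq' (by linarith) (by linarith) h).x₁_le
      linarith
  obtain ⟨j, hjR⟩ := hqR.eq_or_exists.resolve_left fun h => by
    rw [h] at hx
    linarith
  have hj1 := hjR.x₁_le
  have hj2 := hjR.x₂_le
  have hj : (s.child q' j).1.x₁ = R.1.x₁ := by
    refine hj1.eq_or_lt.resolve_right fun h => ?_
    have hij : i = j := by
      refine eq_of_child_overlap (p := q') ?_ ?_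
      · have := (s.child q' i).1.x₁_lt_x₂
        linarith
      · linarith
    rw [hij] at hi
    linarith
  obtain ⟨m, hm⟩ := hiL.exists_eq_sideChain_last hi.symm
  obtain ⟨k, hk⟩ := hjR.exists_eq_sideChain_first hj.symm
  refine ⟨q'.2, i, j, m, k, ?_, ?_, ?_, ?_, ?_⟩
  · rw [hm, sideChain_snd]
    rfl
  · rw [hk, sideChain_snd]
    rfl
  · have e1 : L.1.y₁ = s.sideProd s.last (s.σ q'.2 i) m * (s.weight ⟨q'.2, i⟩ * q'.1.y₁) := by
      rw [hm, sideChain_y₁, child_y₁]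
      rfl
    have e2 : R.1.y₁ = s.sideProd s.first (s.σ q'.2 j) k * (s.weight ⟨q'.2, j⟩ * q'.1.y₁) := by
      rw [hk, sideChain_y₁, child_y₁]
      rfl
    rw [e1, e2, ← mul_assoc, ← mul_assoc, mul_div_mul_right _ _ q'.1.y₁_pos.ne']
  · have h3 := mul_y₂_le hω hc hL
    rw [inv_inv, le_div_iff₀ R.1.y₁_pos]
    exact (mul_le_mul_of_nonneg_left h2.le hc0.le).trans h3
  · have h3 := mul_y₂_le hω hc hR
    rw [div_le_iff₀ R.1.y₁_pos, ← div_eq_inv_mul, le_div_iff₀ hc0, mul_comm]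
    exact (mul_le_mul_of_nonneg_left h1.le hc0.le).trans h3

/-- A tile meeting the height y has width at least c y and cannot fit into a narrower gap between L
and R. -/
theorem x₂_eq_x₁_of_sub_lt [Finite A] (hω : ω ∈ s.tilings g) {c : ℝ} (hc0 : 0 < c)
    (hc : ∀ e, c ≤ s.weight e) {L R : AdmissibleTile × A} (hL : L ∈ ω.tiles) (hR : R ∈ ω.tiles)
    (hLR : L.1.x₁ < R.1.x₁) {y : ℝ} (hLy : L.1.y₁ < y ∧ y < L.1.y₂)
    (hRy : R.1.y₁ < y ∧ y < R.1.y₂) (h : R.1.x₁ - L.1.x₂ < c * y) : L.1.x₂ = R.1.x₁ := by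
  have hLx := L.1.x₁_lt_x₂
  have hRx := R.1.x₁_lt_x₂
  rcases lt_trichotomy L.1.x₂ R.1.x₁ with h' | h' | h'
  · obtain ⟨x, hx1, hx2⟩ := exists_between h'
    obtain ⟨q, hq, ⟨hq1, hq2⟩, hq3, hq4⟩ := ω.exists_mem x (L.1.y₁_pos.trans hLy.1)
    have h1 := mul_y₂_le hω hc hq
    have h2 := mul_le_mul_of_nonneg_left hq4 hc0.le
    have h3 := q.1.width_eq
    rcases lt_or_ge q.1.x₁ L.1.x₂ with h4 | h4
    · have := ω.eq_of_overlap hq hL h4 (by linarith) (by linarith) (by linarith)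
      rw [this] at hq2
      linarith
    · have := ω.eq_of_overlap hq hR (by linarith) (by linarith) (by linarith) (by linarith)
      rw [this] at hq1
      linarith
  · exact h'
  · have := ω.eq_of_overlap hL hR (by linarith) h' (by linarith) (by linarith)
    rw [this] at hLR
    exact absurd hLR (lt_irrefl _)

variable (s) in
/-- The ratios of the heights of two tiles that meet at a line separating them. -/
def allRatios (C : ℝ) (b b' : A) : Set ℝ := {ρ | ∃ a i j, ρ ∈ s.ratios C a i j b b'}

theorem child_mem_of_congr (hω : ω ∈ s.tilings g) {p q : AdmissibleTile × A} (hp : p ∈ ω.tiles)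
    (hx : p.1.x₁ = q.1.x₁) (hy : p.1.y₁ = q.1.y₁) (hpq : p.2 = q.2) (i : Fin (s.len q.2)) :
    s.child q i ∈ ω.tiles := by
  obtain ⟨P, a⟩ := p
  obtain ⟨Q, b⟩ := q
  obtain rfl : a = b := hpq
  rw [← child_congr hx hy i]
  exact child_mem hω hp i

section Finite

variable [Finite A]

theorem finite_allRatios {C : ℝ} (hC : 0 < C) {b b' : A} (h : s.Commensurable b b') :
    (s.allRatios C b b').Finite := by
  refine (Set.finite_iUnion fun a => Set.finite_iUnion fun i => Set.finite_iUnion fun j =>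
    finite_ratios hC a i j h).subset ?_
  rintro ρ ⟨a, i, j, hρ⟩
  simp only [Set.mem_iUnion]
  exact ⟨a, i, j, hρ⟩

/-- In approximating tilings without separating line the corresponding tiles touch and have an
admissible ratio. Commensurability makes the set of ratios finite, hence closed, so the limit ratio
is admissible. -/
theorem div_mem_allRatios (hω : ω ∈ s.Omega g) {c : ℝ} (hc0 : 0 < c) (hc : ∀ e, c ≤ s.weight e)
    {L R : AdmissibleTile × A} (hL : L ∈ ω.tiles) (hR : R ∈ ω.tiles) (hx : L.1.x₂ = R.1.x₁)
    (h1 : L.1.y₁ < R.1.y₂) (h2 : R.1.y₁ < L.1.y₂) (hLR : s.Commensurable L.2 R.2) :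
    L.1.y₁ / R.1.y₁ ∈ s.allRatios c⁻¹ L.2 R.2 := by
  set F := (fun κ => κ * R.1.y₁) '' s.allRatios c⁻¹ L.2 R.2 with hF
  have hFc : IsClosed F := ((finite_allRatios (inv_pos.2 hc0) hLR).image _).isClosed
  obtain ⟨y, hy, hy'⟩ := exists_between
    (max_lt (lt_min L.1.y₁_lt_y₂ h1) (lt_min h2 R.1.y₁_lt_y₂))
  rw [max_lt_iff] at hy
  rw [lt_min_iff] at hy'
  have hLpos := L.1.y₁_pos
  have hy0 := hLpos.trans hy.1
  have hmem : L.1.y₁ ∈ closure F := by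
    rw [Metric.mem_closure_iff]
    intro ε hε
    have hC : 0 < 1 + c⁻¹ := by positivity
    -- The first four bounds keep the height y inside both approximating tiles, c y/2 makes the gap
    -- between them too small for a tile, L.y₁/2 keeps them in order, and ε/(1 + c⁻¹) bounds the
    -- error in the heights, the ratio being at most c⁻¹.
    obtain ⟨η, hη, hη'⟩ : ∃ η, 0 < η ∧ η < min (min (min (y - L.1.y₁) (L.1.y₂ - y))
        (min (y - R.1.y₁) (R.1.y₂ - y))) (min (min (c * y / 2) (L.1.y₁ / 2)) (ε / (1 + c⁻¹))) := by
      refine exists_between (lt_min (lt_min (lt_min ?_ ?_) (lt_min ?_ ?_))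
        (lt_min (lt_min ?_ ?_) ?_))
      · linarith
      · linarith
      · linarith
      · linarith
      · positivity
      · positivity
      · positivity
    simp only [lt_min_iff] at hη'
    obtain ⟨⟨⟨e1, e2⟩, e3, e4⟩, ⟨e5, e6⟩, e7⟩ := hη'
    obtain ⟨ω', ⟨hω', hs'⟩, ⟨P, hP, ⟨p1, p2⟩, p3, p4⟩, Q, hQ, ⟨q1, q2⟩, q3, q4⟩ :=
      ColoredTiling.exists_close_of_mem_closure hω hL hR hη
    rw [abs_le] at p1 p2 p4 q1 q2 q4
    have p3' := abs_le.1 p3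
    have q3' := abs_le.1 q3
    have hw := L.1.width_eq
    have hPQ : P.x₂ = Q.x₁ := by
      refine x₂_eq_x₁_of_sub_lt hω' hc0 hc hP hQ (y := y) ?_ ⟨?_, ?_⟩ ⟨?_, ?_⟩ ?_ <;> dsimp only <;>
        linarith
    obtain ⟨a, i, j, hκ⟩ := exists_div_mem_ratios hω' hs' hc0 hc hP hQ hPQ
      (show P.y₁ < Q.y₂ by linarith) (show Q.y₁ < P.y₂ by linarith)
    dsimp only at hκ
    refine ⟨_, ⟨_, ⟨a, i, j, hκ⟩, rfl⟩, ?_⟩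
    obtain ⟨-, -, -, -, -, hlo, hhi⟩ := hκ
    have hκ0 : 0 ≤ P.y₁ / Q.y₁ := (inv_pos.2 (inv_pos.2 hc0)).le.trans hlo
    have hPκ : P.y₁ = P.y₁ / Q.y₁ * Q.y₁ := (div_mul_cancel₀ _ Q.y₁_pos.ne').symm
    rw [Real.dist_eq]
    have e : L.1.y₁ - P.y₁ / Q.y₁ * R.1.y₁ =
        (L.1.y₁ - P.y₁) - P.y₁ / Q.y₁ * (R.1.y₁ - Q.y₁) := by
      linear_combination hPκ
    dsimp only
    rw [e]
    refine (abs_sub _ _).trans_lt ?_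
    rw [abs_mul, abs_of_nonneg hκ0]
    have h3 := mul_le_mul hhi q3 (abs_nonneg _) (inv_pos.2 hc0).le
    rw [lt_div_iff₀ hC] at e7
    linarith
  rw [hFc.closure_eq] at hmem
  obtain ⟨κ, hκ, hκ'⟩ := hmem
  have : L.1.y₁ / R.1.y₁ = κ := by
    rw [← hκ']
    exact mul_div_cancel_right₀ _ R.1.y₁_pos.ne'
  rwa [this]

/-! ### The pair of tiles at the separating line -/

theorem exists_meet (hω : ω ∈ s.tilings g) {l : PosReal} (hl : 1 < l) (h : l • ω = ω)
    (hs : ω.IsSeparatingLine 0) : ∃ L ∈ ω.tiles, ∃ R ∈ ω.tiles, (L.1.x₂ = 0 ∧ R.1.x₁ = 0) ∧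
      L.1.y₁ < R.1.y₂ ∧ R.1.y₁ < L.1.y₂ := by
  rw [isSeparatingLine_iff] at hs
  obtain ⟨L, hL, hL1, hL2⟩ := exists_mem_left hω 0
  obtain ⟨R₀, hR₀, hR1, hR2⟩ := exists_mem_right hω 0
  obtain ⟨N, hN⟩ := PosReal.exists_pow_mul_gt hl L.1.y₂ R₀.1.y₁_pos
  have hm := ColoredTiling.scaleTile_mem (ColoredTiling.pow_smul_eq h N) hR₀
  -- On the right, the column is followed down from a high enough enlargement of R₀ to the tile that
  -- contains the height of the top of L.
  obtain ⟨R, hR, hRx, hRy⟩ := exists_desc_mem (s := s) (scaleTile (l ^ N) R₀) (x := 0)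
    (y := L.1.y₂) (mul_nonpos_of_nonneg_of_nonpos (l ^ N).2.le hR1) (mul_pos (l ^ N).2 hR2)
    (L.1.y₁_pos.trans L.1.y₁_lt_y₂) (hN N le_rfl).le
  have hR' := hR.mem hω hm
  refine ⟨L, hL, R, hR', ⟨?_, ?_⟩, L.1.y₁_lt_y₂.trans_le hRy.2, hRy.1⟩
  · exact (hL2.eq_or_lt.resolve_right fun h => hs L hL ⟨hL1, h⟩).symm
  · exact hRx.1.eq_or_lt.resolve_right fun h => hs R hR' ⟨h, hRx.2⟩

theorem inv_mul_lt {l : PosReal} (hl : 1 < l) {y : ℝ} (hy : 0 < y) :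
    ((l⁻¹ : PosReal) : ℝ) * y < y := by
  have h : ((l⁻¹ : PosReal) : ℝ) < 1 := inv_lt_one_of_one_lt₀ hl
  exact mul_lt_of_lt_one_left hy h

/-- Both p and l⁻¹ p end on the axis, so the latter is reached by last children alone; comparing
colors and heights gives a closed run with product l⁻¹. -/
theorem exists_sideProd_last_eq (hω : ω ∈ s.tilings g) {l : PosReal} (hl : 1 < l) (h : l • ω = ω)
    {p : AdmissibleTile × A} (hp : p ∈ ω.tiles) (h0 : p.1.x₂ = 0) :
    ∃ n, 0 < n ∧ (s.sideColor s.last)^[n] p.2 = p.2 ∧ s.sideProd s.last p.2 n = (l : ℝ)⁻¹ := by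
  have hx := p.1.x₁_lt_x₂
  have hlt := inv_mul_lt hl p.1.y₁_pos
  have hd : s.Desc p (scaleTile l⁻¹ p) := by
    refine desc_of_overlap hω hp (ColoredTiling.scaleTile_mem (ColoredTiling.inv_smul_eq h) hp)
      ?_ ?_ hlt.le
    · rw [scaleTile.x₂, h0, mul_zero]
      linarith
    · rw [scaleTile.x₁, h0]
      exact mul_neg_of_pos_of_neg (l⁻¹).2 (by linarith)
  obtain ⟨n, hn⟩ := hd.exists_eq_sideChain_last (by rw [scaleTile.x₂, h0, mul_zero])
  refine ⟨n, Nat.pos_of_ne_zero ?_, ?_, ?_⟩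
  · rintro rfl
    have : scaleTile l⁻¹ p = p := hn
    have := congrArg (fun q => q.1.y₁) this
    rw [scaleTile.y₁] at this
    exact hlt.ne this
  · rw [← sideChain_snd, ← hn, scaleTile.snd]
  · have := sideChain_y₁ s.last p n
    rw [← hn, scaleTile.y₁] at this
    exact (mul_right_cancel₀ p.1.y₁_pos.ne' this).symm

theorem exists_sideProd_first_eq (hω : ω ∈ s.tilings g) {l : PosReal} (hl : 1 < l) (h : l • ω = ω)
    {p : AdmissibleTile × A} (hp : p ∈ ω.tiles) (h0 : p.1.x₁ = 0) :
    ∃ n, 0 < n ∧ (s.sideColor s.first)^[n] p.2 = p.2 ∧ s.sideProd s.first p.2 n = (l : ℝ)⁻¹ := by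
  have hx := p.1.x₁_lt_x₂
  have hlt := inv_mul_lt hl p.1.y₁_pos
  have hd : s.Desc p (scaleTile l⁻¹ p) := by
    refine desc_of_overlap hω hp (ColoredTiling.scaleTile_mem (ColoredTiling.inv_smul_eq h) hp)
      ?_ ?_ hlt.le
    · rw [scaleTile.x₂, h0]
      exact mul_pos (l⁻¹).2 (by linarith)
    · rw [scaleTile.x₁, h0, mul_zero]
      linarith
  obtain ⟨n, hn⟩ := hd.exists_eq_sideChain_first (by rw [scaleTile.x₁, h0, mul_zero])
  refine ⟨n, Nat.pos_of_ne_zero ?_, ?_, ?_⟩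
  · rintro rfl
    have : scaleTile l⁻¹ p = p := hn
    have := congrArg (fun q => q.1.y₁) this
    rw [scaleTile.y₁] at this
    exact hlt.ne this
  · rw [← sideChain_snd, ← hn, scaleTile.snd]
  · have := sideChain_y₁ s.first p n
    rw [← hn, scaleTile.y₁] at this
    exact (mul_right_cancel₀ p.1.y₁_pos.ne' this).symm

/-- The colors of tiles on the two sides of the vertical axis, and the ratio of their heights. -/
def IsCorner (ω : ColoredTiling A) (t : A × A × ℝ) : Prop :=
  ∃ L ∈ ω.tiles, ∃ R ∈ ω.tiles, (L.1.x₂ = 0 ∧ R.1.x₁ = 0) ∧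
    t = (L.2, R.2, L.1.y₁ / R.1.y₁)

variable (s) in
/-- The possible data of a corner of an invariant tiling. -/
def cornerData (C : ℝ) : Set (A × A × ℝ) :=
  {t | s.Commensurable t.1 t.2.1 ∧ t.2.2 ∈ s.allRatios C t.1 t.2.1}

theorem finite_cornerData {C : ℝ} (hC : 0 < C) : (s.cornerData C).Finite := by
  have h : ∀ b b' : A, {ρ | s.Commensurable b b' ∧ ρ ∈ s.allRatios C b b'}.Finite := by
    intro b b'
    by_cases hb : s.Commensurable b b'
    · exact (finite_allRatios hC hb).subset fun ρ hρ => hρ.2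
    · convert Set.finite_empty (α := ℝ)
      exact Set.eq_empty_of_forall_notMem fun ρ hρ => hb hρ.1
  refine (Set.finite_iUnion fun b => Set.finite_iUnion fun b' =>
    (h b b').image fun ρ => (b, b', ρ)).subset ?_
  rintro ⟨b, b', ρ⟩ ht
  simp only [Set.mem_iUnion]
  exact ⟨b, b', ρ, ht, rfl⟩

theorem exists_isCorner (hω : ω ∈ s.Omega g) {l : PosReal} (hl : 1 < l) (h : l • ω = ω)
    (hs : ω.IsSeparatingLine 0) {c : ℝ} (hc0 : 0 < c) (hc : ∀ e, c ≤ s.weight e) :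
    ∃ t ∈ s.cornerData c⁻¹, IsCorner ω t := by
  have hω' := Omega_subset_tilings hω
  obtain ⟨L, hL, R, hR, ⟨hL0, hR0⟩, h1, h2⟩ := exists_meet hω' hl h hs
  obtain ⟨n, hn, hnL, hnl⟩ := exists_sideProd_last_eq hω' hl h hL hL0
  obtain ⟨m, hm, hmR, hml⟩ := exists_sideProd_first_eq hω' hl h hR hR0
  -- The same l⁻¹ is a product of weights on both sides.
  have hLR : s.Commensurable L.2 R.2 := ⟨n, m, hn, hm, hnL, hmR, hnl.trans hml.symm⟩
  exact ⟨_, ⟨hLR, div_mem_allRatios hω hc0 hc hL hR (hL0.trans hR0.symm) h1 h2 hLR⟩,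
    L, hL, R, hR, ⟨hL0, hR0⟩, rfl⟩

theorem exists_pow_eq_pow (hω : ω ∈ s.tilings g) (hω' : ω' ∈ s.tilings g) {l l' : PosReal}
    (hl : 1 < l) (h : l • ω = ω) (hl' : 1 < l') (h' : l' • ω' = ω') {p q : AdmissibleTile × A}
    (hp : p ∈ ω.tiles) (hq : q ∈ ω'.tiles) (hp0 : p.1.x₂ = 0) (hq0 : q.1.x₂ = 0)
    (hpq : p.2 = q.2) : ∃ m n : ℕ, 0 < m ∧ l ^ m = l' ^ n := by
  obtain ⟨n, -, hnp, hnl⟩ := exists_sideProd_last_eq hω hl h hp hp0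
  obtain ⟨m, hm, hmq, hml⟩ := exists_sideProd_last_eq hω' hl' h' hq hq0
  refine ⟨m, n, hm, ?_⟩
  rw [← hpq] at hmq hml
  have e1 := sideProd_mul s.last hnp m
  have e2 := sideProd_mul s.last hmq n
  rw [mul_comm, e2, hnl, hml, inv_pow, inv_pow, inv_inj] at e1
  exact Subtype.ext e1.symm

/-- An element u of G matches the left heights, and equality of the ratios then matches the right
ones. The tops may differ, so children on both sides of the axis are compared. A common power of l
and l' provides a scaling that fixes both tilings. -/
theorem IsCorner.exists_smul_eq (hω : ω ∈ s.tilings g) (hω' : ω' ∈ s.tilings g) {l l' : PosReal}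
    (hl : 1 < l) (h : l • ω = ω) (hl' : 1 < l') (h' : l' • ω' = ω') (hs : ω.IsSeparatingLine 0)
    (hs' : ω'.IsSeparatingLine 0) {t : A × A × ℝ} (ht : IsCorner ω t) (ht' : IsCorner ω' t) :
    ∃ u ∈ s.base, u • ω = ω' := by
  obtain ⟨L, hL, R, hR, ⟨hL0, hR0⟩, rfl⟩ := ht
  obtain ⟨L', hL', R', hR', ⟨hL0', hR0'⟩, he⟩ := ht'
  rw [Prod.mk.injEq, Prod.mk.injEq] at he
  obtain ⟨heL, heR, her⟩ := he
  obtain ⟨m, hm, hmL⟩ := (hω L hL).1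
  obtain ⟨m', hm', hmL'⟩ := (hω' L' hL').1
  have hLy : ((m' * m⁻¹ : PosReal) : ℝ) * L.1.y₁ = L'.1.y₁ := by
    rw [hmL, hmL', heL]
    have : m' * m⁻¹ * (g L'.2 * m) = g L'.2 * m' := by
      rw [mul_comm (g L'.2) m, mul_assoc, inv_mul_cancel_left, mul_comm]
    exact congrArg Subtype.val this
  set u := m' * m⁻¹
  have hub : u ∈ s.base := mul_mem hm' (inv_mem hm)
  have hRy : (u : ℝ) * R.1.y₁ = R'.1.y₁ := by
    rw [div_eq_div_iff R.1.y₁_pos.ne' R'.1.y₁_pos.ne', ← hLy] at her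
    have := mul_left_cancel₀ L.1.y₁_pos.ne'
      (show L.1.y₁ * R'.1.y₁ = L.1.y₁ * (u * R.1.y₁) by linear_combination her)
    exact this.symm
  obtain ⟨k, k', hk, hkk⟩ := exists_pow_eq_pow hω hω' hl h hl' h' hL hL' hL0 hL0' heL
  have huω := smul_mem_tilings hω hub
  have h1 : l ^ k • u • ω = u • ω := by
    rw [smul_comm, ColoredTiling.pow_smul_eq h]
  have h2 : l ^ k • ω' = ω' := by
    rw [hkk, ColoredTiling.pow_smul_eq h']
  refine ⟨u, hub, eq_of_smul_eq_of_isSeparatingLine huω hω' (one_lt_pow' hl hk.ne') h1 h2 ?_ hs'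
    (p := s.child L' (s.last _)) (q := s.child R' (s.first _)) ?_ (child_mem hω' hL' _) ?_ ?_
    (child_mem hω' hR' _) ?_⟩
  · exact isSeparatingLine_zero (one_lt_pow' hl hk.ne') h1 (smul_hasSeparatingLine u ⟨0, hs⟩)
  · refine child_mem_of_congr huω (ColoredTiling.scaleTile_mem_smul.2 hL) ?_ hLy heL _
    have w1 := (scaleTile u L).1.width_eq
    have w2 := L'.1.width_eq
    rw [scaleTile.x₂, scaleTile.y₁, hL0, mul_zero] at w1
    linarith
  · have h3 : s.IsLast ⟨L'.2, s.last L'.2⟩ := Nat.sub_add_cancel (s.len_pos L'.2)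
    rw [child_x₂, s.left_add_weight_eq_one h3, mul_one, ← L'.1.width_eq, hL0']
    ring
  · refine child_mem_of_congr huω (ColoredTiling.scaleTile_mem_smul.2 hR) ?_ hRy heR _
    rw [scaleTile.x₁, hR0, hR0', mul_zero]
  · rw [child_x₁, s.left_eq_zero rfl, mul_zero, add_zero, hR0']

theorem finite_separatedClosedOrbits : (s.separatedClosedOrbits g).Finite := by
  obtain ⟨c, hc0, -, hc⟩ := s.exists_le_weight
  have hex : ∀ ξ ∈ s.separatedClosedOrbits g, ∃ t ∈ s.cornerData c⁻¹, ∃ ω ∈ s.Omega g,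
      (∃ l : PosReal, 1 < l ∧ l • ω = ω) ∧ ω.IsSeparatingLine 0 ∧ IsCorner ω t ∧
        ξ = MulAction.orbit s.base ω := by
    rintro _ ⟨⟨ω, hω, ⟨l, -, hl, h⟩, rfl⟩, ω', hω', hs⟩
    obtain ⟨u, -, rfl⟩ := mem_orbit_base_iff.1 hω'
    have hs' := smul_hasSeparatingLine u⁻¹ hs
    rw [inv_smul_smul] at hs'
    have hs0 := isSeparatingLine_zero hl h hs'
    obtain ⟨t, ht, ht'⟩ := exists_isCorner hω hl h hs0 hc0 hc
    exact ⟨t, ht, ω, hω, ⟨l, hl, h⟩, hs0, ht', rfl⟩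
  choose f hf hf' using hex
  have hfin : Finite (s.cornerData c⁻¹) := finite_cornerData (inv_pos.2 hc0)
  refine Set.finite_coe_iff.1 (Finite.of_injective
    (fun ξ : s.separatedClosedOrbits g => (⟨f ξ ξ.2, hf ξ ξ.2⟩ : s.cornerData c⁻¹)) ?_)
  rintro ⟨ξ, hξ⟩ ⟨ξ', hξ'⟩ he
  rw [Subtype.mk.injEq] at he ⊢
  obtain ⟨ω, hω, ⟨l, hl, h⟩, hs, ht, rfl⟩ := hf' ξ hξ
  obtain ⟨ω', hω', ⟨l', hl', h'⟩, hs', ht', rfl⟩ := hf' ξ' hξ'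
  rw [← he] at ht'
  obtain ⟨u, hu, rfl⟩ := ht.exists_smul_eq (Omega_subset_tilings hω) (Omega_subset_tilings hω')
    hl h hl' h' hs hs' ht'
  exact (MulAction.orbit_eq_iff.2 (mem_orbit_base_iff.2 ⟨u, hu, rfl⟩)).symm

end Finite

end WeightedSubstitution

end

noncomputable section

/-! ### Meromorphic functions in normal form -/

/-- Infinite order of the difference at one point spreads over the connected plane. Equality on
punctured neighborhoods then extends to the centers because both functions are in normal form. -/
theorem MeromorphicNFOn.eq_of_eventuallyEq {f g : ℂ → ℂ} (hf : MeromorphicNFOn f Set.univ)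
    (hg : MeromorphicNFOn g Set.univ) {z : ℂ} (h : f =ᶠ[nhds z] g) : f = g := by
  have hd : MeromorphicOn (f - g) Set.univ := hf.meromorphicOn.sub hg.meromorphicOn
  have hz : meromorphicOrderAt (f - g) z = ⊤ := by
    rw [meromorphicOrderAt_eq_top_iff]
    filter_upwards [h.filter_mono nhdsWithin_le_nhds] with w hw
    exact sub_eq_zero.2 hw
  funext x
  have hx : meromorphicOrderAt (f - g) x = ⊤ := by
    by_contra hne
    exact hd.meromorphicOrderAt_ne_top_of_isPreconnected isPreconnected_univ (Set.mem_univ x)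
      (Set.mem_univ z) hne hz
  rw [meromorphicOrderAt_eq_top_iff] at hx
  have hx' : f =ᶠ[nhdsWithin x {x}ᶜ] g := by
    filter_upwards [hx] with w hw
    exact sub_eq_zero.1 hw
  exact (((hf (Set.mem_univ x)).eventuallyEq_nhdsNE_iff_eventuallyEq_nhds
    (hg (Set.mem_univ x))).1 hx').eq_of_nhds

theorem toMeromorphicNFOn_eq_of_analyticAt {f : ℂ → ℂ} (hf : MeromorphicOn f Set.univ) {z : ℂ}
    (h : AnalyticAt ℂ f z) : toMeromorphicNFOn f Set.univ z = f z := by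
  rw [toMeromorphicNFOn_eq_toMeromorphicNFAt hf (Set.mem_univ z),
    toMeromorphicNFAt_eq_self.2 h.meromorphicNFAt]

theorem Differentiable.matrix_det {n : Type*} [Fintype n] [DecidableEq n] {B : ℂ → Matrix n n ℂ}
    (h : ∀ i j, Differentiable ℂ fun z => B z i j) : Differentiable ℂ fun z => (B z).det := by
  simp only [Matrix.det_apply]
  exact Differentiable.fun_sum fun σ _ =>
    (Differentiable.fun_finsetProd fun i _ => h _ _).const_smul _

theorem Complex.differentiable_ofReal_cpow {t : ℝ} (ht : 0 < t) :
    Differentiable ℂ fun z : ℂ => (t : ℂ) ^ z := fun _ =>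
  differentiableAt_id.const_cpow (Or.inl (by exact_mod_cast ht.ne'))

theorem Complex.inv_ofReal_cpow_neg {t : ℝ} (ht : 0 ≤ t) (z : ℂ) :
    ((t⁻¹ : ℝ) : ℂ) ^ (-z) = (t : ℂ) ^ z := by
  rw [Complex.ofReal_inv, Complex.inv_cpow_ofReal_nonneg ht, Complex.cpow_neg, inv_inv]

namespace WeightedSubstitution

open PeriodicPath

variable {A : Type*} {s : WeightedSubstitution A} {g : A → PosReal}

theorem IsZetaFunction.unique {Z Z' : ℂ → ℂ} (h : s.IsZetaFunction g Z)
    (h' : s.IsZetaFunction g Z') : Z = Z' := by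
  refine h.1.eq_of_eventuallyEq h'.1 (z := 2) ?_
  filter_upwards [(isOpen_lt continuous_const Complex.continuous_re).mem_nhds
    (show (1 : ℝ) < (2 : ℂ).re by norm_num)] with α hα
  exact (h.2 α hα).unique (h'.2 α hα)

section Determinants

variable [Fintype A] [DecidableEq A]

theorem differentiable_det_one_sub_M : Differentiable ℂ fun α => (1 - s.M α).det := by
  refine Differentiable.matrix_det fun a a' => ?_
  refine (differentiable_const ((1 : Matrix A A ℂ) a a')).sub ?_
  change Differentiable ℂ fun α => ∑ i : Fin (s.len a), if s.σ a i = a' then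
    ((s.τ a i : ℝ) : ℂ) ^ α else 0
  refine Differentiable.fun_sum fun i _ => ?_
  split_ifs
  · exact Complex.differentiable_ofReal_cpow (s.τ a i).2
  · exact differentiable_const 0

theorem differentiable_det_one_sub_MPlus : Differentiable ℂ fun α => (1 - s.MPlus α).det := by
  refine Differentiable.matrix_det fun a a' => ?_
  refine (differentiable_const ((1 : Matrix A A ℂ) a a')).sub ?_
  change Differentiable ℂ fun α => if s.σ a (s.first a) = a' then
    ((s.τ a (s.first a) : ℝ) : ℂ) ^ α else 0
  split_ifs
  · exact Complex.differentiable_ofReal_cpow (s.τ a _).2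
  · exact differentiable_const 0

theorem differentiable_det_one_sub_MMinus : Differentiable ℂ fun α => (1 - s.MMinus α).det := by
  refine Differentiable.matrix_det fun a a' => ?_
  refine (differentiable_const ((1 : Matrix A A ℂ) a a')).sub ?_
  change Differentiable ℂ fun α => if s.σ a (s.last a) = a' then
    ((s.τ a (s.last a) : ℝ) : ℂ) ^ α else 0
  split_ifs
  · exact Complex.differentiable_ofReal_cpow (s.τ a _).2
  · exact differentiable_const 0

end Determinants

/-! ### The minimum multiplicative cycles -/

section Finite

variable [Finite A]

theorem isLeast_minCycle {ξ : Set (ColoredTiling A)} (hξ : ξ ∈ s.closedOrbits g) :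
    IsLeast (s.multiplicativeCycles ξ) (s.minCycle ξ) := by
  obtain ⟨c, hc⟩ := exists_isLeast_multiplicativeCycles hξ
  rwa [minCycle, hc.csInf_eq]

theorem one_lt_minCycle {ξ : Set (ColoredTiling A)} (hξ : ξ ∈ s.closedOrbits g) :
    1 < s.minCycle ξ := by
  obtain ⟨l, -, hl, -, h⟩ := (isLeast_minCycle hξ).1
  rw [h]
  exact hl

theorem minCycle_pos {ξ : Set (ColoredTiling A)} (hξ : ξ ∈ s.closedOrbits g) :
    0 < s.minCycle ξ := zero_lt_one.trans (one_lt_minCycle hξ)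

theorem minCycle_cpow_neg_ne_one {ξ : Set (ColoredTiling A)} (hξ : ξ ∈ s.closedOrbits g) {α : ℂ}
    (hα : 0 < α.re) : (s.minCycle ξ : ℂ) ^ (-α) ≠ 1 := by
  intro h
  have h1 := Complex.norm_cpow_eq_rpow_re_of_pos (minCycle_pos hξ) (-α)
  rw [h, norm_one, Complex.neg_re] at h1
  exact (Real.rpow_lt_one_of_one_lt_of_neg (one_lt_minCycle hξ) (neg_neg_of_pos hα)).ne' h1

theorem exists_interior_equiv_minCycle (hg : s.IsCompatible g) :
    ∃ f : {q : s.Cycle // q.IsInterior} ≃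
        {ξ : s.closedOrbits g // ξ.1 ∉ s.separatedClosedOrbits g},
      ∀ q (α : ℂ), (s.minCycle (f q).1.1 : ℂ) ^ (-α) = ((cycleProd s.weight q.1 : ℝ) : ℂ) ^ α := by
  obtain ⟨f, hf, h⟩ := exists_interior_equiv hg
  refine ⟨Equiv.ofBijective f hf, fun q α => ?_⟩
  have h1 : s.minCycle (f q).1.1 = (cycleProd s.weight q.1)⁻¹ := (h q).csInf_eq
  have h2 := minCycle_pos (f q).1.2
  rw [h1] at h2
  change (s.minCycle (f q).1.1 : ℂ) ^ (-α) = _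
  rw [h1, Complex.inv_ofReal_cpow_neg (inv_pos.1 h2).le]

theorem zetaSep_eq (α : ℂ) : s.zetaSep g α = ∏ ξ ∈ (finite_separatedClosedOrbits
    (s := s) (g := g)).toFinset, (1 - (s.minCycle ξ : ℂ) ^ (-α))⁻¹ :=
  finprod_mem_eq_finite_toFinset_prod _ _

variable (s g) in
/-- The closed orbits with a separating line, as a subset of the closed orbits. -/
def separatedSubset : Set (s.closedOrbits g) := {ξ | ξ.1 ∈ s.separatedClosedOrbits g}

variable (s g) in
def separatedEquiv : s.separatedSubset g ≃ s.separatedClosedOrbits g where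
  toFun ξ := ⟨ξ.1.1, ξ.2⟩
  invFun ξ := ⟨⟨ξ.1, ξ.2.1⟩, ξ.2⟩
  left_inv _ := rfl
  right_inv _ := rfl

theorem finite_separatedSubset : Finite (s.separatedSubset g) :=
  have : Finite (s.separatedClosedOrbits g) := finite_separatedClosedOrbits
  Finite.of_equiv _ (separatedEquiv s g).symm

theorem hasProd_separatedSubset (α : ℂ) :
    HasProd (fun ξ : s.separatedSubset g => (1 - (s.minCycle ξ.1.1 : ℂ) ^ (-α))⁻¹)
      (s.zetaSep g α) := by
  have : Finite (s.separatedClosedOrbits g) := finite_separatedClosedOrbits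
  have := Fintype.ofFinite (s.separatedClosedOrbits g)
  rw [zetaSep, ← finprod_set_coe_eq_finprod_mem, finprod_eq_prod_of_fintype]
  exact (separatedEquiv s g).hasProd_iff.2
    (hasProd_fintype fun ξ : s.separatedClosedOrbits g => (1 - (s.minCycle ξ.1 : ℂ) ^ (-α))⁻¹)

theorem differentiable_one_sub_minCycle {ξ : Set (ColoredTiling A)} (hξ : ξ ∈ s.closedOrbits g) :
    Differentiable ℂ fun α : ℂ => 1 - (s.minCycle ξ : ℂ) ^ (-α) :=
  (differentiable_const 1).sub
    ((Complex.differentiable_ofReal_cpow (minCycle_pos hξ)).comp differentiable_neg)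

theorem meromorphicAt_zetaSep (α : ℂ) : MeromorphicAt (s.zetaSep g) α := by
  rw [funext (zetaSep_eq (s := s) (g := g))]
  refine MeromorphicAt.fun_prod fun ξ hξ => ?_
  exact ((differentiable_one_sub_minCycle
    ((Set.Finite.mem_toFinset _).1 hξ).1).analyticAt α).meromorphicAt.inv

theorem analyticAt_zetaSep {α : ℂ}
    (h : ∀ ξ ∈ s.separatedClosedOrbits g, (s.minCycle ξ : ℂ) ^ (-α) ≠ 1) :
    AnalyticAt ℂ (s.zetaSep g) α := by
  rw [funext (zetaSep_eq (s := s) (g := g))]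
  refine Finset.analyticAt_fun_prod _ fun ξ hξ => ?_
  rw [Set.Finite.mem_toFinset] at hξ
  exact ((differentiable_one_sub_minCycle hξ.1).analyticAt α).fun_inv
    (sub_ne_zero.2 (h ξ hξ).symm)

end Finite

/-! ### The zeta function -/

section Zeta

variable [Fintype A] [DecidableEq A]

variable (s g) in
/-- The expression of the zeta function in terms of determinants. -/
def zetaFormula (α : ℂ) : ℂ :=
  (1 - s.MPlus α).det * (1 - s.MMinus α).det / (1 - s.M α).det * s.zetaSep g α

theorem meromorphicOn_zetaFormula : MeromorphicOn (s.zetaFormula g) Set.univ := fun α _ =>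
  (((differentiable_det_one_sub_MPlus.analyticAt α).meromorphicAt.mul
    (differentiable_det_one_sub_MMinus.analyticAt α).meromorphicAt).div
    (differentiable_det_one_sub_M.analyticAt α).meromorphicAt).mul (meromorphicAt_zetaSep α)

theorem analyticAt_zetaFormula {α : ℂ} (hα : (1 - s.M α).det ≠ 0)
    (h : ∀ ξ ∈ s.separatedClosedOrbits g, (s.minCycle ξ : ℂ) ^ (-α) ≠ 1) :
    AnalyticAt ℂ (s.zetaFormula g) α :=
  (((differentiable_det_one_sub_MPlus.analyticAt α).mul
    (differentiable_det_one_sub_MMinus.analyticAt α)).div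
    (differentiable_det_one_sub_M.analyticAt α) hα).mul (analyticAt_zetaSep h)

variable [Nonempty A]

theorem summable_minCycle (hg : s.IsCompatible g) {α : ℂ} (hα : 1 < α.re) :
    Summable fun ξ : s.closedOrbits g => ‖(s.minCycle ξ.1 : ℂ) ^ (-α)‖ := by
  obtain ⟨f, hf⟩ := exists_interior_equiv_minCycle hg
  have := finite_separatedSubset (s := s) (g := g)
  refine (summable_subtype_and_compl (s := s.separatedSubset g)).1 ⟨Summable.of_finite, ?_⟩
  refine f.summable_iff.1 ?_
  have h := (s.summable_cycleProd hα).subtype (fun q : s.Cycle => q.IsInterior)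
  refine h.congr fun q => ?_
  exact congrArg norm (hf q α).symm

/-- The closed orbits split into the finitely many with a separating line, which give `zetaSep`, and
the others, whose product is transported to the interior cycles. -/
theorem hasProd_zetaFormula (hg : s.IsCompatible g) {α : ℂ} (hα : 1 < α.re) :
    HasProd (fun ξ : s.closedOrbits g => (1 - (s.minCycle ξ.1 : ℂ) ^ (-α))⁻¹)
      (s.zetaFormula g α) := by
  obtain ⟨f, hf⟩ := exists_interior_equiv_minCycle hg
  rw [zetaFormula, mul_comm]
  refine HasProd.mul_compl (s := s.separatedSubset g) (hasProd_separatedSubset α) ?_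
  have h := s.hasProd_interior hα
  simp only [← hf] at h
  exact f.hasProd_iff.1 h

/-- Passing to the normal form changes no value where the formula is analytic. This covers Re α > 1,
where neither the determinant of I - M_α nor any factor of the separated product vanishes. -/
theorem isZetaFunction_toMeromorphicNFOn (hg : s.IsCompatible g) :
    s.IsZetaFunction g (toMeromorphicNFOn (s.zetaFormula g) Set.univ) := by
  refine ⟨meromorphicNFOn_toMeromorphicNFOn _ _, fun α hα => ?_⟩
  rw [toMeromorphicNFOn_eq_of_analyticAt meromorphicOn_zetaFormula
    (analyticAt_zetaFormula (s.det_one_sub_M_ne_zero hα)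
      fun ξ hξ => minCycle_cpow_neg_ne_one hξ.1 (zero_lt_one.trans hα))]
  exact hasProd_zetaFormula hg hα

end Zeta

end WeightedSubstitution

end

theorem theorem4p1 {A : Type*} [Fintype A] [Nonempty A] [DecidableEq A]
    (s : WeightedSubstitution A) (hs : s.IsPrimitive)
    (g : A → PosReal) (hg : s.IsCompatible g) :
    -- every closed orbit has a minimum multiplicative cycle
    (∀ ξ ∈ s.closedOrbits g, IsLeast (s.multiplicativeCycles ξ) (s.minCycle ξ)) ∧
    -- the product over all closed orbits converges absolutely for `Re α > 1`
    (∀ α : ℂ, 1 < α.re →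
      Summable fun ξ : s.closedOrbits g => ‖(s.minCycle ξ.1 : ℂ) ^ (-α)‖) ∧
    -- it has a unique meromorphic extension to the whole plane
    (∃! Z : ℂ → ℂ, s.IsZetaFunction g Z) ∧
    -- the product over the closed orbits with a separating line is finite
    (s.separatedClosedOrbits g).Finite ∧
    -- the denominator does not vanish in the region of convergence
    (∀ α : ℂ, 1 < α.re → (1 - s.M α).det ≠ 0) ∧
    -- the formula, as an identity of meromorphic functions, and pointwise wherever no
    -- denominator in it vanishes
    ∀ Z : ℂ → ℂ, s.IsZetaFunction g Z →
      (Z =ᶠ[Filter.codiscrete ℂ] fun α =>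
        (1 - s.MPlus α).det * (1 - s.MMinus α).det / (1 - s.M α).det * s.zetaSep g α) ∧
      ∀ α : ℂ, (1 - s.M α).det ≠ 0 →
        (∀ ξ ∈ s.separatedClosedOrbits g, (s.minCycle ξ : ℂ) ^ (-α) ≠ 1) →
        Z α = (1 - s.MPlus α).det * (1 - s.MMinus α).det / (1 - s.M α).det * s.zetaSep g α := by
  have hZ₀ := WeightedSubstitution.isZetaFunction_toMeromorphicNFOn hg
  refine ⟨fun ξ hξ => WeightedSubstitution.isLeast_minCycle hξ,
    fun α hα => WeightedSubstitution.summable_minCycle hg hα,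
    ⟨_, hZ₀, fun Z hZ => hZ.unique hZ₀⟩, WeightedSubstitution.finite_separatedClosedOrbits,
    fun α hα => s.det_one_sub_M_ne_zero hα, fun Z hZ => ?_⟩
  rw [hZ.unique hZ₀]
  exact ⟨(toMeromorphicNFOn_eqOn_codiscrete
      WeightedSubstitution.meromorphicOn_zetaFormula).symm,
    fun α hα h => toMeromorphicNFOn_eq_of_analyticAt
      WeightedSubstitution.meromorphicOn_zetaFormula
      (WeightedSubstitution.analyticAt_zetaFormula hα h)⟩
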